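/- Let $\mu>0$, $k,\eta,s,A,B\in\mathbb R$ and $m\in\mathbb N=\{0,1,2,\dots\}$, and put $$G(u)=-\Big(\frac A2+\frac{s}{2\mu}\Big)u^2-\frac{B}{m+1}u^{m+1}+\Big(2k+\frac{\eta}{\mu}\Big)u .$$ For functions $u,v,q$ of $\xi\in\mathbb R$ set $$K(\xi,\xi')=\exp\Big\{-\frac1{\sqrt\mu}\Big|\int_\xi^{\xi'}\cos^2\frac{v(r)}2\,q(r)\,dr\Big|\Big\}\Big\{G(u(\xi'))\cos^2\frac{v(\xi')}2+\frac s2\sin^2\frac{v(\xi')}2\Big\}q(\xi'),$$ $$P(\xi)=\frac1{2\sqrt\mu}\int_{-\infty}^{\infty}K(\xi,\xi')\,d\xi',\qquad P_x(\xi)=\frac1{2\mu}\Big(\int_\xi^\infty-\int_{-\infty}^\xi\Big)K(\xi,\xi')\,d\xi' .$$ Let $u_0\in H^1(\mathbb R)$ with weak derivative $u_{0x}$, and let $y_0:\mathbb R\to\mathbb R$ be the map determined by $\int_0^{y_0(\xi)}(1+u_{0x}^2)\,dx=\xi$. Consider the Cauchy problem $$\begin{aligned} u_t&=-P_x,\\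 v_t&=\frac1\mu(1+\cos v)\big(G(u)-P\big)-\frac s\mu\sin^2\frac v2,\\ q_t&=\frac1\mu\Big(\frac s2+G(u)-P\Big)\sin v\cdot q, \end{aligned} \qquad \begin{aligned} u(0,\xi)&=u_0(y_0(\xi)),\\ v(0,\xi)&=2\arctan u_{0x}(y_0(\xi)),\\ q(0,\xi)&=1, \end{aligned}$$ as an ordinary differential equation in the Banach space $$X=H^1(\mathbb R)\times\big[L^2(\mathbb R)\cap L^\infty(\mathbb R)\big]\times L^\infty(\mathbb R),\qquad \|(u,v,q)\|_X=\|u\|_{H^1}+\|v\|_{L^2}+\|v\|_{L^\infty}+\|q\|_{L^\infty}.$$ A global solution is a curve $t\mapsto(u,v,q)(t)\in X$, $t\in[0,\infty)$, which is differentiable in $X$ at every $t\ge0$ (from the right at $t=0$), satisfies the initial conditions for a.e. $\xi$, and is such that, for every $t\ge0$, the integrals defining $P(\xi)$ and $P_x(\xi)$ converge absolutely for every $\xi$ and the time derivative in $X$ equals the right-hand side of the system for a.e. $\xi$. Then the Cauchy problem has a global solution, and this solution is unique: any two global solutions coincide for all $t\ge0$. -/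

import Mathlib

open MeasureTheory Set

noncomputable section

namespace DualPowerCH

/-- The coefficients of the generalized Camassa-Holm equation with dual-power nonlinearities
`u_t - μ u_txx + 2k u_x + η u_xxx = (A u + B u^m) u_x + s (2 u_x u_xx + u u_xxx)`. -/
structure Coeffs where
  μ : ℝ
  k : ℝ
  η : ℝ
  s : ℝ
  A : ℝ
  B : ℝ
  m : ℕ

/-! ### The function spaces -/

/-- `g` is a weak derivative of `f` on the real line (both in `L²`). -/
def IsWeakDeriv (f g : Lp ℝ 2 (volume : Measure ℝ)) : Prop :=
  ∀ φ : ℝ → ℝ, ContDiff ℝ (⊤ : ℕ∞) φ → HasCompactSupport φ →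
    ∫ x, f x * deriv φ x = -∫ x, g x * φ x

lemma integrable_mul_of_compactSupport (f : Lp ℝ 2 (volume : Measure ℝ)) {ψ : ℝ → ℝ}
    (hc : Continuous ψ) (hs : HasCompactSupport ψ) : Integrable (fun x => f x * ψ x) :=
  (Lp.memLp f).integrable_mul (hc.memLp_of_hasCompactSupport (p := 2) hs)

/-- The Sobolev space `H¹(ℝ)`: pairs `(f, f')` of `L²` functions such that `f'` is the weak
derivative of `f` (which is determined by `f`).  The norm `max ‖f‖_{L²} ‖f'‖_{L²}` inherited from
the product is equivalent to the usual one. -/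
def H1 : Submodule ℝ (Lp ℝ 2 (volume : Measure ℝ) × Lp ℝ 2 (volume : Measure ℝ)) where
  carrier := {p | IsWeakDeriv p.1 p.2}
  zero_mem' := by
    intro φ _ _
    have h : ((0 : Lp ℝ 2 (volume : Measure ℝ)) : ℝ → ℝ) =ᵐ[volume] 0 := Lp.coeFn_zero _ _ _
    have h1 : ∫ x, (0 : Lp ℝ 2 (volume : Measure ℝ)) x * deriv φ x = 0 := by
      rw [integral_congr_ae (g := fun _ => (0 : ℝ))] <;> [simp; skip]
      filter_upwards [h] with x hx
      rw [hx, Pi.zero_apply, zero_mul]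
    have h2 : ∫ x, (0 : Lp ℝ 2 (volume : Measure ℝ)) x * φ x = 0 := by
      rw [integral_congr_ae (g := fun _ => (0 : ℝ))] <;> [simp; skip]
      filter_upwards [h] with x hx
      rw [hx, Pi.zero_apply, zero_mul]
    simp only [Prod.fst_zero, Prod.snd_zero]
    rw [h1, h2, neg_zero]
  add_mem' := by
    intro p r hp hr φ hφ hs
    have e1 := integrable_mul_of_compactSupport p.1 (hφ.continuous_deriv (by simp)) hs.deriv
    have e2 := integrable_mul_of_compactSupport r.1 (hφ.continuous_deriv (by simp)) hs.deriv
    have e3 := integrable_mul_of_compactSupport p.2 hφ.continuous hs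
    have e4 := integrable_mul_of_compactSupport r.2 hφ.continuous hs
    have h1 : ∫ x, (p.1 + r.1) x * deriv φ x
        = (∫ x, p.1 x * deriv φ x) + ∫ x, r.1 x * deriv φ x := by
      rw [← integral_add e1 e2]
      apply integral_congr_ae
      filter_upwards [Lp.coeFn_add p.1 r.1] with x hx
      rw [hx, Pi.add_apply, add_mul]
    have h2 : ∫ x, (p.2 + r.2) x * φ x = (∫ x, p.2 x * φ x) + ∫ x, r.2 x * φ x := by
      rw [← integral_add e3 e4]
      apply integral_congr_ae
      filter_upwards [Lp.coeFn_add p.2 r.2] with x hx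
      rw [hx, Pi.add_apply, add_mul]
    simp only [Prod.fst_add, Prod.snd_add]
    rw [h1, h2, hp φ hφ hs, hr φ hφ hs]
    ring
  smul_mem' := by
    intro c p hp φ hφ hs
    have h1 : ∫ x, (c • p.1) x * deriv φ x = c * ∫ x, p.1 x * deriv φ x := by
      rw [← integral_const_mul]
      apply integral_congr_ae
      filter_upwards [Lp.coeFn_smul c p.1] with x hx
      simp [hx, mul_assoc]
    have h2 : ∫ x, (c • p.2) x * φ x = c * ∫ x, p.2 x * φ x := by
      rw [← integral_const_mul]
      apply integral_congr_ae
      filter_upwards [Lp.coeFn_smul c p.2] with x hx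
      simp [hx, mul_assoc]
    simp only [Prod.smul_fst, Prod.smul_snd]
    rw [h1, h2, hp φ hφ hs]
    ring

/-- The underlying function of an element of `H¹(ℝ)`. -/
def H1.toFun (f : H1) : ℝ → ℝ := f.1.1

/-- The weak derivative of an element of `H¹(ℝ)`. -/
def H1.wderiv (f : H1) : ℝ → ℝ := f.1.2

/-- The space `L²(ℝ) ∩ L^∞(ℝ)`: pairs of an `L²` class and an `L^∞` class that agree almost
everywhere.  The inherited norm is `max ‖f‖_{L²} ‖f‖_{L^∞}`. -/
def L2Linf : Submodule ℝ (Lp ℝ 2 (volume : Measure ℝ) × Lp ℝ ⊤ (volume : Measure ℝ)) where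
  carrier := {p | (p.1 : ℝ → ℝ) =ᵐ[volume] p.2}
  zero_mem' := (Lp.coeFn_zero ℝ 2 volume).trans (Lp.coeFn_zero ℝ ⊤ volume).symm
  add_mem' := by
    intro p r hp hr
    have hp' : (p.1 : ℝ → ℝ) =ᵐ[volume] p.2 := hp
    have hr' : (r.1 : ℝ → ℝ) =ᵐ[volume] r.2 := hr
    exact ((Lp.coeFn_add p.1 r.1).trans (hp'.add hr')).trans (Lp.coeFn_add p.2 r.2).symm
  smul_mem' := by
    intro c p hp
    have hp' : (p.1 : ℝ → ℝ) =ᵐ[volume] p.2 := hp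
    exact ((Lp.coeFn_smul c p.1).trans (hp'.const_smul c)).trans (Lp.coeFn_smul c p.2).symm

/-- The underlying function of an element of `L²(ℝ) ∩ L^∞(ℝ)`. -/
def L2Linf.toFun (f : L2Linf) : ℝ → ℝ := f.1.1

/-- The phase space `X = H¹(ℝ) × (L²(ℝ) ∩ L^∞(ℝ)) × L^∞(ℝ)`.  Its norm is the maximum of the norms
of the components, which is equivalent to their sum. -/
abbrev X : Type := H1 × L2Linf × Lp ℝ ⊤ (volume : Measure ℝ)

/-- The `u`-component of a point of `X`, as a function of `ξ`. -/
def X.u (w : X) : ℝ → ℝ := H1.toFun w.1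

/-- The `v`-component of a point of `X`, as a function of `ξ`. -/
def X.v (w : X) : ℝ → ℝ := L2Linf.toFun w.2.1

/-- The `q`-component of a point of `X`, as a function of `ξ`. -/
def X.q (w : X) : ℝ → ℝ := w.2.2

/-! ### The nonlocal terms -/

/-- `G(u) = -(A/2 + s/(2μ)) u² - B/(m+1) u^(m+1) + (2k + η/μ) u`. -/
def G (c : Coeffs) (u : ℝ) : ℝ :=
  -(c.A / 2 + c.s / (2 * c.μ)) * u ^ 2 - c.B / (c.m + 1) * u ^ (c.m + 1)
    + (2 * c.k + c.η / c.μ) * u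

/-- The integrand common to `P` and `P_x`, as a function of `ξ'`. -/
def integrand (c : Coeffs) (w : X) (ξ ξ' : ℝ) : ℝ :=
  Real.exp (-(1 / √c.μ) * |∫ r in ξ..ξ', Real.cos (X.v w r / 2) ^ 2 * X.q w r|) *
    ((G c (X.u w ξ') * Real.cos (X.v w ξ' / 2) ^ 2 + c.s / 2 * Real.sin (X.v w ξ' / 2) ^ 2)
      * X.q w ξ')

/-- The nonlocal term `P`. -/
def P (c : Coeffs) (w : X) (ξ : ℝ) : ℝ :=
  1 / (2 * √c.μ) * ∫ ξ', integrand c w ξ ξ'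

/-- The nonlocal term `P_x` (a name, not a derivative in `ξ`). -/
def Px (c : Coeffs) (w : X) (ξ : ℝ) : ℝ :=
  1 / (2 * c.μ) * ((∫ ξ' in Ioi ξ, integrand c w ξ ξ') - ∫ ξ' in Iic ξ, integrand c w ξ ξ')

/-! ### The initial data -/

lemma exists_y₀ (u₀ : H1) (ξ : ℝ) : ∃ y : ℝ, ∫ x in (0 : ℝ)..y, (1 + (H1.wderiv u₀ x) ^ 2) = ξ := by
  have hint : ∀ a b : ℝ, IntervalIntegrable (fun x => 1 + (H1.wderiv u₀ x) ^ 2) volume a b := by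
    intro a b
    exact intervalIntegrable_const.add ((Lp.memLp u₀.1.2).integrable_sq.intervalIntegrable)
  have hsq : ∀ a b : ℝ, IntervalIntegrable (fun x => (H1.wderiv u₀ x) ^ 2) volume a b := fun a b =>
    (Lp.memLp u₀.1.2).integrable_sq.intervalIntegrable
  have hval : ∀ y : ℝ, ∫ x in (0 : ℝ)..y, (1 + (H1.wderiv u₀ x) ^ 2)
      = y + ∫ x in (0 : ℝ)..y, (H1.wderiv u₀ x) ^ 2 := by
    intro y
    rw [intervalIntegral.integral_add intervalIntegrable_const (hsq 0 y)]
    simp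
  have hcont : Continuous fun y : ℝ => ∫ x in (0 : ℝ)..y, (1 + (H1.wderiv u₀ x) ^ 2) :=
    intervalIntegral.continuous_primitive hint 0
  have htop : Filter.Tendsto (fun y : ℝ => ∫ x in (0 : ℝ)..y, (1 + (H1.wderiv u₀ x) ^ 2))
      Filter.atTop Filter.atTop := by
    refine Filter.tendsto_atTop_mono' _ ?_ Filter.tendsto_id
    filter_upwards [Filter.eventually_ge_atTop 0] with y hy
    have := intervalIntegral.integral_nonneg (μ := volume) hy
      (fun x _ => sq_nonneg (H1.wderiv u₀ x))
    simp only [id, hval]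
    linarith
  have hbot : Filter.Tendsto (fun y : ℝ => ∫ x in (0 : ℝ)..y, (1 + (H1.wderiv u₀ x) ^ 2))
      Filter.atBot Filter.atBot := by
    refine Filter.tendsto_atBot_mono' _ ?_ Filter.tendsto_id
    filter_upwards [Filter.eventually_le_atBot 0] with y hy
    have := intervalIntegral.integral_nonneg (μ := volume) hy
      (fun x _ => sq_nonneg (H1.wderiv u₀ x))
    rw [intervalIntegral.integral_symm] at this
    simp only [id, hval]
    linarith
  exact hcont.surjective htop hbot ξ

/-- The map `ξ ↦ y₀(ξ)` given by `∫₀^{y₀(ξ)} (1 + u₀'²) dx = ξ`; the integrand is at least `1`, so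
that the solution `y₀(ξ)` of this equation is unique. -/
def y₀ (u₀ : H1) (ξ : ℝ) : ℝ := (exists_y₀ u₀ ξ).choose

lemma y₀_spec (u₀ : H1) (ξ : ℝ) : ∫ x in (0 : ℝ)..y₀ u₀ ξ, (1 + (H1.wderiv u₀ x) ^ 2) = ξ :=
  (exists_y₀ u₀ ξ).choose_spec

/-! ### The Cauchy problem -/

/-- `w' ∈ X` is the value at `w ∈ X` of the right-hand side of the semilinear system: the integrals
in `P` and `P_x` converge and the three components of `w'` are those prescribed by the system. -/
structure IsRHS (c : Coeffs) (w w' : X) : Prop where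
  integrable : ∀ ξ, Integrable (integrand c w ξ)
  u_eq : ∀ᵐ ξ, X.u w' ξ = -Px c w ξ
  v_eq : ∀ᵐ ξ, X.v w' ξ =
    1 / c.μ * (1 + Real.cos (X.v w ξ)) * (G c (X.u w ξ) - P c w ξ)
      - c.s / c.μ * Real.sin (X.v w ξ / 2) ^ 2
  q_eq : ∀ᵐ ξ, X.q w' ξ =
    1 / c.μ * (c.s / 2 + G c (X.u w ξ) - P c w ξ) * Real.sin (X.v w ξ) * X.q w ξ

/-- `w = (u, v, q)` is a global solution, on the time interval `[0, ∞)`, of the semilinear system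
with the initial data determined by `u₀`; the system is an ordinary differential equation in `X`,
the time derivative being that of a curve in the normed space `X`.  Values at negative times are
irrelevant. -/
structure IsGlobalSolution (c : Coeffs) (u₀ : H1) (w : ℝ → X) : Prop where
  ode : ∀ t ∈ Ici (0 : ℝ), ∃ w' : X, HasDerivWithinAt w w' (Ici 0) t ∧ IsRHS c (w t) w'
  u_init : ∀ᵐ ξ, X.u (w 0) ξ = H1.toFun u₀ (y₀ u₀ ξ)
  v_init : ∀ᵐ ξ, X.v (w 0) ξ = 2 * Real.arctan (H1.wderiv u₀ (y₀ u₀ ξ))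
  q_init : ∀ᵐ ξ, X.q (w 0) ξ = 1

end DualPowerCH

end

/-! The system is an ODE `w' = F(w)` in `X`, studied on the set `posSet` where `q` is essentially
bounded below by a positive constant. There `q ≥ δ` and `∫ sin²(v/2) ≤ N` give `∫_x^y cos²(v/2) q ≥
δ (y - x - N)`, so the nonlocal kernel decays exponentially (`Region.kerAdm`). Young's inequality
then bounds `P` and `P_x` in `L²`, and `P` also in `L^∞`, together with their differences. The
one-sided integrals are absolutely continuous with explicit derivatives, so `-P_x` lies in `H¹`.
Hence `F` is locally Lipschitz on `posSet` (`vf_control`) and Picard-Lindelöf applies.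

Local solutions extend to all times because of two conservation laws. The defect `u_ξ - q sin(v/2)
cos(v/2)` has zero time derivative (`hasDeriv_defect`) and vanishes for the given data, since `y₀' =
1/(1 + u₀'²)`. When it vanishes, the energy density has an exact `ξ`-derivative as its time
derivative, so the energy `E` is constant (`hasDeriv_energy`). Now `E` bounds `sup |u|`
(`lb_u_of_energy`) and then `sup |P|` (`abs_P_le`), without any lower bound on `q` entering the
constants. Therefore `|q_t| ≤ Λ q`, and `q` stays between `e^{-Λt}` and `e^{Λt}` (`SolOn.q_bounds`).
This in turn bounds `∫ sin²(v/2)` by `E/(μδ)`. On such a region `F` grows at most linearly in the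
norm (`exists_bound_fullRHS`), so Gronwall bounds `‖w‖` on bounded time intervals
(`exists_apriori`). The Picard step length is then uniform, and finitely many steps reach any given
time (`exists_global_of_apriori`).

A competing solution is not assumed to keep `q` positive. The times up to which it agrees with the
constructed one form a closed set, and at a time of agreement it starts inside a ball of `posSet`,
where its derivative must be `F`; so agreement propagates (`SolOn.eqOn_of_locallyLipschitz`). -/

namespace DualPowerCH

/-! ### Absolutely continuous functions and weak derivatives -/

open Filter Topology

/-- `f` is a primitive of the locally integrable function `g`. -/
structure IsPrim (f g : ℝ → ℝ) : Prop where
  loc : LocallyIntegrable g volume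
  sub_eq : ∀ a b, f b - f a = ∫ x in a..b, g x

lemma _root_.MeasureTheory.LocallyIntegrable.intervalIntegrable' {g : ℝ → ℝ}
    (h : LocallyIntegrable g volume) (a b : ℝ) : IntervalIntegrable g volume a b :=
  intervalIntegrable_iff.mpr <|
      (h.integrableOn_isCompact isCompact_uIcc).mono_set uIoc_subset_uIcc

lemma isPrim_integral {g : ℝ → ℝ} (h : LocallyIntegrable g volume) (c : ℝ) :
    IsPrim (fun x => ∫ y in c..x, g y) g :=
  ⟨h, fun _ _ => intervalIntegral.integral_interval_sub_left
    (h.intervalIntegrable' _ _) (h.intervalIntegrable' _ _)⟩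

namespace IsPrim

variable {f g f₁ g₁ : ℝ → ℝ}

lemma eq_add (h : IsPrim f g) (a x : ℝ) : f x = f a + ∫ y in a..x, g y := by
  rw [← h.sub_eq]; ring

lemma continuous (h : IsPrim f g) : Continuous f := by
  have : f = fun x => f 0 + ∫ y in (0 : ℝ)..x, g y := funext fun x => h.eq_add 0 x
  rw [this]
  exact continuous_const.add
    (intervalIntegral.continuous_primitive (fun a b => h.loc.intervalIntegrable' a b) 0)

lemma absolutelyContinuous (h : IsPrim f g) (a b : ℝ) : AbsolutelyContinuousOnInterval f a b := by
  have : f = fun x => (fun _ => f a) x + ∫ y in a..x, g y := funext fun x => h.eq_add a x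
  rw [this]
  refine AbsolutelyContinuousOnInterval.add ?_
    ((h.loc.intervalIntegrable' a b).absolutelyContinuousOnInterval_intervalIntegral left_mem_uIcc)
  exact (LipschitzWith.const (f a)).lipschitzOnWith.absolutelyContinuousOnInterval

lemma ae_hasDerivAt (h : IsPrim f g) : ∀ᵐ x, HasDerivAt f (g x) x := by
  have : f = fun x => f 0 + ∫ y in (0 : ℝ)..x, g y := funext fun x => h.eq_add 0 x
  filter_upwards [LocallyIntegrable.ae_hasDerivAt_integral h.loc] with x hx
  rw [this]
  exact (hx 0).const_add _

/-- The fundamental theorem of calculus for absolutely continuous functions. It reduces the product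
and chain rules below to their pointwise a.e. versions. -/
lemma of_absolutelyContinuous (hac : ∀ a b, AbsolutelyContinuousOnInterval f a b)
    (hg : LocallyIntegrable g volume) (hd : ∀ᵐ x, HasDerivAt f (g x) x) : IsPrim f g := by
  refine ⟨hg, fun a b => ?_⟩
  rw [← (hac a b).integral_deriv_eq_sub]
  refine intervalIntegral.integral_congr_ae ?_
  filter_upwards [hd] with x hx _ using hx.deriv

lemma const_add (h : IsPrim f g) (c : ℝ) : IsPrim (fun x => c + f x) g :=
  ⟨h.loc, fun a b => by rw [← h.sub_eq]; ring⟩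

lemma add (h : IsPrim f g) (h₁ : IsPrim f₁ g₁) :
    IsPrim (fun x => f x + f₁ x) (fun x => g x + g₁ x) := by
  refine ⟨h.loc.add h₁.loc, fun a b => ?_⟩
  rw [intervalIntegral.integral_add (h.loc.intervalIntegrable' a b)
    (h₁.loc.intervalIntegrable' a b), ← h.sub_eq, ← h₁.sub_eq]
  ring

lemma const_mul (h : IsPrim f g) (c : ℝ) : IsPrim (fun x => c * f x) (fun x => c * g x) := by
  refine ⟨h.loc.smul c, fun a b => ?_⟩
  rw [intervalIntegral.integral_const_mul, ← h.sub_eq]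
  ring

lemma mul (h : IsPrim f g) (h₁ : IsPrim f₁ g₁) :
    IsPrim (fun x => f x * f₁ x) (fun x => g x * f₁ x + f x * g₁ x) := by
  refine of_absolutelyContinuous
    (fun a b => (h.absolutelyContinuous a b).mul (h₁.absolutelyContinuous a b)) ?_ ?_
  · exact (h.loc.mul_continuous h₁.continuous).add (h₁.loc.continuous_mul h.continuous)
  · filter_upwards [h.ae_hasDerivAt, h₁.ae_hasDerivAt] with x hx hx₁ using hx.mul hx₁

lemma comp {φ φ' : ℝ → ℝ} (hφ : ∀ x, HasDerivAt φ (φ' x) x) (hφ' : Continuous φ')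
    (h : IsPrim f g) : IsPrim (fun x => φ (f x)) (fun x => φ' (f x) * g x) := by
  refine of_absolutelyContinuous (fun a b => ?_)
    (h.loc.continuous_mul (hφ'.comp h.continuous)) ?_
  · obtain ⟨M, hM⟩ := (isCompact_uIcc (a := a) (b := b)).exists_bound_of_continuousOn
      h.continuous.continuousOn
    have hcd : ContDiff ℝ 1 φ := by
      rw [contDiff_one_iff_deriv]
      refine ⟨fun x => (hφ x).differentiableAt, ?_⟩
      rwa [show deriv φ = φ' from funext fun x => (hφ x).deriv]
    -- On `[a, b]` the values of `f` stay in `[-M, M]`, where the `C¹` function `φ` is Lipschitz. A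
    -- Lipschitz function of an absolutely continuous one is absolutely continuous; dividing `ε` by
    -- `K + 1` covers `K = 0`.
    obtain ⟨K, hK⟩ := hcd.contDiffOn.exists_lipschitzOnWith (by decide) (convex_Icc (-M) M)
      isCompact_Icc
    rw [absolutelyContinuousOnInterval_iff]
    intro ε hε
    obtain ⟨δ, hδ, hδ'⟩ := (absolutelyContinuousOnInterval_iff f a b).1
      (h.absolutelyContinuous a b) (ε / (K + 1)) (by positivity)
    refine ⟨δ, hδ, fun E hE hlt => ?_⟩
    have key := hδ' E hE hlt
    have hmem : ∀ x ∈ uIcc a b, f x ∈ Icc (-M) M := fun x hx => abs_le.1 (hM x hx)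
    calc _ ≤ ∑ i ∈ Finset.range E.1, (K : ℝ) * dist (f (E.2 i).1) (f (E.2 i).2) := by
            refine Finset.sum_le_sum fun i hi => ?_
            exact hK.dist_le_mul _ (hmem _ (hE.1 i hi).1) _ (hmem _ (hE.1 i hi).2)
      _ = K * ∑ i ∈ Finset.range E.1, dist (f (E.2 i).1) (f (E.2 i).2) := by
            rw [Finset.mul_sum]
      _ ≤ K * (ε / (K + 1)) := by gcongr
      _ < (K + 1) * (ε / (K + 1)) := by gcongr; linarith
      _ = ε := by field_simp
  · filter_upwards [h.ae_hasDerivAt] with x hx using (hφ _).comp x hx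

/-- Integrability of `g` makes `f` converge at infinity, and an integrable function cannot have a
nonzero limit there, because half-lines have infinite measure. -/
lemma tendsto_atTop_zero (h : IsPrim f g) (hf : Integrable f) (hg : Integrable g) :
    Tendsto f atTop (𝓝 0) := by
  have h1 : Tendsto f atTop (𝓝 (f 0 + ∫ y in Ioi (0 : ℝ), g y)) := by
    have := intervalIntegral_tendsto_integral_Ioi (0 : ℝ) hg.integrableOn tendsto_id
    refine (this.const_add (f 0)).congr fun x => (h.eq_add 0 x).symm
  have : IntegrableAtFilter f atTop volume := ⟨univ, univ_mem, hf.integrableOn⟩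
  rwa [this.eq_zero_of_tendsto ?_ h1] at h1
  intro s hs
  obtain ⟨b, hb⟩ := mem_atTop_sets.1 hs
  rw [← top_le_iff, ← Real.volume_Ici (a := b)]
  exact measure_mono hb

lemma tendsto_atBot_zero (h : IsPrim f g) (hf : Integrable f) (hg : Integrable g) :
    Tendsto f atBot (𝓝 0) := by
  have h1 : Tendsto f atBot (𝓝 (f 0 - ∫ y in Iic (0 : ℝ), g y)) := by
    have := intervalIntegral_tendsto_integral_Iic (0 : ℝ) hg.integrableOn tendsto_id
    refine (this.const_sub (f 0)).congr fun x => ?_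
    rw [id, ← h.sub_eq]; ring
  have : IntegrableAtFilter f atBot volume := ⟨univ, univ_mem, hf.integrableOn⟩
  rwa [this.eq_zero_of_tendsto ?_ h1] at h1
  intro s hs
  obtain ⟨b, hb⟩ := mem_atBot_sets.1 hs
  rw [← top_le_iff, ← Real.volume_Iic (a := b)]
  exact measure_mono hb

/-- Both boundary values at infinity vanish. This is the source of integration by parts and of the
conservation of energy. -/
lemma integral_eq_zero (h : IsPrim f g) (hf : Integrable f) (hg : Integrable g) :
    ∫ x, g x = 0 := by
  have h1 := intervalIntegral_tendsto_integral hg tendsto_neg_atTop_atBot tendsto_id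
  have h2 : Tendsto (fun x : ℝ => f x - f (-x)) atTop (𝓝 (0 - 0)) :=
    (h.tendsto_atTop_zero hf hg).sub ((h.tendsto_atBot_zero hf hg).comp tendsto_neg_atTop_atBot)
  rw [sub_zero] at h2
  exact tendsto_nhds_unique h1 (h2.congr fun x => h.sub_eq _ _)

lemma eq_integral_Iic (h : IsPrim f g) (hf : Integrable f) (hg : Integrable g) (x : ℝ) :
    f x = ∫ y in Iic x, g y := by
  have h1 := intervalIntegral_tendsto_integral_Iic x hg.integrableOn tendsto_id
  have h2 : Tendsto (fun y : ℝ => f x - f y) atBot (𝓝 (f x - 0)) :=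
    tendsto_const_nhds.sub (h.tendsto_atBot_zero hf hg)
  rw [sub_zero] at h2
  exact tendsto_nhds_unique (h2.congr fun y => h.sub_eq _ _) h1

lemma neg_eq_integral_Ioi (h : IsPrim f g) (hf : Integrable f) (hg : Integrable g) (x : ℝ) :
    -f x = ∫ y in Ioi x, g y := by
  have h1 := intervalIntegral_tendsto_integral_Ioi x hg.integrableOn tendsto_id
  have h2 : Tendsto (fun y : ℝ => f y - f x) atTop (𝓝 (0 - f x)) :=
    (h.tendsto_atTop_zero hf hg).sub tendsto_const_nhds
  rw [zero_sub] at h2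
  exact tendsto_nhds_unique (h2.congr fun y => h.sub_eq _ _) h1

/-- The factor `2` comes from writing `f x` both as an integral from `-∞` and as minus an integral
to `+∞`, and adding the two estimates. -/
lemma two_mul_abs_le (h : IsPrim f g) (hf : Integrable f) (hg : Integrable g) (x : ℝ) :
    2 * |f x| ≤ ∫ y, |g y| := by
  have e1 : |f x| ≤ ∫ y in Iic x, |g y| := by
    rw [h.eq_integral_Iic hf hg x]; exact abs_integral_le_integral_abs
  have e2 : |f x| ≤ ∫ y in Ioi x, |g y| := by
    rw [← abs_neg, h.neg_eq_integral_Ioi hf hg x]; exact abs_integral_le_integral_abs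
  have := intervalIntegral.integral_Iic_add_Ioi (b := x) hg.abs.integrableOn hg.abs.integrableOn
  linarith

end IsPrim

lemma isPrim_of_contDiff {φ : ℝ → ℝ} (hφ : ContDiff ℝ (⊤ : ℕ∞) φ) : IsPrim φ (deriv φ) := by
  have hc : Continuous (deriv φ) := hφ.continuous_deriv (by simp)
  refine ⟨hc.locallyIntegrable, fun a b => ?_⟩
  rw [intervalIntegral.integral_deriv_eq_sub
    (fun x _ => (hφ.differentiable (by simp)).differentiableAt) (hc.intervalIntegrable a b)]

/-- Integration by parts against a test function. -/
lemma IsPrim.integral_mul_deriv {f g : ℝ → ℝ} (h : IsPrim f g) {φ : ℝ → ℝ}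
    (hφ : ContDiff ℝ (⊤ : ℕ∞) φ) (hs : HasCompactSupport φ) :
    ∫ x, f x * deriv φ x = -∫ x, g x * φ x := by
  have hc : Continuous (deriv φ) := hφ.continuous_deriv (by simp)
  have e1 : Integrable fun x => f x * φ x :=
    (h.continuous.mul hφ.continuous).integrable_of_hasCompactSupport hs.mul_left
  have e2 : Integrable fun x => f x * deriv φ x :=
    (h.continuous.mul hc).integrable_of_hasCompactSupport hs.deriv.mul_left
  have e3 : Integrable fun x => g x * φ x := by
    simpa [mul_comm] using h.loc.integrable_smul_left_of_hasCompactSupport hφ.continuous hs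
  have := (h.mul (isPrim_of_contDiff hφ)).integral_eq_zero e1 (e3.add e2)
  rw [integral_add e3 e2] at this
  linarith

/-- A test function with zero mean is the derivative of a test function. -/
lemma exists_primitive_of_integral_eq_zero {χ : ℝ → ℝ} (hχ : ContDiff ℝ (⊤ : ℕ∞) χ)
    (hs : HasCompactSupport χ) (h0 : ∫ x, χ x = 0) :
    ∃ φ : ℝ → ℝ, ContDiff ℝ (⊤ : ℕ∞) φ ∧ HasCompactSupport φ ∧ deriv φ = χ := by
  obtain ⟨R, hR⟩ := hs.isCompact.isBounded.subset_closedBall 0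
  rw [Real.closedBall_eq_Icc] at hR
  simp only [zero_sub, zero_add] at hR
  have hz : ∀ x, x ∉ Icc (-R) R → χ x = 0 := fun x hx => image_eq_zero_of_notMem_tsupport
    fun h => hx (hR h)
  have hd : ∀ x, HasDerivAt (fun x => ∫ y in (-R)..x, χ y) (χ x) x := fun x =>
    intervalIntegral.integral_hasDerivAt_right (hχ.continuous.intervalIntegrable _ _)
      (hχ.continuous.stronglyMeasurableAtFilter _ _) hχ.continuous.continuousAt
  have hdd : deriv (fun x => ∫ y in (-R)..x, χ y) = χ := funext fun x => (hd x).deriv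
  -- The primitive starting at the left end of the support vanishes to the left of it by
  -- construction, and to the right because the mean of `χ` is zero.
  refine ⟨fun x => ∫ y in (-R)..x, χ y, ?_, ?_, hdd⟩
  · rw [contDiff_infty_iff_deriv, hdd]
    exact ⟨fun x => (hd x).differentiableAt, hχ⟩
  · refine HasCompactSupport.intro (isCompact_Icc (a := -R) (b := R)) fun x hx => ?_
    rw [mem_Icc, not_and_or, not_le, not_le] at hx
    rcases hx with hx | hx
    · have : EqOn χ 0 (uIcc (-R) x) := fun y hy => by
        rw [uIcc_of_ge hx.le] at hy
        rcases eq_or_lt_of_le hy.2 with h | h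
        -- At the endpoint `-R` itself, `χ` vanishes by continuity from the left.
        · have : IsClosed {y | χ y = 0} := isClosed_eq hχ.continuous continuous_const
          have h2 : closure (Iio (-R)) ⊆ {y | χ y = 0} :=
            closure_minimal (fun z hz' => hz z fun h => absurd h.1 (not_le.2 hz')) this
          rw [closure_Iio] at h2
          exact h2 hy.2
        · exact hz y fun h' => absurd h'.1 (not_le.2 h)
      rw [intervalIntegral.integral_congr this]
      simp
    · rw [← h0]
      have hsub : Function.support χ ⊆ Ioc (-R) x := by
        intro y hy
        have h1 := hR (subset_tsupport _ hy)
        refine ⟨lt_of_le_of_ne h1.1 ?_, h1.2.trans hx.le⟩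
        rintro rfl
        have : IsClosed {y | χ y = 0} := isClosed_eq hχ.continuous continuous_const
        have h2 : closure (Iio (-R)) ⊆ {y | χ y = 0} :=
          closure_minimal (fun z hz' => hz z fun h => absurd h.1 (not_le.2 hz')) this
        rw [closure_Iio] at h2
        exact hy (h2 (mem_Iic.2 le_rfl))
      exact intervalIntegral.integral_eq_integral_of_support_subset hsub

/-- A locally integrable function whose weak derivative is locally integrable has an absolutely
continuous representative. -/
lemma exists_isPrim_of_weakDeriv {f g : ℝ → ℝ} (hf : LocallyIntegrable f volume)
    (hg : LocallyIntegrable g volume)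
    (h : ∀ φ : ℝ → ℝ, ContDiff ℝ (⊤ : ℕ∞) φ → HasCompactSupport φ →
      ∫ x, f x * deriv φ x = -∫ x, g x * φ x) :
    ∃ F : ℝ → ℝ, F =ᵐ[volume] f ∧ IsPrim F g := by
  set U : ℝ → ℝ := fun x => ∫ y in (0 : ℝ)..x, g y with hU
  have hUp : IsPrim U g := isPrim_integral hg 0
  have hUl : LocallyIntegrable U volume := hUp.continuous.locallyIntegrable
  have hl : LocallyIntegrable (fun x => f x - U x) volume := hf.sub hUl
  have I : ∀ {k : ℝ → ℝ} (_ : LocallyIntegrable k volume) {ψ : ℝ → ℝ} (_ : Continuous ψ)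
      (_ : HasCompactSupport ψ), Integrable fun x => ψ x * k x := fun hk _ hc hs => by
    simpa using hk.integrable_smul_left_of_hasCompactSupport hc hs
  have h0 : ∀ φ : ℝ → ℝ, ContDiff ℝ (⊤ : ℕ∞) φ → HasCompactSupport φ →
      ∫ x, deriv φ x * (f x - U x) = 0 := by
    intro φ hφ hs
    have hc : Continuous (deriv φ) := hφ.continuous_deriv (by simp)
    have e1 := h φ hφ hs
    have e2 := hUp.integral_mul_deriv hφ hs
    simp_rw [mul_sub]
    rw [integral_sub (I hf hc hs.deriv) (I hUl hc hs.deriv)]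
    simp_rw [mul_comm (deriv φ _)]
    rw [e1, e2, sub_self]
  let b : ContDiffBump (0 : ℝ) := default
  let ρ : ℝ → ℝ := b.normed volume
  have hρ : ContDiff ℝ (⊤ : ℕ∞) ρ := b.contDiff_normed
  have hρs : HasCompactSupport ρ := b.hasCompactSupport_normed
  have hρ1 : ∫ x, ρ x = 1 := b.integral_normed
  set C : ℝ := ∫ x, ρ x * (f x - U x) with hC
  have key : ∀ᵐ x, f x - U x = C := by
    refine ae_eq_of_integral_contDiff_smul_eq hl continuous_const.locallyIntegrable
      fun ψ hψ hψs => ?_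
    set m : ℝ := ∫ x, ψ x with hm
    have hψi : Integrable ψ := hψ.continuous.integrable_of_hasCompactSupport hψs
    have hρi : Integrable ρ := hρ.continuous.integrable_of_hasCompactSupport hρs
    -- Du Bois-Reymond: subtracting `m ρ` from `ψ` leaves a function of zero mean, hence the
    -- derivative of a test function, against which `f - U` integrates to zero. So `f - U` acts on
    -- `ψ` as the constant `C`.
    obtain ⟨φ, hφ, hφs, hφd⟩ := exists_primitive_of_integral_eq_zero
      (χ := fun x => ψ x - m * ρ x) (hψ.sub (contDiff_const.mul hρ))
      (hψs.sub hρs.mul_left)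
      (by rw [integral_sub hψi (hρi.const_mul m), integral_const_mul, hρ1]; simp [hm])
    have e := h0 φ hφ hφs
    rw [hφd] at e
    simp_rw [sub_mul, mul_assoc] at e
    rw [integral_sub (I hl hψ.continuous hψs)
      ((I hl hρ.continuous hρs).const_mul m), integral_const_mul] at e
    simp only [smul_eq_mul]
    rw [integral_mul_const]
    linarith
  refine ⟨fun x => C + U x, ?_, hUp.const_add C⟩
  filter_upwards [key] with x hx
  rw [← hx]; ring

end DualPowerCH

/-! ### Quantitative `L^p` bounds and Young's inequality for exponential kernels -/

namespace DualPowerCH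

open Filter Topology
open scoped ENNReal

/-- `f` is a.e. strongly measurable with `L^p` seminorm at most `B`. -/
structure LB (p : ℝ≥0∞) (f : ℝ → ℝ) (B : ℝ) : Prop where
  meas : AEStronglyMeasurable f volume
  nonneg : 0 ≤ B
  le : eLpNorm f p volume ≤ ENNReal.ofReal B

namespace LB

variable {p : ℝ≥0∞} {f g : ℝ → ℝ} {A B : ℝ}

lemma memLp (h : LB p f B) : MemLp f p volume := ⟨h.meas, h.le.trans_lt ENNReal.ofReal_lt_top⟩

lemma mono (h : LB p f A) (hAB : A ≤ B) : LB p f B :=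
  ⟨h.meas, h.nonneg.trans hAB, h.le.trans (ENNReal.ofReal_le_ofReal hAB)⟩

lemma congr (h : LB p f B) (hfg : f =ᵐ[volume] g) : LB p g B :=
  ⟨h.meas.congr hfg, h.nonneg, by rw [← eLpNorm_congr_ae hfg]; exact h.le⟩

lemma of_le_mul (h : LB p g B) (hf : AEStronglyMeasurable f volume) {c : ℝ} (hc : 0 ≤ c)
    (hle : ∀ᵐ x, |f x| ≤ c * |g x|) : LB p f (c * B) :=
  ⟨hf, mul_nonneg hc h.nonneg, (eLpNorm_le_mul_eLpNorm_of_ae_le_mul (g := g) (c := c) hle p).trans (by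
    rw [ENNReal.ofReal_mul hc]; exact mul_le_mul_right h.le _)⟩

lemma of_le (h : LB p g B) (hf : AEStronglyMeasurable f volume)
    (hle : ∀ᵐ x, |f x| ≤ |g x|) : LB p f B := by
  simpa using h.of_le_mul hf zero_le_one (by simpa using hle)

lemma add [Fact (1 ≤ p)] (hf : LB p f A) (hg : LB p g B) : LB p (fun x => f x + g x) (A + B) :=
  ⟨hf.meas.add hg.meas, add_nonneg hf.nonneg hg.nonneg,
    (eLpNorm_add_le hf.meas hg.meas Fact.out).trans (by
      rw [ENNReal.ofReal_add hf.nonneg hg.nonneg]; exact add_le_add hf.le hg.le)⟩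

lemma const_mul (hf : LB p f A) (c : ℝ) : LB p (fun x => c * f x) (|c| * A) :=
  hf.of_le_mul (hf.meas.const_mul c) (abs_nonneg c) (ae_of_all _ fun _ => (abs_mul _ _).le)

lemma neg (hf : LB p f A) : LB p (fun x => -f x) A :=
  hf.of_le hf.meas.neg (ae_of_all _ fun _ => (abs_neg _).le)

lemma abs (hf : LB p f A) : LB p (fun x => |f x|) A :=
  hf.of_le hf.meas.norm (ae_of_all _ fun _ => (abs_abs _).le)

lemma ae_le (h : LB ⊤ f B) : ∀ᵐ x, |f x| ≤ B := by
  have h1 := h.le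
  rw [eLpNorm_exponent_top] at h1
  filter_upwards [ae_le_eLpNormEssSup (f := f) (μ := volume)] with x hx
  have := hx.trans h1
  rwa [Real.enorm_eq_ofReal_abs, ENNReal.ofReal_le_ofReal_iff h.nonneg] at this

lemma of_bound (hf : AEStronglyMeasurable f volume) (hB : 0 ≤ B) (h : ∀ᵐ x, |f x| ≤ B) :
    LB ⊤ f B := by
  refine ⟨hf, hB, ?_⟩
  rw [eLpNorm_exponent_top]
  exact eLpNormEssSup_le_of_ae_bound h

lemma mul (hf : LB ⊤ f A) (hg : LB p g B) : LB p (fun x => f x * g x) (A * B) :=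
  hg.of_le_mul (hf.meas.mul hg.meas) hf.nonneg (by
    filter_upwards [hf.ae_le] with x hx
    rw [Pi.mul_apply, abs_mul]; gcongr)

lemma integrable_sq (h : LB 2 f B) : Integrable (fun x => f x ^ 2) := h.memLp.integrable_sq

lemma integral_sq_le (h : LB 2 f B) : ∫ x, f x ^ 2 ≤ B ^ 2 := by
  have h1 := h.le
  rw [h.memLp.eLpNorm_eq_integral_rpow_norm (by simp) (by simp),
    ENNReal.ofReal_le_ofReal_iff h.nonneg] at h1
  have h0 : 0 ≤ ∫ x, f x ^ 2 := integral_nonneg fun x => sq_nonneg _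
  have e : ∫ x, ‖f x‖ ^ (ENNReal.toReal 2) = ∫ x, f x ^ 2 := by
    congr 1; ext x; simp
  rw [e] at h1
  calc ∫ x, f x ^ 2 = ((∫ x, f x ^ 2) ^ (ENNReal.toReal 2)⁻¹) ^ 2 := by
        rw [← Real.rpow_natCast, ← Real.rpow_mul h0]; simp
    _ ≤ B ^ 2 := by gcongr

lemma of_integral_sq (hf : AEStronglyMeasurable f volume) (hB : 0 ≤ B)
    (hi : Integrable (fun x => f x ^ 2)) (h : ∫ x, f x ^ 2 ≤ B ^ 2) : LB 2 f B := by
  refine ⟨hf, hB, ?_⟩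
  have hm : MemLp f 2 volume := (memLp_two_iff_integrable_sq hf).2 hi
  rw [hm.eLpNorm_eq_integral_rpow_norm (by simp) (by simp)]
  refine ENNReal.ofReal_le_ofReal ?_
  have h0 : 0 ≤ ∫ x, f x ^ 2 := integral_nonneg fun x => sq_nonneg _
  have e : ∫ x, ‖f x‖ ^ (ENNReal.toReal 2) = ∫ x, f x ^ 2 := by
    congr 1; ext x; simp
  rw [e]
  calc (∫ x, f x ^ 2) ^ (ENNReal.toReal 2)⁻¹ ≤ (B ^ 2) ^ (ENNReal.toReal 2)⁻¹ := by
        gcongr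
    _ = B := by rw [← Real.rpow_natCast, ← Real.rpow_mul hB]; simp

lemma integrable_mul (hf : LB 2 f A) (hg : LB 2 g B) : Integrable (fun x => f x * g x) :=
  hf.memLp.integrable_mul hg.memLp

lemma integral_abs_mul_le (hf : LB 2 f A) (hg : LB 2 g B) : ∫ x, |f x * g x| ≤ A * B := by
  have h := eLpNorm_smul_le_mul_eLpNorm (p := 2) (q := 2) (r := 1) hg.meas hf.meas
  have h2 : eLpNorm (f • g) 1 volume ≤ ENNReal.ofReal (A * B) := by
    refine h.trans ?_
    rw [ENNReal.ofReal_mul hf.nonneg]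
    exact mul_le_mul' hf.le hg.le
  rw [eLpNorm_one_eq_lintegral_enorm] at h2
  have h3 := integral_norm_eq_lintegral_enorm (hf.integrable_mul hg).1
  simp only [Real.norm_eq_abs] at h3
  rw [h3]
  exact ENNReal.toReal_le_of_le_ofReal (mul_nonneg hf.nonneg hg.nonneg) h2

lemma abs_integral_mul_le (hf : LB 2 f A) (hg : LB 2 g B) : |∫ x, f x * g x| ≤ A * B :=
  abs_integral_le_integral_abs.trans (hf.integral_abs_mul_le hg)

lemma locallyIntegrable [Fact (1 ≤ p)] (h : LB p f B) : LocallyIntegrable f volume :=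
  h.memLp.locallyIntegrable Fact.out

lemma of_Lp (f : Lp ℝ p (volume : Measure ℝ)) : LB p f ‖f‖ :=
  ⟨Lp.aestronglyMeasurable f, ENNReal.toReal_nonneg, by
    rw [Lp.norm_def, ENNReal.ofReal_toReal (Lp.eLpNorm_ne_top f)]⟩

lemma norm_le {F : Lp ℝ p (volume : Measure ℝ)} (h : LB p F B) : ‖F‖ ≤ B := by
  rw [Lp.norm_def]
  exact ENNReal.toReal_le_of_le_ofReal h.nonneg h.le

end LB

lemma integrable_exp_neg_mul_abs {κ : ℝ} (hκ : 0 < κ) :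
    Integrable (fun y : ℝ => Real.exp (-(κ * |y|))) := by
  have h1 : IntegrableOn (fun y : ℝ => Real.exp (-(κ * |y|))) (Ioi 0) := by
    refine (integrableOn_exp_mul_Ioi (neg_lt_zero.2 hκ) 0).congr_fun (fun y hy => ?_)
      measurableSet_Ioi
    simp only [abs_of_pos (mem_Ioi.1 hy)]
    ring_nf
  have h2 : IntegrableOn (fun y : ℝ => Real.exp (-(κ * |y|))) (Iic 0) := by
    refine (integrableOn_exp_mul_Iic hκ 0).congr_fun (fun y hy => ?_) measurableSet_Iic
    simp only [abs_of_nonpos (mem_Iic.1 hy)]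
    ring_nf
  have := h2.union h1
  rwa [Iic_union_Ioi, integrableOn_univ] at this

lemma integral_exp_neg_mul_abs {κ : ℝ} (hκ : 0 < κ) :
    ∫ y : ℝ, Real.exp (-(κ * |y|)) = 2 / κ := by
  rw [integral_comp_abs (f := fun y => Real.exp (-(κ * y)))]
  have := integral_exp_mul_Ioi (neg_lt_zero.2 hκ) 0
  simp only [neg_mul] at this
  rw [this]
  simp
  ring

lemma integrable_exp_mul {κ : ℝ} (hκ : 0 < κ) {f : ℝ → ℝ} {A : ℝ} (hf : LB ⊤ f A) (x : ℝ) :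
    Integrable (fun y => Real.exp (-(κ * |x - y|)) * |f y|) := by
  refine ((integrable_exp_neg_mul_abs hκ).comp_sub_left x).mul_bdd hf.abs.meas (c := A) ?_
  filter_upwards [hf.ae_le] with y hy
  simpa using hy

/-- Young's inequality for the kernel `e^{-κ|x-y|}`, in `L^∞`. -/
lemma LB.top_of_le_exp_kernel {κ : ℝ} (hκ : 0 < κ) {f T : ℝ → ℝ} {A C : ℝ} (hC : 0 ≤ C)
    (hf : LB ⊤ f A) (hT : AEStronglyMeasurable T volume)
    (h : ∀ x, |T x| ≤ C * ∫ y, Real.exp (-(κ * |x - y|)) * |f y|) :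
    LB ⊤ T (C * (2 / κ) * A) := by
  have hA := hf.nonneg
  refine LB.of_bound hT (by positivity) (ae_of_all _ fun x => (h x).trans ?_)
  rw [mul_assoc]
  gcongr
  calc ∫ y, Real.exp (-(κ * |x - y|)) * |f y|
      ≤ ∫ y, Real.exp (-(κ * |x - y|)) * A := by
        refine integral_mono_ae (integrable_exp_mul hκ hf x)
          (((integrable_exp_neg_mul_abs hκ).comp_sub_left x).mul_const A) ?_
        filter_upwards [hf.ae_le] with y hy
        gcongr
    _ = 2 / κ * A := by
        rw [integral_mul_const, integral_sub_left_eq_self (fun y => Real.exp (-(κ * |y|))) volume x,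
          integral_exp_neg_mul_abs hκ]

/-- Young's inequality for the kernel `e^{-κ|x-y|}`, in `L²`. -/
lemma LB.two_of_le_exp_kernel {κ : ℝ} (hκ : 0 < κ) {f T : ℝ → ℝ} {A B C : ℝ} (hC : 0 ≤ C)
    (hf : LB ⊤ f A) (hf2 : LB 2 f B) (hT : AEStronglyMeasurable T volume)
    (h : ∀ x, |T x| ≤ C * ∫ y, Real.exp (-(κ * |x - y|)) * |f y|) :
    LB 2 T (C * (2 / κ) * B) := by
  have hB := hf2.nonneg
  set k : ℝ → ℝ := fun y => Real.exp (-(κ * |y|)) with hk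
  have hki : Integrable k := integrable_exp_neg_mul_abs hκ
  have hk1 : ∫ y, k y = 2 / κ := integral_exp_neg_mul_abs hκ
  set L := ContinuousLinearMap.mul ℝ ℝ
  set V : ℝ → ℝ := convolution (fun y => f y ^ 2) k L volume with hV
  have hVi : Integrable V := hf2.integrable_sq.integrable_convolution L hki
  have hVint : ∫ x, V x = (∫ y, f y ^ 2) * (2 / κ) := by
    rw [hV, integral_convolution L hf2.integrable_sq hki, hk1]; rfl
  have hsqi : ∀ x, Integrable fun y => k (x - y) * f y ^ 2 := fun x => by
    have hm : AEStronglyMeasurable (fun y => k (x - y)) volume := (hki.comp_sub_left x).1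
    refine hf2.integrable_sq.bdd_mul hm (c := 1) (ae_of_all _ fun y => ?_)
    rw [Real.norm_eq_abs, hk, abs_of_pos (Real.exp_pos _), Real.exp_le_one_iff]
    have := mul_nonneg hκ.le (abs_nonneg (x - y))
    linarith
  have hpt : ∀ x, (∫ y, k (x - y) * |f y|) ^ 2 ≤ (2 / κ) * V x := by
    intro x
    set m := ∫ y, k (x - y) * |f y| with hm
    have hVx : V x = ∫ y, k (x - y) * f y ^ 2 := by
      rw [hV, convolution]
      congr 1; ext y
      simp [L, mul_comm]
    have hkx : ∫ y, k (x - y) = 2 / κ := by rw [integral_sub_left_eq_self k volume x, hk1]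
    -- The mean of `|f|` with respect to the kernel, whose mass is `2/κ`. Nonnegativity of the
    -- variance about `c` is the Cauchy-Schwarz bound `m² ≤ (2/κ) V x`.
    set c := m * (κ / 2)
    have hnn : 0 ≤ ∫ y, k (x - y) * (|f y| - c) ^ 2 :=
      integral_nonneg fun y => mul_nonneg (Real.exp_pos _).le (sq_nonneg _)
    have i1 : Integrable fun y => k (x - y) * |f y| := integrable_exp_mul hκ hf x
    have i2 := hki.comp_sub_left x
    have hexp : ∫ y, k (x - y) * (|f y| - c) ^ 2 = V x - 2 * c * m + c ^ 2 * (2 / κ) := by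
      have : ∀ y, k (x - y) * (|f y| - c) ^ 2
          = k (x - y) * f y ^ 2 - 2 * c * (k (x - y) * |f y|) + c ^ 2 * k (x - y) := by
        intro y; rw [← sq_abs (f y)]; ring
      simp_rw [this]
      rw [integral_add (f := fun y => k (x - y) * f y ^ 2 - 2 * c * (k (x - y) * |f y|))
        ((hsqi x).sub (i1.const_mul _)) (i2.const_mul _),
        integral_sub (hsqi x) (i1.const_mul _), integral_const_mul, integral_const_mul, hkx, hVx]
    rw [hexp] at hnn
    have : V x - 2 * c * m + c ^ 2 * (2 / κ) = V x - m ^ 2 * (κ / 2) := by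
      simp only [c]; field_simp; ring
    rw [this] at hnn
    calc m ^ 2 = (2 / κ) * (m ^ 2 * (κ / 2)) := by field_simp
      _ ≤ (2 / κ) * V x := by gcongr; linarith
  have hTle : ∀ x, T x ^ 2 ≤ C ^ 2 * ((2 / κ) * V x) := by
    intro x
    rw [← sq_abs]
    calc |T x| ^ 2 ≤ (C * ∫ y, k (x - y) * |f y|) ^ 2 := by gcongr; exact h x
      _ = C ^ 2 * (∫ y, k (x - y) * |f y|) ^ 2 := by ring
      _ ≤ _ := by gcongr; exact hpt x
  have hdom : Integrable fun x => C ^ 2 * ((2 / κ) * V x) := (hVi.const_mul _).const_mul _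
  have hTi : Integrable fun x => T x ^ 2 := hdom.mono' (hT.pow 2) (ae_of_all _ fun x => by
    rw [Real.norm_eq_abs, abs_of_nonneg (sq_nonneg _)]; exact hTle x)
  refine LB.of_integral_sq hT (by positivity) hTi ?_
  calc ∫ x, T x ^ 2 ≤ ∫ x, C ^ 2 * ((2 / κ) * V x) := integral_mono hTi hdom hTle
    _ = C ^ 2 * ((2 / κ) * ((∫ y, f y ^ 2) * (2 / κ))) := by
        rw [integral_const_mul, integral_const_mul, hVint]
    _ ≤ C ^ 2 * ((2 / κ) * (B ^ 2 * (2 / κ))) := by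
        gcongr; exact hf2.integral_sq_le
    _ = (C * (2 / κ) * B) ^ 2 := by ring

end DualPowerCH

/-! ### Integral operators with kernel `exp(-ν |∫_x^y α|)` -/

namespace DualPowerCH

open Filter Topology
open scoped ENNReal

/-- The kernel `exp(-ν |∫_x^y α|)`. -/
noncomputable def kern (ν : ℝ) (α : ℝ → ℝ) (x y : ℝ) : ℝ := Real.exp (-ν * |∫ r in x..y, α r|)

/-- The integral operator with kernel `kern ν α`, restricted to `y ∈ s x`. -/
noncomputable def nl (s : ℝ → Set ℝ) (ν : ℝ) (α f : ℝ → ℝ) (x : ℝ) : ℝ :=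
  ∫ y in s x, kern ν α x y * f y

/-- Densities whose kernel decays exponentially. -/
structure KerAdm (ν κ D Q : ℝ) (α : ℝ → ℝ) : Prop where
  ν_pos : 0 < ν
  κ_pos : 0 < κ
  lb : LB ⊤ α Q
  nonneg : ∀ᵐ x, 0 ≤ α x
  lower : ∀ x y, x ≤ y → κ * (y - x) - D ≤ ν * ∫ r in x..y, α r

lemma kern_pos (ν : ℝ) (α : ℝ → ℝ) (x y : ℝ) : 0 < kern ν α x y := Real.exp_pos _

lemma continuous_kern {α : ℝ → ℝ} (hα : LocallyIntegrable α volume) (ν x : ℝ) :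
    Continuous (kern ν α x) :=
  Real.continuous_exp.comp (continuous_const.mul (isPrim_integral hα x).continuous.abs)

lemma LB.of_le_exp_kernel {p : ℝ≥0∞} (hp : p = 2 ∨ p = ⊤) {κ : ℝ} (hκ : 0 < κ) {f T : ℝ → ℝ}
    {A B C : ℝ} (hC : 0 ≤ C) (hf : LB ⊤ f A) (hf2 : LB p f B) (hT : AEStronglyMeasurable T volume)
    (h : ∀ x, |T x| ≤ C * ∫ y, Real.exp (-(κ * |x - y|)) * |f y|) :
    LB p T (C * (2 / κ) * B) := by
  rcases hp with rfl | rfl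
  · exact LB.two_of_le_exp_kernel hκ hC hf hf2 hT h
  · exact LB.top_of_le_exp_kernel hκ hC hf2 hT h

namespace KerAdm

variable {ν κ D Q : ℝ} {α β f g : ℝ → ℝ} {A B : ℝ} {p : ℝ≥0∞}

lemma loc (h : KerAdm ν κ D Q α) : LocallyIntegrable α volume := h.lb.locallyIntegrable

lemma lower_abs (h : KerAdm ν κ D Q α) (x y : ℝ) :
    κ * |x - y| - D ≤ ν * |∫ r in x..y, α r| := by
  have hν := h.ν_pos
  rcases le_total x y with hxy | hxy
  · rw [abs_sub_comm, abs_of_nonneg (sub_nonneg.2 hxy)]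
    exact (h.lower x y hxy).trans (by gcongr; exact le_abs_self _)
  · rw [abs_of_nonneg (sub_nonneg.2 hxy), intervalIntegral.integral_symm, abs_neg]
    exact (h.lower y x hxy).trans (by gcongr; exact le_abs_self _)

lemma kern_le (h : KerAdm ν κ D Q α) (x y : ℝ) :
    kern ν α x y ≤ Real.exp D * Real.exp (-(κ * |x - y|)) := by
  rw [← Real.exp_add, kern, Real.exp_le_exp]
  have := h.lower_abs x y
  linarith

lemma integrable (h : KerAdm ν κ D Q α) (hf : LB ⊤ f A) (x : ℝ) :
    Integrable (fun y => kern ν α x y * f y) := by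
  refine ((integrable_exp_mul h.κ_pos hf x).const_mul (Real.exp D)).mono'
    ((continuous_kern h.loc ν x).aestronglyMeasurable.mul hf.meas) (ae_of_all _ fun y => ?_)
  rw [Real.norm_eq_abs, abs_mul, abs_of_pos (kern_pos _ _ _ _), ← mul_assoc]
  gcongr
  exact h.kern_le x y

lemma abs_nl_le (h : KerAdm ν κ D Q α) (hf : LB ⊤ f A) (s : ℝ → Set ℝ) (x : ℝ) :
    |nl s ν α f x| ≤ Real.exp D * ∫ y, Real.exp (-(κ * |x - y|)) * |f y| := by
  have hi := h.integrable hf x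
  calc |nl s ν α f x| ≤ ∫ y in s x, |kern ν α x y * f y| := abs_integral_le_integral_abs
    _ ≤ ∫ y, |kern ν α x y * f y| :=
        setIntegral_le_integral hi.abs (ae_of_all _ fun y => abs_nonneg _)
    _ ≤ ∫ y, Real.exp D * (Real.exp (-(κ * |x - y|)) * |f y|) := by
        refine integral_mono hi.abs ((integrable_exp_mul h.κ_pos hf x).const_mul _) fun y => ?_
        simp only [abs_mul, abs_of_pos (kern_pos _ _ _ _), ← mul_assoc]
        gcongr
        exact h.kern_le x y
    _ = _ := integral_const_mul _ _

lemma nl_sub (h : KerAdm ν κ D Q α) (hf : LB ⊤ f A) (hg : LB ⊤ g B) (s : ℝ → Set ℝ) (x : ℝ) :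
    nl s ν α (fun y => f y - g y) x = nl s ν α f x - nl s ν α g x := by
  simp only [nl, mul_sub]
  exact integral_sub (h.integrable hf x).integrableOn (h.integrable hg x).integrableOn

lemma abs_integral_sub_le (hα : LB ⊤ α A) (hβ : LB ⊤ β B) {δ : ℝ}
    (hd : LB ⊤ (fun x => α x - β x) δ) (x y : ℝ) :
    |(∫ r in x..y, α r) - ∫ r in x..y, β r| ≤ δ * |x - y| := by
  rw [← intervalIntegral.integral_sub (hα.locallyIntegrable.intervalIntegrable' x y)
    (hβ.locallyIntegrable.intervalIntegrable' x y), abs_sub_comm x y]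
  refine intervalIntegral.norm_integral_le_of_norm_le_const_ae (E := ℝ) ?_
  filter_upwards [hd.ae_le] with r hr _ using hr

/-- Since `|e^{-a} - e^{-b}| ≤ |a - b| e^{-m}` for `m ≤ a, b`, the difference is at most linear
growth in `|x - y|` times the common exponential decay. Half of the decay absorbs the linear factor,
whence the rate `κ / 2`. -/
lemma abs_kern_sub_le (hα : KerAdm ν κ D Q α) (hβ : KerAdm ν κ D Q β) {δ : ℝ}
    (hd : LB ⊤ (fun x => α x - β x) δ) (x y : ℝ) :
    |kern ν α x y - kern ν β x y|
      ≤ (ν * δ * Real.exp D * (2 / κ)) * Real.exp (-(κ / 2 * |x - y|)) := by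
  have hν := hα.ν_pos
  have hκ := hα.κ_pos
  have hδ := hd.nonneg
  have aux : ∀ a b m : ℝ, m ≤ a → m ≤ b →
      |Real.exp (-a) - Real.exp (-b)| ≤ |a - b| * Real.exp (-m) := by
    have aux1 : ∀ a b m : ℝ, a ≤ b → m ≤ a →
        |Real.exp (-a) - Real.exp (-b)| ≤ |a - b| * Real.exp (-m) := by
      intro a b m hab hma
      have h1 : Real.exp (-b) = Real.exp (-a) * Real.exp (a - b) := by
        rw [← Real.exp_add]; ring_nf
      have h2 : a - b + 1 ≤ Real.exp (a - b) := Real.add_one_le_exp _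
      have h3 : Real.exp (-b) ≤ Real.exp (-a) := Real.exp_le_exp.2 (by linarith)
      have h4 : Real.exp (-a) ≤ Real.exp (-m) := Real.exp_le_exp.2 (by linarith)
      rw [abs_of_nonneg (by linarith), abs_of_nonpos (by linarith), h1]
      have h5 := Real.exp_pos (-a)
      calc Real.exp (-a) - Real.exp (-a) * Real.exp (a - b)
          = Real.exp (-a) * (1 - Real.exp (a - b)) := by ring
        _ ≤ Real.exp (-a) * (-(a - b)) := by gcongr; linarith
        _ ≤ Real.exp (-m) * (-(a - b)) :=
            mul_le_mul_of_nonneg_right h4 (by linarith)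
        _ = _ := by ring
    intro a b m ha hb
    rcases le_total a b with hab | hab
    · exact aux1 a b m hab ha
    · rw [abs_sub_comm, abs_sub_comm a b]; exact aux1 b a m hab hb
  have h1 := aux _ _ _ (hα.lower_abs x y) (hβ.lower_abs x y)
  simp only [kern, neg_mul]
  refine h1.trans ?_
  have h2 : |ν * |∫ r in x..y, α r| - ν * (|∫ r in x..y, β r|)| ≤ ν * (δ * |x - y|) := by
    rw [← mul_sub, abs_mul, abs_of_pos hν]
    gcongr
    exact (abs_abs_sub_abs_le_abs_sub _ _).trans (abs_integral_sub_le hα.lb hβ.lb hd x y)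
  set t := |x - y|
  have h3 : t ≤ 2 / κ * Real.exp (κ / 2 * t) := by
    have := Real.add_one_le_exp (κ / 2 * t)
    calc t = 2 / κ * (κ / 2 * t) := by field_simp
      _ ≤ _ := by gcongr; linarith
  have h4 : Real.exp (-(κ * t - D)) = Real.exp D * Real.exp (-(κ * t)) := by
    rw [← Real.exp_add]; ring_nf
  have h5 : Real.exp (κ / 2 * t) * Real.exp (-(κ * t)) = Real.exp (-(κ / 2 * t)) := by
    rw [← Real.exp_add]; ring_nf
  calc _ ≤ (ν * (δ * (2 / κ * Real.exp (κ / 2 * t)))) * (Real.exp D * Real.exp (-(κ * t))) := by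
        rw [h4]; gcongr; exact h2.trans (by gcongr)
    _ = (ν * δ * Real.exp D * (2 / κ)) * (Real.exp (κ / 2 * t) * Real.exp (-(κ * t))) := by ring
    _ = _ := by rw [h5]

lemma abs_nl_sub_le (hα : KerAdm ν κ D Q α) (hβ : KerAdm ν κ D Q β) {δ : ℝ}
    (hd : LB ⊤ (fun x => α x - β x) δ) (hf : LB ⊤ f A) (s : ℝ → Set ℝ) (x : ℝ) :
    |nl s ν α f x - nl s ν β f x| ≤ (ν * δ * Real.exp D * (2 / κ)) *
      ∫ y, Real.exp (-(κ / 2 * |x - y|)) * |f y| := by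
  have hi := (hα.integrable hf x).sub (hβ.integrable hf x)
  have he : nl s ν α f x - nl s ν β f x
      = ∫ y in s x, (kern ν α x y * f y - kern ν β x y * f y) :=
    (integral_sub (hα.integrable hf x).integrableOn (hβ.integrable hf x).integrableOn).symm
  rw [he]
  calc |∫ y in s x, (kern ν α x y * f y - kern ν β x y * f y)|
      ≤ ∫ y in s x, |kern ν α x y * f y - kern ν β x y * f y| := abs_integral_le_integral_abs
    _ ≤ ∫ y, |kern ν α x y * f y - kern ν β x y * f y| :=
        setIntegral_le_integral hi.abs (ae_of_all _ fun y => abs_nonneg _)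
    _ ≤ ∫ y, (ν * δ * Real.exp D * (2 / κ)) * (Real.exp (-(κ / 2 * |x - y|)) * |f y|) := by
        refine integral_mono hi.abs
          ((integrable_exp_mul (half_pos hα.κ_pos) hf x).const_mul _) fun y => ?_
        simp only [← sub_mul, abs_mul, ← mul_assoc]
        gcongr
        exact abs_kern_sub_le hα hβ hd x y
    _ = _ := integral_const_mul _ _

lemma lb_nl (hp : p = 2 ∨ p = ⊤) (h : KerAdm ν κ D Q α) (hf : LB ⊤ f A) (hf2 : LB p f B)
    {s : ℝ → Set ℝ} (hm : Continuous (nl s ν α f)) :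
    LB p (nl s ν α f) (Real.exp D * (2 / κ) * B) :=
  LB.of_le_exp_kernel hp h.κ_pos (Real.exp_pos D).le hf hf2 hm.aestronglyMeasurable
    (h.abs_nl_le hf s)

lemma lb_nl_sub (hp : p = 2 ∨ p = ⊤) (hα : KerAdm ν κ D Q α) (hβ : KerAdm ν κ D Q β) {δ : ℝ}
    (hd : LB ⊤ (fun x => α x - β x) δ) (hf : LB ⊤ f A) (hf2 : LB p f B) {s : ℝ → Set ℝ}
    (hm : Continuous (nl s ν α f)) (hm' : Continuous (nl s ν β f)) :
    LB p (fun x => nl s ν α f x - nl s ν β f x)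
      (ν * δ * Real.exp D * (2 / κ) * (2 / (κ / 2)) * B) := by
  have h1 := hα.ν_pos
  have h2 := hα.κ_pos
  have h3 := hd.nonneg
  exact LB.of_le_exp_kernel hp (half_pos h2) (by positivity) hf hf2
    (hm.sub hm').aestronglyMeasurable (abs_nl_sub_le hα hβ hd hf s)

/-! ### The one-sided operators as primitives -/

lemma isPrim_exp (h : KerAdm ν κ D Q α) (c : ℝ) :
    IsPrim (fun x => Real.exp (c * ∫ r in (0 : ℝ)..x, α r))
      (fun x => Real.exp (c * ∫ r in (0 : ℝ)..x, α r) * (c * α x)) :=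
  ((isPrim_integral h.loc 0).const_mul c).comp Real.hasDerivAt_exp Real.continuous_exp

/-- As `α ≥ 0`, the absolute value disappears once `x` and `y` are ordered, and the kernel separates
into a function of `x` times a function of `y`. This is what makes the one-sided operators
differentiable in `x`. -/
lemma kern_eq_of_le (h : KerAdm ν κ D Q α) {x y : ℝ} (hxy : x ≤ y) :
    kern ν α x y = Real.exp (ν * ∫ r in (0 : ℝ)..x, α r) * Real.exp (-ν * ∫ r in (0 : ℝ)..y, α r) := by
  rw [kern, ← Real.exp_add, abs_of_nonneg
    (intervalIntegral.integral_nonneg_of_ae_restrict hxy (ae_restrict_of_ae h.nonneg)),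
    ← intervalIntegral.integral_interval_sub_left (h.loc.intervalIntegrable' 0 y)
      (h.loc.intervalIntegrable' 0 x)]
  ring_nf

lemma kern_eq_of_ge (h : KerAdm ν κ D Q α) {x y : ℝ} (hxy : y ≤ x) :
    kern ν α x y = Real.exp (-ν * ∫ r in (0 : ℝ)..x, α r) * Real.exp (ν * ∫ r in (0 : ℝ)..y, α r) := by
  have : kern ν α x y = kern ν α y x := by
    rw [kern, kern, intervalIntegral.integral_symm, abs_neg]
  rw [this, h.kern_eq_of_le hxy, mul_comm]

lemma integrableOn_Ioi (h : KerAdm ν κ D Q α) (hf : LB ⊤ f A) (x : ℝ) :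
    IntegrableOn (fun y => Real.exp (-ν * ∫ r in (0 : ℝ)..y, α r) * f y) (Ioi x) := by
  have := ((h.integrable hf x).integrableOn (s := Ioi x)).const_mul
    (Real.exp (ν * ∫ r in (0 : ℝ)..x, α r))⁻¹
  refine IntegrableOn.congr_fun this (fun y hy => ?_) measurableSet_Ioi
  rw [h.kern_eq_of_le (le_of_lt hy)]
  field_simp

lemma integrableOn_Iic (h : KerAdm ν κ D Q α) (hf : LB ⊤ f A) (x : ℝ) :
    IntegrableOn (fun y => Real.exp (ν * ∫ r in (0 : ℝ)..y, α r) * f y) (Iic x) := by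
  have := ((h.integrable hf x).integrableOn (s := Iic x)).const_mul
    (Real.exp (-ν * ∫ r in (0 : ℝ)..x, α r))⁻¹
  refine IntegrableOn.congr_fun this (fun y hy => ?_) measurableSet_Iic
  rw [h.kern_eq_of_ge hy]
  field_simp

lemma nl_Ioi_eq (h : KerAdm ν κ D Q α) (x : ℝ) :
    nl Ioi ν α f x = Real.exp (ν * ∫ r in (0 : ℝ)..x, α r) *
      ∫ y in Ioi x, Real.exp (-ν * ∫ r in (0 : ℝ)..y, α r) * f y := by
  rw [nl, ← integral_const_mul]
  refine setIntegral_congr_fun measurableSet_Ioi fun y hy => ?_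
  rw [h.kern_eq_of_le (le_of_lt hy), mul_assoc]

lemma nl_Iic_eq (h : KerAdm ν κ D Q α) (x : ℝ) :
    nl Iic ν α f x = Real.exp (-ν * ∫ r in (0 : ℝ)..x, α r) *
      ∫ y in Iic x, Real.exp (ν * ∫ r in (0 : ℝ)..y, α r) * f y := by
  rw [nl, ← integral_const_mul]
  refine setIntegral_congr_fun measurableSet_Iic fun y hy => ?_
  rw [h.kern_eq_of_ge hy, mul_assoc]

/-- After separating the kernel, this is the product rule: the exponential prefactor contributes `ν
α` times the operator, and the moving endpoint contributes `-f`. The resulting continuity also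
supplies the measurability needed for Young's inequality. -/
lemma isPrim_nl_Ioi (h : KerAdm ν κ D Q α) (hf : LB ⊤ f A) :
    IsPrim (nl Ioi ν α f) (fun x => ν * α x * nl Ioi ν α f x - f x) := by
  have hloc : LocallyIntegrable (fun y => Real.exp (-ν * ∫ r in (0 : ℝ)..y, α r) * f y) volume :=
    hf.locallyIntegrable.continuous_mul (h.isPrim_exp (-ν)).continuous
  have h1 : IsPrim (fun x => ∫ y in Ioi x, Real.exp (-ν * ∫ r in (0 : ℝ)..y, α r) * f y)
      (fun y => -1 * (Real.exp (-ν * ∫ r in (0 : ℝ)..y, α r) * f y)) := by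
    have h2 := ((isPrim_integral hloc 0).const_mul (-1)).const_add
      (∫ y in Ioi 0, Real.exp (-ν * ∫ r in (0 : ℝ)..y, α r) * f y)
    convert h2 using 2 with x
    rw [← intervalIntegral.integral_Ioi_sub_Ioi' (h.integrableOn_Ioi hf 0)
      (h.integrableOn_Ioi hf x)]
    ring
  have h3 := (h.isPrim_exp ν).mul h1
  convert h3 using 1
  · ext x; exact h.nl_Ioi_eq x
  · ext x
    rw [h.nl_Ioi_eq x]
    have : Real.exp (ν * ∫ r in (0 : ℝ)..x, α r) * Real.exp (-ν * ∫ r in (0 : ℝ)..x, α r) = 1 := by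
      rw [← Real.exp_add]; simp
    linear_combination (f x) * this

lemma isPrim_nl_Iic (h : KerAdm ν κ D Q α) (hf : LB ⊤ f A) :
    IsPrim (nl Iic ν α f) (fun x => f x - ν * α x * nl Iic ν α f x) := by
  have hloc : LocallyIntegrable (fun y => Real.exp (ν * ∫ r in (0 : ℝ)..y, α r) * f y) volume :=
    hf.locallyIntegrable.continuous_mul (h.isPrim_exp ν).continuous
  have h1 : IsPrim (fun x => ∫ y in Iic x, Real.exp (ν * ∫ r in (0 : ℝ)..y, α r) * f y)
      (fun y => Real.exp (ν * ∫ r in (0 : ℝ)..y, α r) * f y) := by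
    have h2 := (isPrim_integral hloc 0).const_add
      (∫ y in Iic 0, Real.exp (ν * ∫ r in (0 : ℝ)..y, α r) * f y)
    convert h2 using 2 with x
    rw [← intervalIntegral.integral_Iic_sub_Iic (h.integrableOn_Iic hf 0)
      (h.integrableOn_Iic hf x)]
    ring
  have h3 := (h.isPrim_exp (-ν)).mul h1
  convert h3 using 1
  · ext x; exact h.nl_Iic_eq x
  · ext x
    rw [h.nl_Iic_eq x]
    have : Real.exp (-ν * ∫ r in (0 : ℝ)..x, α r) * Real.exp (ν * ∫ r in (0 : ℝ)..x, α r) = 1 := by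
      rw [← Real.exp_add]; simp
    linear_combination (-f x) * this

/-- Up to the factor `-1/ν`, the kernel times `α` is an exact derivative in `y`, so its integral is
explicit. The bound does not involve `κ` or `D`, so it can be used before any lower bound on `q` is
available. -/
lemma nl_Ioi_self_le (h : KerAdm ν κ D Q α) (x : ℝ) : nl Ioi ν α α x ≤ 1 / ν := by
  have hν := h.ν_pos
  rw [h.nl_Ioi_eq]
  set e : ℝ → ℝ := fun x => Real.exp (-ν * ∫ r in (0 : ℝ)..x, α r) with he
  have h1 : ∫ y in Ioi x, e y * α y ≤ 1 / ν * e x := by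
    refine le_of_tendsto (intervalIntegral_tendsto_integral_Ioi x (h.integrableOn_Ioi h.lb x)
      tendsto_id) (Eventually.of_forall fun y => ?_)
    have h2 : -1 / ν * e y - -1 / ν * e x = ∫ z in x..y, -1 / ν * (e z * (-ν * α z)) :=
      ((h.isPrim_exp (-ν)).const_mul (-1 / ν)).sub_eq x y
    have h3 : ∀ z, -1 / ν * (e z * (-ν * α z)) = e z * α z := fun z => by field_simp
    rw [intervalIntegral.integral_congr (fun z _ => h3 z)] at h2
    rw [id, ← h2]
    have : 0 < 1 / ν * e y := by positivity
    linear_combination this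
  have h4 : Real.exp (ν * ∫ r in (0 : ℝ)..x, α r) * e x = 1 := by
    rw [he, ← Real.exp_add]; simp
  calc _ ≤ Real.exp (ν * ∫ r in (0 : ℝ)..x, α r) * (1 / ν * e x) := by gcongr
    _ = 1 / ν := by linear_combination (1 / ν) * h4

lemma nl_Iic_self_le (h : KerAdm ν κ D Q α) (x : ℝ) : nl Iic ν α α x ≤ 1 / ν := by
  have hν := h.ν_pos
  rw [h.nl_Iic_eq]
  set e : ℝ → ℝ := fun x => Real.exp (ν * ∫ r in (0 : ℝ)..x, α r) with he
  have h1 : ∫ y in Iic x, e y * α y ≤ 1 / ν * e x := by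
    refine le_of_tendsto (intervalIntegral_tendsto_integral_Iic x (h.integrableOn_Iic h.lb x)
      tendsto_id) (Eventually.of_forall fun y => ?_)
    have h2 : 1 / ν * e x - 1 / ν * e y = ∫ z in y..x, 1 / ν * (e z * (ν * α z)) :=
      ((h.isPrim_exp ν).const_mul (1 / ν)).sub_eq y x
    have h3 : ∀ z, 1 / ν * (e z * (ν * α z)) = e z * α z := fun z => by field_simp
    rw [intervalIntegral.integral_congr (fun z _ => h3 z)] at h2
    rw [id, ← h2]
    have : 0 < 1 / ν * e y := by positivity
    linear_combination this
  have h4 : Real.exp (-ν * ∫ r in (0 : ℝ)..x, α r) * e x = 1 := by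
    rw [he, ← Real.exp_add]; simp
  calc _ ≤ Real.exp (-ν * ∫ r in (0 : ℝ)..x, α r) * (1 / ν * e x) := by gcongr
    _ = 1 / ν := by linear_combination (1 / ν) * h4

end KerAdm

end DualPowerCH

namespace DualPowerCH

open Filter Topology
open scoped ENNReal

/-! ### Pointwise access to the phase space -/

/-- The weak derivative of the `u`-component. -/
noncomputable def X.ux (w : X) : ℝ → ℝ := H1.wderiv w.1

namespace X

lemma u_sub (w z : X) : X.u (w - z) =ᵐ[volume] fun x => X.u w x - X.u z x :=
  Lp.coeFn_sub w.1.1.1 z.1.1.1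

lemma ux_sub (w z : X) : X.ux (w - z) =ᵐ[volume] fun x => X.ux w x - X.ux z x :=
  Lp.coeFn_sub w.1.1.2 z.1.1.2

lemma v_sub (w z : X) : X.v (w - z) =ᵐ[volume] fun x => X.v w x - X.v z x :=
  Lp.coeFn_sub w.2.1.1.1 z.2.1.1.1

lemma q_sub (w z : X) : X.q (w - z) =ᵐ[volume] fun x => X.q w x - X.q z x :=
  Lp.coeFn_sub w.2.2 z.2.2

lemma u_smul (a : ℝ) (w : X) : X.u (a • w) =ᵐ[volume] fun x => a * X.u w x :=
  Lp.coeFn_smul a w.1.1.1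

lemma ux_smul (a : ℝ) (w : X) : X.ux (a • w) =ᵐ[volume] fun x => a * X.ux w x :=
  Lp.coeFn_smul a w.1.1.2

lemma v_smul (a : ℝ) (w : X) : X.v (a • w) =ᵐ[volume] fun x => a * X.v w x :=
  Lp.coeFn_smul a w.2.1.1.1

lemma q_smul (a : ℝ) (w : X) : X.q (a • w) =ᵐ[volume] fun x => a * X.q w x :=
  Lp.coeFn_smul a w.2.2

lemma v_ae_eq (w : X) : X.v w =ᵐ[volume] w.2.1.1.2 := w.2.1.2

lemma lb_u (w : X) : LB 2 (X.u w) ‖w‖ :=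
  (LB.of_Lp w.1.1.1).mono ((norm_fst_le w.1.1).trans (norm_fst_le w))

lemma lb_ux (w : X) : LB 2 (X.ux w) ‖w‖ :=
  (LB.of_Lp w.1.1.2).mono ((norm_snd_le w.1.1).trans (norm_fst_le w))

lemma lb_v (w : X) : LB 2 (X.v w) ‖w‖ :=
  (LB.of_Lp w.2.1.1.1).mono ((norm_fst_le w.2.1.1).trans ((norm_fst_le w.2).trans (norm_snd_le w)))

lemma lb_v_top (w : X) : LB ⊤ (X.v w) ‖w‖ :=
  ((LB.of_Lp w.2.1.1.2).mono ((norm_snd_le w.2.1.1).trans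
    ((norm_fst_le w.2).trans (norm_snd_le w)))).congr w.v_ae_eq.symm

lemma lb_q (w : X) : LB ⊤ (X.q w) ‖w‖ :=
  (LB.of_Lp w.2.2).mono ((norm_snd_le w.2).trans (norm_snd_le w))

end X

lemma H1.exists_isPrim (f : H1) : ∃ F : ℝ → ℝ, F =ᵐ[volume] H1.toFun f ∧ IsPrim F (H1.wderiv f) :=
  exists_isPrim_of_weakDeriv (LB.of_Lp f.1.1).locallyIntegrable (LB.of_Lp f.1.2).locallyIntegrable
    f.2

/-- The Sobolev inequality. -/
lemma IsPrim.lb_top {F g : ℝ → ℝ} (h : IsPrim F g) {A B : ℝ} (hF : LB 2 F A) (hg : LB 2 g B) (x : ℝ) :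
    F x ^ 2 ≤ A * B := by
  have h1 := h.mul h
  have h2 : Integrable (fun x => F x * F x) := hF.integrable_mul hF
  have h3 : Integrable (fun x => g x * F x + F x * g x) :=
    (hg.integrable_mul hF).add (hF.integrable_mul hg)
  have h4 := h1.two_mul_abs_le h2 h3 x
  have h5 : ∫ x, |g x * F x + F x * g x| = 2 * ∫ x, |F x * g x| := by
    rw [← integral_const_mul]
    congr 1; ext y
    rw [mul_comm (g y), ← two_mul, abs_mul]; simp
  have h6 := hF.integral_abs_mul_le hg
  rw [h5] at h4
  have := le_abs_self (F x * F x)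
  nlinarith

lemma X.lb_u_top (w : X) : LB ⊤ (X.u w) ‖w‖ := by
  obtain ⟨F, hF, hp⟩ := H1.exists_isPrim w.1
  refine LB.congr ?_ hF
  refine LB.of_bound hp.continuous.aestronglyMeasurable (norm_nonneg _) (ae_of_all _ fun x => ?_)
  have := hp.lb_top (w.lb_u.congr hF.symm) w.lb_ux x
  exact abs_le_of_sq_le_sq (by nlinarith) (norm_nonneg _)

lemma X.norm_le {w : X} {B : ℝ} (h1 : LB 2 (X.u w) B) (h2 : LB 2 (X.ux w) B) (h3 : LB 2 (X.v w) B)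
    (h4 : LB ⊤ (X.v w) B) (h5 : LB ⊤ (X.q w) B) : ‖w‖ ≤ B := by
  have e1 : ‖w.1.1.1‖ ≤ B := LB.norm_le h1
  have e2 : ‖w.1.1.2‖ ≤ B := LB.norm_le h2
  have e3 : ‖w.2.1.1.1‖ ≤ B := LB.norm_le h3
  have e4 : ‖w.2.1.1.2‖ ≤ B := LB.norm_le (h4.congr w.v_ae_eq)
  have e5 : ‖w.2.2‖ ≤ B := LB.norm_le h5
  exact max_le (max_le e1 e2) (max_le (max_le e3 e4) e5)

lemma X.ext_ae {w z : X} (h1 : X.u w =ᵐ[volume] X.u z) (h2 : X.ux w =ᵐ[volume] X.ux z)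
    (h3 : X.v w =ᵐ[volume] X.v z) (h4 : X.q w =ᵐ[volume] X.q z) : w = z := by
  have e1 : w.1.1.1 = z.1.1.1 := Lp.ext h1
  have e2 : w.1.1.2 = z.1.1.2 := Lp.ext h2
  have e3 : w.2.1.1.1 = z.2.1.1.1 := Lp.ext h3
  have e4 : w.2.1.1.2 = z.2.1.1.2 := Lp.ext (w.v_ae_eq.symm.trans (h3.trans z.v_ae_eq))
  have e5 : w.2.2 = z.2.2 := Lp.ext h4
  exact Prod.ext (Subtype.ext (Prod.ext e1 e2)) (Prod.ext (Subtype.ext (Prod.ext e3 e4)) e5)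

/-- Weak derivatives are unique, by testing against smooth functions. Hence neither the initial
conditions nor `IsRHS` need to mention the derivative component. -/
lemma X.ux_congr {w z : X} (h : X.u w =ᵐ[volume] X.u z) : X.ux w =ᵐ[volume] X.ux z := by
  refine ae_eq_of_integral_contDiff_smul_eq w.lb_ux.locallyIntegrable z.lb_ux.locallyIntegrable
    fun φ hφ hs => ?_
  have h1 := w.1.2 φ hφ hs
  have h2 := z.1.2 φ hφ hs
  have h3 : ∫ x, X.u w x * deriv φ x = ∫ x, X.u z x * deriv φ x := by
    refine integral_congr_ae ?_
    filter_upwards [h] with x hx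
    rw [hx]
  simp only [smul_eq_mul, mul_comm (φ _)]
  have h4 : ∫ x, X.u w x * deriv φ x = -∫ x, X.ux w x * φ x := h1
  have h5 : ∫ x, X.u z x * deriv φ x = -∫ x, X.ux z x * φ x := h2
  linarith

lemma X.exists_of_functions {φ φ' ψ χ : ℝ → ℝ} {A B C D E : ℝ} (h : IsPrim φ φ') (h1 : LB 2 φ A)
    (h2 : LB 2 φ' B) (h3 : LB 2 ψ C) (h4 : LB ⊤ ψ D) (h5 : LB ⊤ χ E) :
    ∃ w : X, X.u w =ᵐ[volume] φ ∧ X.ux w =ᵐ[volume] φ' ∧ X.v w =ᵐ[volume] ψ ∧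
      X.q w =ᵐ[volume] χ := by
  have c1 := h1.memLp.coeFn_toLp
  have c2 := h2.memLp.coeFn_toLp
  have c3 := h3.memLp.coeFn_toLp
  have c4 := h4.memLp.coeFn_toLp
  have c5 := h5.memLp.coeFn_toLp
  refine ⟨⟨⟨(h1.memLp.toLp φ, h2.memLp.toLp φ'), fun η hη hs => ?_⟩,
    ⟨(h3.memLp.toLp ψ, h4.memLp.toLp ψ), c3.trans c4.symm⟩, h5.memLp.toLp χ⟩, c1, c2, c3, c5⟩
  have e1 : ∫ x, h1.memLp.toLp φ x * deriv η x = ∫ x, φ x * deriv η x := by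
    refine integral_congr_ae ?_
    filter_upwards [c1] with x hx
    rw [hx]
  have e2 : ∫ x, h2.memLp.toLp φ' x * η x = ∫ x, φ' x * η x := by
    refine integral_congr_ae ?_
    filter_upwards [c2] with x hx
    rw [hx]
  simp only
  rw [e1, e2]
  exact h.integral_mul_deriv hη hs

/-! ### Lipschitz families of functions -/

/-- A family of functions, parametrized by `w ∈ S`, that is bounded in `L^p` by a multiple of the
weight `θ` and Lipschitz in `w` with a constant controlled by `θ`. -/
def Lip (S : Set X) (p : ℝ≥0∞) (θ : X → ℝ) (Φ : X → ℝ → ℝ) : Prop :=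
  ∃ C, 0 ≤ C ∧ (∀ w ∈ S, LB p (Φ w) (C * θ w)) ∧
    ∀ w ∈ S, ∀ z ∈ S, LB p (fun x => Φ w x - Φ z x) (C * θ z * ‖w - z‖)

namespace Lip

variable {S : Set X} {p : ℝ≥0∞} {θ : X → ℝ} {Φ Ψ : X → ℝ → ℝ}

lemma congr (h : Lip S p θ Φ) (he : ∀ w x, Φ w x = Ψ w x) : Lip S p θ Ψ := by
  rwa [show Ψ = Φ from funext fun w => funext fun x => (he w x).symm]

lemma add [Fact (1 ≤ p)] (h : Lip S p θ Φ) (h' : Lip S p θ Ψ) :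
    Lip S p θ (fun w x => Φ w x + Ψ w x) := by
  obtain ⟨C, hC, h1, h2⟩ := h
  obtain ⟨C', hC', h1', h2'⟩ := h'
  refine ⟨C + C', add_nonneg hC hC', fun w hw => ?_, fun w hw z hz => ?_⟩
  · exact ((h1 w hw).add (h1' w hw)).mono (by rw [add_mul])
  · refine (((h2 w hw z hz).add (h2' w hw z hz)).mono (by rw [← add_mul, ← add_mul])).congr
      (ae_of_all _ fun x => ?_)
    ring

lemma const_mul (h : Lip S p θ Φ) (a : ℝ) : Lip S p θ (fun w x => a * Φ w x) := by
  obtain ⟨C, hC, h1, h2⟩ := h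
  refine ⟨|a| * C, by positivity, fun w hw => ?_, fun w hw z hz => ?_⟩
  · exact ((h1 w hw).const_mul a).mono (by rw [mul_assoc])
  · refine (((h2 w hw z hz).const_mul a).mono (by simp only [mul_assoc, le_refl])).congr
      (ae_of_all _ fun x => ?_)
    ring

lemma neg (h : Lip S p θ Φ) : Lip S p θ (fun w x => -Φ w x) :=
  (h.const_mul (-1)).congr fun w x => by ring

lemma sub [Fact (1 ≤ p)] (h : Lip S p θ Φ) (h' : Lip S p θ Ψ) :
    Lip S p θ (fun w x => Φ w x - Ψ w x) :=
  (h.add h'.neg).congr fun w x => by ring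

lemma const (S : Set X) (a : ℝ) : Lip S ⊤ (fun _ => 1) (fun _ _ => a) := by
  refine ⟨|a|, abs_nonneg a, fun w _ => ?_, fun w _ z _ => ?_⟩
  · exact LB.of_bound aestronglyMeasurable_const (by positivity) (by simp)
  · exact LB.of_bound aestronglyMeasurable_const (by positivity)
      (ae_of_all _ fun x => by simp; positivity)

/-- Uses `Φ_w Ψ_w - Φ_z Ψ_z = Φ_w (Ψ_w - Ψ_z) + (Φ_w - Φ_z) Ψ_z`. With one factor bounded uniformly,
the weight enters only once and at `z`; growth therefore stays linear in `θ` under products. -/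
lemma mul [Fact (1 ≤ p)] (h : Lip S ⊤ (fun _ => 1) Φ) (h' : Lip S p θ Ψ) :
    Lip S p θ (fun w x => Φ w x * Ψ w x) := by
  obtain ⟨C, hC, h1, h2⟩ := h
  obtain ⟨C', hC', h1', h2'⟩ := h'
  refine ⟨C * C' + C * C', by positivity, fun w hw => ?_, fun w hw z hz => ?_⟩
  · refine ((h1 w hw).mul (h1' w hw)).mono ?_
    have := mul_nonneg hC (h1' w hw).nonneg
    linarith
  · refine ((((h1 w hw).mul (h2' w hw z hz)).add ((h2 w hw z hz).mul (h1' z hz))).mono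
      (le_of_eq (by ring))).congr (ae_of_all _ fun x => ?_)
    ring

lemma mul_right [Fact (1 ≤ p)] (h' : Lip S p θ Ψ) (h : Lip S ⊤ (fun _ => 1) Φ) :
    Lip S p θ (fun w x => Ψ w x * Φ w x) :=
  (h.mul h').congr fun w x => by ring

/-- Nonlocal operators preserve Lipschitz families. -/
lemma nl (hp : p = 2 ∨ p = ⊤) [Fact (1 ≤ p)] {ν κ D Q : ℝ} {α : X → ℝ → ℝ}
    (hα : ∀ w ∈ S, KerAdm ν κ D Q (α w)) (hαL : Lip S ⊤ (fun _ => 1) α)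
    (hΦ : Lip S ⊤ (fun _ => 1) Φ) (hΦp : Lip S p θ Φ) {s : ℝ → Set ℝ}
    (hs : ∀ w ∈ S, ∀ (f : ℝ → ℝ) (A : ℝ), LB ⊤ f A → Continuous (nl s ν (α w) f)) :
    Lip S p θ (fun w => nl s ν (α w) (Φ w)) := by
  obtain ⟨C, hC, h1, h2⟩ := hΦ
  obtain ⟨C', hC', h1', h2'⟩ := hΦp
  obtain ⟨C₂, hC₂, -, h2₂⟩ := hαL
  rcases S.eq_empty_or_nonempty with rfl | ⟨w₀, hw₀⟩
  · exact ⟨0, le_rfl, by simp, by simp⟩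
  have hν := (hα w₀ hw₀).ν_pos
  have hκ := (hα w₀ hw₀).κ_pos
  set a := Real.exp D * (2 / κ)
  set b := ν * C₂ * Real.exp D * (2 / κ) * (2 / (κ / 2))
  have ha : 0 ≤ a := by positivity
  have hb : 0 ≤ b := by positivity
  refine ⟨a * C' + b * C', by positivity, fun w hw => ?_, fun w hw z hz => ?_⟩
  · refine ((hα w hw).lb_nl hp (h1 w hw) (h1' w hw) (hs w hw _ _ (h1 w hw))).mono ?_
    have := mul_nonneg hb (h1' w hw).nonneg
    simp only [a] at *
    linarith
  -- The source is varied first with the kernel of `w` fixed (`e1`), then the kernel is varied with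
  -- the source of `z` fixed (`e2`).
  · have e1 := (hα w hw).lb_nl hp (h2 w hw z hz) (h2' w hw z hz) (hs w hw _ _ (h2 w hw z hz))
    have e2 := KerAdm.lb_nl_sub hp (hα w hw) (hα z hz) (h2₂ w hw z hz) (h1 z hz) (h1' z hz)
      (hs w hw _ _ (h1 z hz)) (hs z hz _ _ (h1 z hz))
    refine ((e1.add e2).mono (le_of_eq ?_)).congr (ae_of_all _ fun x => ?_)
    · simp only [a, b]; ring
    · simp only [(hα w hw).nl_sub (h1 w hw) (h1 z hz) s x]
      ring

/-- Composition with a bounded Lipschitz function of `v`. -/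
lemma comp_v {φ : ℝ → ℝ} {K M : ℝ} (hφ : ∀ x y, |φ x - φ y| ≤ K * |x - y|) (hφc : Continuous φ)
    (hM : ∀ x, |φ x| ≤ M) : Lip S ⊤ (fun _ => 1) (fun w x => φ (X.v w x)) := by
  have hK : 0 ≤ K := by
    have := (abs_nonneg _).trans (hφ 1 0); simpa using this
  have hM0 : 0 ≤ M := (abs_nonneg _).trans (hM 0)
  have hmeas : ∀ w : X, AEStronglyMeasurable (fun x => φ (X.v w x)) volume := fun w =>
    hφc.comp_aestronglyMeasurable w.lb_v.meas
  refine ⟨K + M, by positivity, fun w _ => ?_, fun w _ z _ => ?_⟩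
  · exact LB.of_bound (hmeas w) (by positivity) (ae_of_all _ fun x => (hM _).trans (by linarith))
  · have h := ((X.lb_v_top (w - z)).congr (X.v_sub w z)).of_le_mul
      ((hmeas w).sub (hmeas z)) hK (ae_of_all _ fun x => hφ _ _)
    refine h.mono ?_
    have := mul_nonneg hM0 (norm_nonneg (w - z))
    linarith

/-- Here `φ 0 = 0` gives `|φ(v)| ≤ K |v|`, which puts `φ(v)` in `L²` at the price of the weight `1 +
‖w‖`. -/
lemma comp_v_two {φ : ℝ → ℝ} {K : ℝ} (hφ : ∀ x y, |φ x - φ y| ≤ K * |x - y|) (hφc : Continuous φ)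
    (h0 : φ 0 = 0) : Lip S 2 (fun w => 1 + ‖w‖) (fun w x => φ (X.v w x)) := by
  have hK : 0 ≤ K := by
    have := (abs_nonneg _).trans (hφ 1 0); simpa using this
  have hmeas : ∀ w : X, AEStronglyMeasurable (fun x => φ (X.v w x)) volume := fun w =>
    hφc.comp_aestronglyMeasurable w.lb_v.meas
  refine ⟨K, by positivity, fun w _ => ?_, fun w _ z _ => ?_⟩
  · refine (w.lb_v.of_le_mul (hmeas w) hK (ae_of_all _ fun x => ?_)).mono (by gcongr; linarith)
    simpa [h0] using hφ (X.v w x) 0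
  · refine (((X.lb_v (w - z)).congr (X.v_sub w z)).of_le_mul
      ((hmeas w).sub (hmeas z)) hK (ae_of_all _ fun x => hφ _ _)).mono ?_
    have := mul_nonneg (mul_nonneg hK (norm_nonneg z)) (norm_nonneg (w - z))
    linarith

/-- Composition with a locally Lipschitz function of `u`. -/
lemma comp_u {φ : ℝ → ℝ} {K M : ℝ} (hS : ∀ w ∈ S, LB ⊤ (X.u w) M)
    (hφ : ∀ x y, |x| ≤ M → |y| ≤ M → |φ x - φ y| ≤ K * |x - y|) (hK : 0 ≤ K) (hφc : Continuous φ)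
    (h0 : φ 0 = 0) : Lip S ⊤ (fun _ => 1) (fun w x => φ (X.u w x)) := by
  rcases S.eq_empty_or_nonempty with rfl | ⟨w₀, hw₀⟩
  · exact ⟨0, le_rfl, by simp, by simp⟩
  have hM : 0 ≤ M := (hS w₀ hw₀).nonneg
  have hmeas : ∀ w : X, AEStronglyMeasurable (fun x => φ (X.u w x)) volume := fun w =>
    hφc.comp_aestronglyMeasurable w.lb_u.meas
  refine ⟨K + K * M, by positivity, fun w hw => ?_, fun w hw z hz => ?_⟩
  · refine ((hS w hw).of_le_mul (hmeas w) hK ?_).mono (by linarith)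
    filter_upwards [(hS w hw).ae_le] with x hx
    simpa [h0] using hφ (X.u w x) 0 hx (by simpa using hM)
  · refine (((X.lb_u_top (w - z)).congr (X.u_sub w z)).of_le_mul
      ((hmeas w).sub (hmeas z)) hK ?_).mono ?_
    · filter_upwards [(hS w hw).ae_le, (hS z hz).ae_le] with x hx hx' using hφ _ _ hx hx'
    · have := mul_nonneg (mul_nonneg hK hM) (norm_nonneg (w - z))
      linarith

lemma comp_u_two {φ : ℝ → ℝ} {K M : ℝ} (hS : ∀ w ∈ S, LB ⊤ (X.u w) M)
    (hφ : ∀ x y, |x| ≤ M → |y| ≤ M → |φ x - φ y| ≤ K * |x - y|) (hK : 0 ≤ K) (hφc : Continuous φ)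
    (h0 : φ 0 = 0) : Lip S 2 (fun w => 1 + ‖w‖) (fun w x => φ (X.u w x)) := by
  have hmeas : ∀ w : X, AEStronglyMeasurable (fun x => φ (X.u w x)) volume := fun w =>
    hφc.comp_aestronglyMeasurable w.lb_u.meas
  refine ⟨K, by positivity, fun w hw => ?_, fun w hw z hz => ?_⟩
  · refine (w.lb_u.of_le_mul (hmeas w) hK ?_).mono (by gcongr; linarith)
    filter_upwards [(hS w hw).ae_le] with x hx
    simpa [h0] using hφ (X.u w x) 0 hx (by simpa using (hS w hw).nonneg)
  · refine (((X.lb_u (w - z)).congr (X.u_sub w z)).of_le_mul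
      ((hmeas w).sub (hmeas z)) hK ?_).mono ?_
    · filter_upwards [(hS w hw).ae_le, (hS z hz).ae_le] with x hx hx' using hφ _ _ hx hx'
    · have := mul_nonneg (mul_nonneg hK (norm_nonneg z)) (norm_nonneg (w - z))
      linarith

lemma q {Q : ℝ} (hS : ∀ w ∈ S, LB ⊤ (X.q w) Q) : Lip S ⊤ (fun _ => 1) X.q := by
  rcases S.eq_empty_or_nonempty with rfl | ⟨w₀, hw₀⟩
  · exact ⟨0, le_rfl, by simp, by simp⟩
  have hQ : 0 ≤ Q := (hS w₀ hw₀).nonneg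
  refine ⟨1 + Q, by positivity, fun w hw => (hS w hw).mono (by linarith), fun w _ z _ => ?_⟩
  refine ((X.lb_q (w - z)).congr (X.q_sub w z)).mono ?_
  have := mul_nonneg hQ (norm_nonneg (w - z))
  linarith

end Lip

end DualPowerCH

namespace DualPowerCH

open Filter Topology
open scoped ENNReal

/-! ### The right-hand side on regions where `q` is bounded below -/

/-- The density `cos²(v/2) q`. -/
noncomputable def dens (w : X) (x : ℝ) : ℝ := Real.cos (X.v w x / 2) ^ 2 * X.q w x

/-- The source `(G(u) cos²(v/2) + (s/2) sin²(v/2)) q`. -/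
noncomputable def src (c : Coeffs) (w : X) (x : ℝ) : ℝ :=
  (G c (X.u w x) * Real.cos (X.v w x / 2) ^ 2 + c.s / 2 * Real.sin (X.v w x / 2) ^ 2) * X.q w x

lemma integrand_eq (c : Coeffs) (w : X) (x : ℝ) :
    integrand c w x = fun y => kern (1 / √c.μ) (dens w) x y * src c w y := rfl

/-- Points with `|u| ≤ M`, `δ ≤ q ≤ Q` and `∫ sin²(v/2) ≤ N`. -/
structure Region (M δ Q N : ℝ) (w : X) : Prop where
  δ_pos : 0 < δ
  u : LB ⊤ (X.u w) M
  q : LB ⊤ (X.q w) Q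
  q_lower : ∀ᵐ x, δ ≤ X.q w x
  sin_le : ∫ x, Real.sin (X.v w x / 2) ^ 2 ≤ N

lemma abs_sin_half_sub_le (x y : ℝ) : |Real.sin (x / 2) - Real.sin (y / 2)| ≤ 1 / 2 * |x - y| := by
  have := Real.abs_sin_sub_sin_le (x / 2) (y / 2)
  rw [← sub_div, abs_div, abs_two] at this
  linarith

lemma abs_cos_half_sub_le (x y : ℝ) : |Real.cos (x / 2) - Real.cos (y / 2)| ≤ 1 / 2 * |x - y| := by
  have := Real.abs_cos_sub_cos_le (x / 2) (y / 2)
  rw [← sub_div, abs_div, abs_two] at this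
  linarith

lemma lb_sin_half (w : X) : LB 2 (fun x => Real.sin (X.v w x / 2)) ‖w‖ := by
  refine w.lb_v.of_le ((Real.continuous_sin.comp (continuous_id.div_const 2)).comp_aestronglyMeasurable
    w.lb_v.meas) (ae_of_all _ fun x => ?_)
  have := abs_sin_half_sub_le (X.v w x) 0
  simp only [zero_div, Real.sin_zero, sub_zero] at this
  have h2 := abs_nonneg (X.v w x)
  exact this.trans (by linarith)

lemma integrable_sin_sq (w : X) : Integrable fun x => Real.sin (X.v w x / 2) ^ 2 :=
  (lb_sin_half w).integrable_sq

lemma dens_meas (w : X) : AEStronglyMeasurable (dens w) volume :=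
  (((Real.continuous_cos.comp (continuous_id.div_const 2)).comp_aestronglyMeasurable
    w.lb_v.meas).pow 2).mul w.lb_q.meas

lemma cos_sq_le_one' (x : ℝ) : |Real.cos x ^ 2| ≤ 1 := by
  rw [abs_of_nonneg (sq_nonneg _)]; exact Real.cos_sq_le_one x

/-- A region on which the kernel decays uniformly. -/
lemma Region.kerAdm {M δ Q N ν : ℝ} (hν : 0 < ν) {w : X} (h : Region M δ Q N w) :
    KerAdm ν (ν * δ) (ν * δ * N) Q (dens w) := by
  have hδ := h.δ_pos
  have hlb : LB ⊤ (dens w) Q := by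
    refine h.q.of_le (dens_meas w) (ae_of_all _ fun x => ?_)
    rw [dens, abs_mul]
    exact mul_le_of_le_one_left (abs_nonneg _) (cos_sq_le_one' _)
  refine ⟨hν, by positivity, hlb, ?_, fun x y hxy => ?_⟩
  · filter_upwards [h.q_lower] with x hx
    exact mul_nonneg (sq_nonneg _) (by linarith)
  · have i1 : IntervalIntegrable (fun r => δ * (1 - Real.sin (X.v w r / 2) ^ 2)) volume x y :=
      (intervalIntegrable_const.sub (integrable_sin_sq w).intervalIntegrable).const_mul δ
    -- With `cos² = 1 - sin²` and `q ≥ δ`, the density is at least `δ` up to a loss of total mass at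
    -- most `δ N`; this loss is the additive constant `D` of `KerAdm`, after multiplication by `ν`.
    have h1 : ∫ r in x..y, δ * (1 - Real.sin (X.v w r / 2) ^ 2) ≤ ∫ r in x..y, dens w r := by
      refine intervalIntegral.integral_mono_ae hxy i1
        (hlb.locallyIntegrable.intervalIntegrable' x y) ?_
      filter_upwards [h.q_lower] with r hr
      rw [dens, Real.cos_sq', mul_comm δ]
      have : 0 ≤ 1 - Real.sin (X.v w r / 2) ^ 2 := by linarith [Real.sin_sq_le_one (X.v w r / 2)]
      gcongr
    rw [intervalIntegral.integral_const_mul, intervalIntegral.integral_sub intervalIntegrable_const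
      (integrable_sin_sq w).intervalIntegrable] at h1
    have h2 : ∫ r in x..y, Real.sin (X.v w r / 2) ^ 2 ≤ N := by
      rw [intervalIntegral.integral_of_le hxy]
      exact (setIntegral_le_integral (integrable_sin_sq w)
        (ae_of_all _ fun r => sq_nonneg _)).trans h.sin_le
    simp only [intervalIntegral.integral_const, smul_eq_mul, mul_one] at h1
    have h3 : δ * (y - x - N) ≤ ∫ r in x..y, dens w r := le_trans (by gcongr) h1
    calc ν * δ * (y - x) - ν * δ * N = ν * (δ * (y - x - N)) := by ring
      _ ≤ _ := by gcongr

lemma continuous_G (c : Coeffs) : Continuous (G c) := by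
  unfold G; fun_prop

lemma G_zero (c : Coeffs) : G c 0 = 0 := by simp [G]

lemma G_lipschitz (c : Coeffs) (M : ℝ) : ∃ K, 0 ≤ K ∧ ∀ x y, |x| ≤ M → |y| ≤ M →
    |G c x - G c y| ≤ K * |x - y| := by
  have hcd : ContDiff ℝ 1 (G c) := by unfold G; fun_prop
  obtain ⟨K, hK⟩ := hcd.contDiffOn.exists_lipschitzOnWith (by decide) (convex_Icc (-M) M)
      isCompact_Icc
  exact ⟨K, K.2, fun x y hx hy => hK.dist_le_mul x (abs_le.1 hx) y (abs_le.1 hy)⟩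

lemma P_eq (c : Coeffs) {M δ Q N : ℝ} (hμ : 0 < c.μ) {w : X} (h : Region M δ Q N w) {A : ℝ}
    (hf : LB ⊤ (src c w) A) (x : ℝ) :
    P c w x = 1 / (2 * √c.μ) * (nl Ioi (1 / √c.μ) (dens w) (src c w) x +
      nl Iic (1 / √c.μ) (dens w) (src c w) x) := by
  have hν : 0 < 1 / √c.μ := by positivity
  have hi := (h.kerAdm hν).integrable hf x
  rw [P, integrand_eq, nl, nl, add_comm, intervalIntegral.integral_Iic_add_Ioi hi.integrableOn
    hi.integrableOn]

lemma Px_eq (c : Coeffs) (w : X) (x : ℝ) :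
    Px c w x = 1 / (2 * c.μ) * (nl Ioi (1 / √c.μ) (dens w) (src c w) x -
      nl Iic (1 / √c.μ) (dens w) (src c w) x) := rfl

/-- The derivative of `-P_x`. -/
noncomputable def negPxDeriv (c : Coeffs) (w : X) (x : ℝ) : ℝ :=
  1 / c.μ * (src c w x - dens w x * P c w x)

noncomputable def vRHS (c : Coeffs) (w : X) (x : ℝ) : ℝ :=
  1 / c.μ * (1 + Real.cos (X.v w x)) * (G c (X.u w x) - P c w x)
      - c.s / c.μ * Real.sin (X.v w x / 2) ^ 2

noncomputable def qRHS (c : Coeffs) (w : X) (x : ℝ) : ℝ :=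
  1 / c.μ * (c.s / 2 + G c (X.u w x) - P c w x) * Real.sin (X.v w x) * X.q w x

section RegionLip

variable {M δ Q N : ℝ} (c : Coeffs)

lemma lip_cos_sq (S : Set X) :
    Lip S ⊤ (fun _ => 1) (fun w x => Real.cos (X.v w x / 2) ^ 2) := by
  have h : Lip S ⊤ (fun _ => 1) (fun w x => Real.cos (X.v w x / 2)) :=
    Lip.comp_v (φ := fun y => Real.cos (y / 2)) abs_cos_half_sub_le (by fun_prop)
      (fun x => Real.abs_cos_le_one _)
  exact (h.mul h).congr fun w x => by ring

lemma lip_sin_half (S : Set X) :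
    Lip S ⊤ (fun _ => 1) (fun w x => Real.sin (X.v w x / 2)) :=
  Lip.comp_v (φ := fun y => Real.sin (y / 2)) abs_sin_half_sub_le (by fun_prop)
      (fun x => Real.abs_sin_le_one _)

lemma lip_sin_half_two (S : Set X) :
    Lip S 2 (fun w => 1 + ‖w‖) (fun w x => Real.sin (X.v w x / 2)) :=
  Lip.comp_v_two (φ := fun y => Real.sin (y / 2)) abs_sin_half_sub_le (by fun_prop)
      (by simp)

lemma lip_sin_sq (S : Set X) :
    Lip S ⊤ (fun _ => 1) (fun w x => Real.sin (X.v w x / 2) ^ 2) :=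
  ((lip_sin_half S).mul (lip_sin_half S)).congr fun w x => by ring

lemma lip_sin_sq_two (S : Set X) :
    Lip S 2 (fun w => 1 + ‖w‖) (fun w x => Real.sin (X.v w x / 2) ^ 2) :=
  ((lip_sin_half S).mul (lip_sin_half_two S)).congr fun w x => by ring

lemma lip_q : Lip {w | Region M δ Q N w} ⊤ (fun _ => 1) X.q := Lip.q fun _ hw => hw.q

lemma lip_dens : Lip {w | Region M δ Q N w} ⊤ (fun _ => 1) dens := (lip_cos_sq _).mul lip_q

lemma lip_G : Lip {w | Region M δ Q N w} ⊤ (fun _ => 1) (fun w x => G c (X.u w x)) := by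
  obtain ⟨K, hK, h⟩ := G_lipschitz c M
  exact Lip.comp_u (fun _ hw => hw.u) h hK (continuous_G c) (G_zero c)

lemma lip_G_two :
    Lip {w | Region M δ Q N w} 2 (fun w => 1 + ‖w‖) (fun w x => G c (X.u w x)) := by
  obtain ⟨K, hK, h⟩ := G_lipschitz c M
  exact Lip.comp_u_two (fun _ hw => hw.u) h hK (continuous_G c) (G_zero c)

lemma lip_one_add_cos (S : Set X) :
    Lip S ⊤ (fun _ => 1) (fun w x => 1 / c.μ * (1 + Real.cos (X.v w x))) :=
  ((Lip.const S 1).add (Lip.comp_v (φ := Real.cos) (K := 1)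
    (fun x y => by simpa using Real.abs_cos_sub_cos_le x y) Real.continuous_cos
      Real.abs_cos_le_one)).const_mul _

lemma lip_src : Lip {w | Region M δ Q N w} ⊤ (fun _ => 1) (src c) :=
  (((lip_G c).mul (lip_cos_sq _)).add ((lip_sin_sq _).const_mul _)).mul lip_q

lemma lip_src_two : Lip {w | Region M δ Q N w} 2 (fun w => 1 + ‖w‖) (src c) :=
  (((lip_G_two c).mul_right (lip_cos_sq _)).add ((lip_sin_sq_two _).const_mul _)).mul_right lip_q

variable {c}

lemma Region.src_lb {w : X} (h : Region M δ Q N w) : ∃ A, LB ⊤ (src c w) A := by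
  obtain ⟨C, -, h1, -⟩ := lip_src (M := M) (δ := δ) (Q := Q) (N := N) c
  exact ⟨_, h1 w h⟩

variable (hμ : 0 < c.μ)
include hμ

lemma lip_nl {p : ℝ≥0∞} (hp : p = 2 ∨ p = ⊤) [Fact (1 ≤ p)] {θ : X → ℝ}
    (h : Lip {w | Region M δ Q N w} p θ (src c)) :
    Lip {w | Region M δ Q N w} p θ (fun w => nl Ioi (1 / √c.μ) (dens w) (src c w)) ∧
    Lip {w | Region M δ Q N w} p θ (fun w => nl Iic (1 / √c.μ) (dens w) (src c w)) := by
  have hν : 0 < 1 / √c.μ := by positivity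
  exact ⟨Lip.nl hp (fun w hw => hw.kerAdm hν) lip_dens (lip_src c) h
    fun w hw f A hf => ((Region.kerAdm hν hw).isPrim_nl_Ioi hf).continuous,
    Lip.nl hp (fun w hw => hw.kerAdm hν) lip_dens (lip_src c) h
    fun w hw f A hf => ((Region.kerAdm hν hw).isPrim_nl_Iic hf).continuous⟩

lemma lip_P_aux {p : ℝ≥0∞} (hp : p = 2 ∨ p = ⊤) [Fact (1 ≤ p)] {θ : X → ℝ}
    (h : Lip {w | Region M δ Q N w} p θ (src c)) :
    Lip {w | Region M δ Q N w} p θ (P c) := by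
  have h0 := ((lip_nl hμ hp h).1.add (lip_nl hμ hp h).2).const_mul (1 / (2 * √c.μ))
  obtain ⟨C, hC, h1, h2⟩ := h0
  have e : ∀ w, Region M δ Q N w → P c w = fun x => 1 / (2 * √c.μ) *
      (nl Ioi (1 / √c.μ) (dens w) (src c w) x + nl Iic (1 / √c.μ) (dens w) (src c w) x) := by
    intro w hw
    obtain ⟨A, hA⟩ := hw.src_lb (c := c)
    exact funext fun x => P_eq c hμ hw hA x
  refine ⟨C, hC, fun w hw => ?_, fun w hw z hz => ?_⟩
  · rw [e w hw]; exact h1 w hw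
  · rw [e w hw, e z hz]; exact h2 w hw z hz

lemma lip_P : Lip {w | Region M δ Q N w} ⊤ (fun _ => 1) (P c) :=
  lip_P_aux hμ (Or.inr rfl) (lip_src c)

lemma lip_P_two : Lip {w | Region M δ Q N w} 2 (fun w => 1 + ‖w‖) (P c) :=
  lip_P_aux hμ (Or.inl rfl) (lip_src_two c)

lemma lip_Px_two : Lip {w | Region M δ Q N w} 2 (fun w => 1 + ‖w‖) (fun w x => -Px c w x) :=
  (((lip_nl hμ (Or.inl rfl) (lip_src_two c)).1.sub
    (lip_nl hμ (Or.inl rfl) (lip_src_two c)).2).const_mul (1 / (2 * c.μ))).neg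

lemma lip_negPxDeriv : Lip {w | Region M δ Q N w} 2 (fun w => 1 + ‖w‖) (negPxDeriv c) :=
  ((lip_src_two c).sub (lip_dens.mul (lip_P_two hμ))).const_mul _

lemma lip_vRHS : Lip {w | Region M δ Q N w} ⊤ (fun _ => 1) (vRHS c) :=
  ((lip_one_add_cos c _).mul ((lip_G c).sub (lip_P hμ))).sub ((lip_sin_sq _).const_mul _)

lemma lip_vRHS_two : Lip {w | Region M δ Q N w} 2 (fun w => 1 + ‖w‖) (vRHS c) :=
  ((lip_one_add_cos c _).mul ((lip_G_two c).sub (lip_P_two hμ))).sub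
    ((lip_sin_sq_two _).const_mul _)

lemma lip_qRHS : Lip {w | Region M δ Q N w} ⊤ (fun _ => 1) (qRHS c) :=
  (((((Lip.const _ (c.s / 2)).add (lip_G c)).sub (lip_P hμ)).const_mul _).mul
    (Lip.comp_v (φ := Real.sin) (K := 1)
    (fun x y => by simpa using Real.abs_sin_sub_sin_le x y) Real.continuous_sin
      Real.abs_sin_le_one)).mul lip_q

/-- In the sum of the two one-sided operators the endpoint terms `∓ src` cancel, and what remains is
the density times the difference of the operators, that is, `P_x`. -/
lemma Region.isPrim_P {w : X} (h : Region M δ Q N w) :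
    IsPrim (P c w) (fun x => dens w x * Px c w x) := by
  have hν : 0 < 1 / √c.μ := by positivity
  obtain ⟨A, hA⟩ := h.src_lb (c := c)
  have h1 := (((h.kerAdm hν).isPrim_nl_Ioi hA).add ((h.kerAdm hν).isPrim_nl_Iic hA)).const_mul
    (1 / (2 * √c.μ))
  convert h1 using 1
  · exact funext fun x => P_eq c hμ h hA x
  · ext x
    rw [Px_eq]
    have : √c.μ * √c.μ = c.μ := Real.mul_self_sqrt hμ.le
    have h2 : √c.μ ≠ 0 := by positivity
    field_simp
    rw [sq, this]; ring

/-- In the difference the endpoint terms add up instead of cancelling, which produces the local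
source term. With the `L²` bounds, this shows that the first component of the right-hand side is in
`H¹`. -/
lemma Region.isPrim_Px {w : X} (h : Region M δ Q N w) :
    IsPrim (fun x => -Px c w x) (negPxDeriv c w) := by
  have hν : 0 < 1 / √c.μ := by positivity
  obtain ⟨A, hA⟩ := h.src_lb (c := c)
  have h1 := (((h.kerAdm hν).isPrim_nl_Ioi hA).add
    (((h.kerAdm hν).isPrim_nl_Iic hA).const_mul (-1))).const_mul (-(1 / (2 * c.μ)))
  convert h1 using 1
  · ext x; rw [Px_eq]; ring
  · ext x
    rw [negPxDeriv, P_eq c hμ h hA]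
    have h2 : √c.μ ≠ 0 := by positivity
    field_simp
    ring

end RegionLip

/-- `w'` is the value at `w` of the right-hand side, including the weak derivative of its first
component. -/
structure FullRHS (c : Coeffs) (w w' : X) : Prop extends IsRHS c w w' where
  ux_eq : X.ux w' =ᵐ[volume] negPxDeriv c w

lemma Region.exists_fullRHS {M δ Q N : ℝ} {c : Coeffs} (hμ : 0 < c.μ) {w : X}
    (h : Region M δ Q N w) : ∃ w' : X, FullRHS c w w' := by
  have hν : 0 < 1 / √c.μ := by positivity
  obtain ⟨A, hA⟩ := h.src_lb (c := c)
  obtain ⟨_, -, h1, -⟩ := lip_Px_two (M := M) (δ := δ) (Q := Q) (N := N) hμ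
  obtain ⟨_, -, h2, -⟩ := lip_negPxDeriv (M := M) (δ := δ) (Q := Q) (N := N) hμ
  obtain ⟨_, -, h3, -⟩ := lip_vRHS_two (M := M) (δ := δ) (Q := Q) (N := N) hμ
  obtain ⟨_, -, h4, -⟩ := lip_vRHS (M := M) (δ := δ) (Q := Q) (N := N) hμ
  obtain ⟨_, -, h5, -⟩ := lip_qRHS (M := M) (δ := δ) (Q := Q) (N := N) hμ
  obtain ⟨w', e1, e2, e3, e4⟩ := X.exists_of_functions (h.isPrim_Px hμ) (h1 w h) (h2 w h)
    (h3 w h) (h4 w h) (h5 w h)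
  exact ⟨w', ⟨fun x => (h.kerAdm hν).integrable hA x, e1, e3, e4⟩, e2⟩

lemma IsRHS.unique {c : Coeffs} {w z z' : X} (h : IsRHS c w z) (h' : IsRHS c w z') : z = z' := by
  have e1 : X.u z =ᵐ[volume] X.u z' := EventuallyEq.trans h.u_eq (EventuallyEq.symm h'.u_eq)
  exact X.ext_ae e1 (X.ux_congr e1) (EventuallyEq.trans h.v_eq (EventuallyEq.symm h'.v_eq))
    (EventuallyEq.trans h.q_eq (EventuallyEq.symm h'.q_eq))

/-- On a region, the right-hand side grows linearly and is locally Lipschitz. -/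
lemma exists_bound_fullRHS {c : Coeffs} (hμ : 0 < c.μ) (M δ Q N : ℝ) : ∃ C, 0 ≤ C ∧
    (∀ w w', Region M δ Q N w → FullRHS c w w' → ‖w'‖ ≤ C * (1 + ‖w‖)) ∧
    ∀ w w' z z', Region M δ Q N w → FullRHS c w w' → Region M δ Q N z → FullRHS c z z' →
      ‖w' - z'‖ ≤ C * (1 + ‖z‖) * ‖w - z‖ := by
  obtain ⟨C1, hC1, a1, b1⟩ := lip_Px_two (M := M) (δ := δ) (Q := Q) (N := N) hμ
  obtain ⟨C2, hC2, a2, b2⟩ := lip_negPxDeriv (M := M) (δ := δ) (Q := Q) (N := N) hμ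
  obtain ⟨C3, hC3, a3, b3⟩ := lip_vRHS_two (M := M) (δ := δ) (Q := Q) (N := N) hμ
  obtain ⟨C4, hC4, a4, b4⟩ := lip_vRHS (M := M) (δ := δ) (Q := Q) (N := N) hμ
  obtain ⟨C5, hC5, a5, b5⟩ := lip_qRHS (M := M) (δ := δ) (Q := Q) (N := N) hμ
  have key : ∀ r : ℝ, 0 ≤ r → C1 * (1 + r) ≤ (C1 + C2 + C3 + C4 + C5) * (1 + r) ∧
      C2 * (1 + r) ≤ (C1 + C2 + C3 + C4 + C5) * (1 + r) ∧
      C3 * (1 + r) ≤ (C1 + C2 + C3 + C4 + C5) * (1 + r) ∧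
      C4 * 1 ≤ (C1 + C2 + C3 + C4 + C5) * (1 + r) ∧
      C5 * 1 ≤ (C1 + C2 + C3 + C4 + C5) * (1 + r) := by
    intro r hr
    refine ⟨?_, ?_, ?_, ?_, ?_⟩ <;> (gcongr <;> linarith)
  refine ⟨C1 + C2 + C3 + C4 + C5, by positivity, fun w w' hw hw' => ?_,
    fun w w' z z' hw hw' hz hz' => ?_⟩
  · obtain ⟨k1, k2, k3, k4, k5⟩ := key ‖w‖ (norm_nonneg w)
    exact X.norm_le (((a1 w hw).mono k1).congr (EventuallyEq.symm hw'.u_eq))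
      (((a2 w hw).mono k2).congr hw'.ux_eq.symm)
      (((a3 w hw).mono k3).congr (EventuallyEq.symm hw'.v_eq))
      (((a4 w hw).mono k4).congr (EventuallyEq.symm hw'.v_eq))
      (((a5 w hw).mono k5).congr (EventuallyEq.symm hw'.q_eq))
  · obtain ⟨k1, k2, k3, k4, k5⟩ := key ‖z‖ (norm_nonneg z)
    have hd := norm_nonneg (w - z)
    refine X.norm_le (((b1 w hw z hz).mono (mul_le_mul_of_nonneg_right k1 hd)).congr ?_)
      (((b2 w hw z hz).mono (mul_le_mul_of_nonneg_right k2 hd)).congr ?_)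
      (((b3 w hw z hz).mono (mul_le_mul_of_nonneg_right k3 hd)).congr ?_)
      (((b4 w hw z hz).mono (mul_le_mul_of_nonneg_right k4 hd)).congr ?_)
      (((b5 w hw z hz).mono (mul_le_mul_of_nonneg_right k5 hd)).congr ?_)
    · filter_upwards [X.u_sub w' z', hw'.u_eq, hz'.u_eq] with x h1 h2 h3
      rw [h1, h2, h3]
    · filter_upwards [X.ux_sub w' z', hw'.ux_eq, hz'.ux_eq] with x h1 h2 h3
      rw [h1, h2, h3]
    · filter_upwards [X.v_sub w' z', hw'.v_eq, hz'.v_eq] with x h1 h2 h3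
      rw [h1, h2, h3]; rfl
    · filter_upwards [X.v_sub w' z', hw'.v_eq, hz'.v_eq] with x h1 h2 h3
      rw [h1, h2, h3]; rfl
    · filter_upwards [X.q_sub w' z', hw'.q_eq, hz'.q_eq] with x h1 h2 h3
      rw [h1, h2, h3]; rfl

end DualPowerCH

/-! ### Autonomous ODEs in a Banach space: uniqueness, continuation, global existence -/

namespace DualPowerCH

open Filter Topology Metric
open scoped NNReal

section AbstractODE

variable {E : Type*} [NormedAddCommGroup E] [NormedSpace ℝ E]

/-- `w` solves `w' = F(w)` on `[0,T]`, inside `Ω`, with `w(0) = x₀`. -/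
structure SolOn (F : E → E) (Ω : Set E) (x₀ : E) (T : ℝ) (w : ℝ → E) : Prop where
  init : w 0 = x₀
  mem : ∀ t ∈ Icc 0 T, w t ∈ Ω
  deriv : ∀ t ∈ Icc 0 T, HasDerivWithinAt w (F (w t)) (Icc 0 T) t

variable {F : E → E} {Ω : Set E} {x₀ : E} {T T' : ℝ} {w z : ℝ → E}

lemma SolOn.mono (h : SolOn F Ω x₀ T w) (hT : T' ≤ T) : SolOn F Ω x₀ T' w := by
  have hs : Icc 0 T' ⊆ Icc 0 T := Icc_subset_Icc_right hT
  exact ⟨h.init, fun t ht => h.mem t (hs ht), fun t ht => (h.deriv t (hs ht)).mono hs⟩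

lemma SolOn.continuousOn (h : SolOn F Ω x₀ T w) : ContinuousOn w (Icc 0 T) :=
  fun t ht => (h.deriv t ht).continuousWithinAt

lemma hasDerivWithinAt_Ici_of_Icc {w' : E} {a b t : ℝ} (h : HasDerivWithinAt w w' (Icc a b) t)
    (ht : t ∈ Ico a b) : HasDerivWithinAt w w' (Ici t) t :=
  h.mono_of_mem_nhdsWithin (mem_of_superset (Icc_mem_nhdsGE ht.2) (Icc_subset_Icc_left ht.1))

/-- Solutions are unique as long as one of them stays in a set where the vector field is locally
Lipschitz. -/
lemma SolOn.eqOn_of_locallyLipschitz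
    (hloc : ∀ x ∈ Ω, ∃ ε > 0, ∃ K : ℝ≥0, closedBall x ε ⊆ Ω ∧ LipschitzOnWith K F (closedBall x ε))
    (hw : SolOn F Ω x₀ T w) {z' : ℝ → E} (hz0 : z 0 = x₀)
    (hz : ∀ t ∈ Icc 0 T, HasDerivWithinAt z (z' t) (Icc 0 T) t)
    (hz' : ∀ t ∈ Icc 0 T, z t ∈ Ω → z' t = F (z t)) : EqOn z w (Icc 0 T) := by
  have hwc := hw.continuousOn
  have hzc : ContinuousOn z (Icc 0 T) := fun t ht => (hz t ht).continuousWithinAt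
  have hcl : IsClosed ({t | z t = w t} ∩ Icc 0 T) := by
    have : {t | z t = w t} ∩ Icc 0 T = Icc 0 T ∩ (fun t => z t - w t) ⁻¹' {0} := by
      ext t; simp [sub_eq_zero, and_comm]
    rw [this]
    exact (hzc.sub hwc).preimage_isClosed_of_isClosed isClosed_Icc isClosed_singleton
  -- Continuous induction along the closed set of agreement. At a time `x` of agreement both curves
  -- remain for a while in a ball around `w x` contained in `Ω`, so `z` solves the equation there
  -- even though it is not assumed to stay in `Ω`.
  refine hcl.Icc_subset_of_forall_exists_gt (by simp [hz0, hw.init]) fun x hx y hy => ?_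
  obtain ⟨hxe, hxI⟩ := hx
  have hxI' : x ∈ Icc 0 T := Ico_subset_Icc_self hxI
  obtain ⟨ε, hε, K, hball, hK⟩ := hloc _ (hw.mem x hxI')
  have e1 : ∀ᶠ t in 𝓝[Icc 0 T] x, w t ∈ closedBall (w x) ε :=
    (hwc x hxI').eventually_mem (closedBall_mem_nhds _ hε)
  have e2 : ∀ᶠ t in 𝓝[Icc 0 T] x, z t ∈ closedBall (w x) ε := by
    refine (hzc x hxI').eventually_mem ?_
    rw [show z x = w x from hxe]; exact closedBall_mem_nhds _ hε
  have hle : 𝓝[≥] x ≤ 𝓝[Icc 0 T] x := by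
    refine nhdsWithin_le_of_mem (mem_of_superset (Icc_mem_nhdsGE hxI.2) (Icc_subset_Icc_left hxI.1))
  obtain ⟨b, hb, hbs⟩ := (mem_nhdsGE_iff_exists_Icc_subset).1 (hle (e1.and e2))
  set m := min (min b T) y with hm
  have hxm : x < m := lt_min (lt_min hb hxI.2) hy
  have hmb : m ≤ b := (min_le_left _ _).trans (min_le_left _ _)
  have hmT : m ≤ T := (min_le_left _ _).trans (min_le_right _ _)
  have hsub : Icc x m ⊆ Icc 0 T := Icc_subset_Icc hxI.1 hmT
  have hmem : ∀ t ∈ Ico x m, w t ∈ closedBall (w x) ε ∧ z t ∈ closedBall (w x) ε := fun t ht =>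
    hbs ⟨ht.1, ht.2.le.trans hmb⟩
  have key := ODE_solution_unique_of_mem_Icc_right (v := fun _ => F)
    (s := fun _ => closedBall (w x) ε) (K := K) (f := z) (g := w) (a := x) (b := m)
    (fun _ _ => hK) (hzc.mono hsub) (fun t ht => ?_) (fun t ht => (hmem t ht).2)
    (hwc.mono hsub) (fun t ht => ?_) (fun t ht => (hmem t ht).1) hxe
  · exact ⟨m, key ⟨hxm.le, le_rfl⟩, hxm, min_le_right _ _⟩
  · have htI := hsub (Ico_subset_Icc_self ht)
    rw [← hz' t htI (hball (hmem t ht).2)]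
    exact hasDerivWithinAt_Ici_of_Icc (hz t htI) ⟨htI.1, ht.2.trans_le hmT⟩
  · have htI := hsub (Ico_subset_Icc_self ht)
    exact hasDerivWithinAt_Ici_of_Icc (hw.deriv t htI) ⟨htI.1, ht.2.trans_le hmT⟩

variable [CompleteSpace E]

/-- Picard-Lindelöf for an autonomous vector field, with control on the range of the solution. -/
lemma exists_sol_mem_closedBall {x : E} {ε : ℝ≥0} {K L : ℝ≥0}
    (hK : LipschitzOnWith K F (closedBall x ε)) (hL : ∀ y ∈ closedBall x ε, ‖F y‖ ≤ L)
    {a τ : ℝ} (hτ : 0 ≤ τ) (hτL : L * τ ≤ ε) :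
    ∃ α : ℝ → E, α a = x ∧ (∀ t, α t ∈ closedBall x ε) ∧
      ∀ t ∈ Icc a (a + τ), HasDerivWithinAt α (F (α t)) (Icc a (a + τ)) t := by
  have hmem : a ∈ Icc a (a + τ) := ⟨le_rfl, by linarith⟩
  have hf : IsPicardLindelof (fun _ => F) (⟨a, hmem⟩ : Icc a (a + τ)) x ε 0 L K :=
    IsPicardLindelof.of_time_independent hL hK (by simpa [hτ] using hτL)
  have hx : x ∈ closedBall x ((0 : ℝ≥0) : ℝ) := mem_closedBall_self le_rfl
  -- Working with the fixed point of the Picard map itself retains the information that the curve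
  -- takes values in the ball.
  obtain ⟨α, hα⟩ := ODE.FunSpace.exists_isFixedPt_next hf hx
  refine ⟨α.compProj, ?_, fun t => α.compProj_mem_closedBall hf.mul_max_le, fun t ht => ?_⟩
  · have : α.compProj ((⟨a, hmem⟩ : Icc a (a + τ)) : ℝ) = x := by
      rw [ODE.FunSpace.compProj_val, ← hα, ODE.FunSpace.next_apply₀]
    exact this
  · apply ODE.hasDerivWithinAt_picard_Icc hmem hf.continuousOn_uncurry
      α.continuous_compProj.continuousOn (fun _ _ ↦ α.compProj_mem_closedBall hf.mul_max_le)
      x ht |>.congr_of_mem _ ht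
    intro t' ht'
    nth_rw 1 [← hα]
    rw [ODE.FunSpace.compProj_of_mem ht', ODE.FunSpace.next_apply]

lemma SolOn.extend (hw : SolOn F Ω x₀ T w) (hT : 0 ≤ T) {ε : ℝ≥0} {K L : ℝ≥0}
    (hΩ : closedBall (w T) ε ⊆ Ω) (hK : LipschitzOnWith K F (closedBall (w T) ε))
    (hL : ∀ y ∈ closedBall (w T) ε, ‖F y‖ ≤ L) {τ : ℝ} (hτ : 0 ≤ τ) (hτL : L * τ ≤ ε) :
    ∃ w₁, SolOn F Ω x₀ (T + τ) w₁ := by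
  obtain ⟨α, hα, hαm, hαd⟩ := exists_sol_mem_closedBall hK hL (a := T) hτ hτL
  set w₁ : ℝ → E := fun t => if t ≤ T then w t else α t with hw₁
  have e1 : EqOn w₁ w (Icc 0 T) := fun t ht => if_pos ht.2
  have e2 : EqOn w₁ α (Icc T (T + τ)) := fun t ht => by
    rcases eq_or_lt_of_le ht.1 with rfl | h
    · simp only [hw₁, le_refl, if_true]; exact hα.symm
    · exact if_neg (not_le.2 h)
  have hun : Icc 0 T ∪ Icc T (T + τ) = Icc 0 (T + τ) := Icc_union_Icc_eq_Icc hT (by linarith)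
  refine ⟨w₁, ?_, fun t ht => ?_, fun t ht => ?_⟩
  · rw [e1 ⟨le_rfl, hT⟩, hw.init]
  · rw [← hun] at ht
    rcases ht with ht | ht
    · rw [e1 ht]; exact hw.mem t ht
    · rw [e2 ht]; exact hΩ (hαm t)
  · rw [← hun] at ht ⊢
    -- Each piece is differentiated within its own closed interval. At a point outside that interval
    -- the condition is vacuous, and at the junction both pieces have derivative `F (w T)`.
    refine HasDerivWithinAt.union ?_ ?_
    · by_cases h : t ∈ Icc 0 T
      · rw [e1 h]; exact (hw.deriv t h).congr_of_mem (fun x hx => e1 hx) h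
      · exact HasFDerivWithinAt.of_notMem_closure (by rwa [isClosed_Icc.closure_eq])
    · by_cases h : t ∈ Icc T (T + τ)
      · rw [e2 h]; exact (hαd t h).congr_of_mem (fun x hx => e2 hx) h
      · exact HasFDerivWithinAt.of_notMem_closure (by rwa [isClosed_Icc.closure_eq])

/-- Global existence from a-priori control on every bounded time interval. -/
theorem exists_global_of_apriori
    (hloc : ∀ x ∈ Ω, ∃ ε > 0, ∃ K : ℝ≥0, closedBall x ε ⊆ Ω ∧ LipschitzOnWith K F (closedBall x ε))
    (hx₀ : x₀ ∈ Ω)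
    (hap : ∀ T : ℝ, 0 ≤ T → ∃ ε K L : ℝ≥0, 0 < ε ∧ ∀ T' ∈ Icc 0 T, ∀ w, SolOn F Ω x₀ T' w →
      closedBall (w T') ε ⊆ Ω ∧ LipschitzOnWith K F (closedBall (w T') ε) ∧
        ∀ y ∈ closedBall (w T') ε, ‖F y‖ ≤ L) :
    ∃ w : ℝ → E, w 0 = x₀ ∧ ∀ t ∈ Ici (0 : ℝ), w t ∈ Ω ∧ HasDerivWithinAt w (F (w t)) (Ici 0) t := by
  have hfin : ∀ T : ℝ, 0 ≤ T → ∃ w, SolOn F Ω x₀ T w := by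
    intro T hT
    obtain ⟨ε, K, L, hε, h⟩ := hap T hT
    set τ : ℝ := ε / (L + 1) with hτ
    have hε' : (0 : ℝ) < ε := hε
    have hτ0 : 0 < τ := by positivity
    have hτL : L * τ ≤ ε := by
      rw [hτ, ← mul_div_assoc, div_le_iff₀ (by positivity)]
      nlinarith [L.2]
    -- Overshooting `T` by one step is harmless: the a priori control is applied only at the start
    -- of a step, which is at most `T`.
    have hn : ∀ n : ℕ, n * τ ≤ T + τ → ∃ w, SolOn F Ω x₀ (n * τ) w := by
      intro n
      induction n with
      | zero =>
        intro _
        refine ⟨fun _ => x₀, rfl, fun _ _ => hx₀, fun t ht => ?_⟩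
        simp only [Nat.cast_zero, zero_mul, Icc_self, mem_singleton_iff] at ht ⊢
        exact HasFDerivWithinAt.of_subsingleton subsingleton_singleton
      | succ n ih =>
        intro hle
        push_cast at hle ⊢
        rw [add_mul, one_mul] at hle ⊢
        obtain ⟨w, hw⟩ := ih (by linarith)
        have h0 : 0 ≤ n * τ := by positivity
        obtain ⟨h1, h2, h3⟩ := h (n * τ) ⟨h0, by linarith⟩ w hw
        exact hw.extend h0 h1 h2 h3 hτ0.le hτL
    have hceil := Nat.ceil_lt_add_one (div_nonneg hT hτ0.le)
    have hceil' := Nat.le_ceil (T / τ)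
    rw [div_le_iff₀ hτ0] at hceil'
    obtain ⟨w, hw⟩ := hn ⌈T / τ⌉₊ (by
      have := mul_le_mul_of_nonneg_right hceil.le hτ0.le
      rwa [add_mul, div_mul_cancel₀ _ hτ0.ne', one_mul] at this)
    exact ⟨w, hw.mono hceil'⟩
  choose W hW using fun n : ℕ => hfin n n.cast_nonneg
  have hcons : ∀ m n : ℕ, ∀ t : ℝ, 0 ≤ t → t ≤ m → t ≤ n → W m t = W n t := by
    intro m n t h0 hm hn
    have hm' := (hW m).mono hm
    have hn' := (hW n).mono hn
    exact hn'.eqOn_of_locallyLipschitz hloc (z' := fun t => F (W m t)) hm'.init hm'.deriv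
      (fun _ _ _ => rfl) ⟨h0, le_rfl⟩
  -- The extra `1` places `t` strictly before the end of the interval of the chosen solution, so
  -- that derivatives within `[0, n]` are derivatives within `[0, ∞)`.
  set w : ℝ → E := fun t => W (⌈t⌉₊ + 1) t with hw
  have hwW : ∀ (n : ℕ) (t : ℝ), 0 ≤ t → t ≤ n → w t = W n t := fun n t h0 hn =>
    hcons _ _ t h0 (by push_cast; linarith [Nat.le_ceil t]) hn
  refine ⟨w, ?_, fun t ht => ?_⟩
  · rw [hwW 0 0 le_rfl (by simp)]; exact (hW 0).init
  · set n := ⌈t⌉₊ + 1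
    have htn : t < n := by simp only [n]; push_cast; linarith [Nat.le_ceil t]
    have htI : t ∈ Icc (0 : ℝ) n := ⟨ht, htn.le⟩
    have hEq : EqOn w (W n) (Icc 0 n) := fun s hs => hwW n s hs.1 hs.2
    refine ⟨by rw [hEq htI]; exact (hW n).mem t htI, ?_⟩
    rw [hEq htI]
    refine (((hW n).deriv t htI).congr_of_mem (fun x hx => hEq hx) htI).mono_of_mem_nhdsWithin ?_
    rw [← Ici_inter_Iic]
    exact inter_mem self_mem_nhdsWithin (mem_nhdsWithin_of_mem_nhds (Iic_mem_nhds htn))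

end AbstractODE

end DualPowerCH

/-! ### Time derivatives of curves of functions in the `L^p` seminorm -/

namespace DualPowerCH

open Filter Topology Asymptotics
open scoped ENNReal

/-- The curve `τ ↦ f τ` is differentiable at `t` within `s`, in the `L^p` seminorm. -/
structure DL (p : ℝ≥0∞) (s : Set ℝ) (t : ℝ) (f : ℝ → ℝ → ℝ) (f' : ℝ → ℝ) : Prop where
  bdd : ∃ C, LB p (f t) C
  bdd' : ∃ C, LB p f' C
  diff : ∃ e : ℝ → ℝ, e =o[𝓝[s] t] (fun τ => τ - t) ∧
    ∀ᶠ τ in 𝓝[s] t, LB p (fun x => f τ x - f t x - (τ - t) * f' x) (e τ)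

namespace DL

variable {p : ℝ≥0∞} {s : Set ℝ} {t : ℝ} {f g : ℝ → ℝ → ℝ} {f' g' : ℝ → ℝ}

lemma tendsto_sub (s : Set ℝ) (t : ℝ) : Tendsto (fun τ => τ - t) (𝓝[s] t) (𝓝 0) := by
  have : Tendsto (fun τ => τ - t) (𝓝 t) (𝓝 (t - t)) := tendsto_id.sub_const t
  rw [sub_self] at this
  exact this.mono_left nhdsWithin_le_nhds

lemma isLittleO_sq (s : Set ℝ) (t C : ℝ) :
    (fun τ => C * |τ - t| * |τ - t|) =o[𝓝[s] t] (fun τ => τ - t) := by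
  have h1 : (fun τ => C * |τ - t|) =o[𝓝[s] t] (fun _ => (1 : ℝ)) := by
    rw [isLittleO_one_iff]
    simpa using ((tendsto_sub s t).abs.const_mul C)
  have h2 : (fun τ => |τ - t|) =O[𝓝[s] t] (fun τ => τ - t) :=
    (isBigO_refl (fun τ => τ - t) _).norm_left
  simpa using h1.mul_isBigO h2

lemma sub_le [Fact (1 ≤ p)] (h : DL p s t f f') : ∃ C, 0 ≤ C ∧
    ∀ᶠ τ in 𝓝[s] t, LB p (fun x => f τ x - f t x) (C * |τ - t|) := by
  obtain ⟨e, he, hd⟩ := h.diff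
  obtain ⟨C, hC⟩ := h.bdd'
  refine ⟨1 + C, by linarith [hC.nonneg], ?_⟩
  filter_upwards [hd, he.bound one_pos] with τ h1 h2
  refine ((h1.add (hC.const_mul (τ - t))).mono ?_).congr (ae_of_all _ fun x => by ring)
  rw [Real.norm_eq_abs, abs_of_nonneg h1.nonneg, Real.norm_eq_abs] at h2
  linarith

lemma eventually_bdd [Fact (1 ≤ p)] (h : DL p s t f f') :
    ∃ C, 0 ≤ C ∧ ∀ᶠ τ in 𝓝[s] t, LB p (f τ) C := by
  obtain ⟨C, hC, hd⟩ := h.sub_le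
  obtain ⟨C', hC'⟩ := h.bdd
  refine ⟨C + C', by linarith [hC'.nonneg], ?_⟩
  have : ∀ᶠ τ in 𝓝[s] t, |τ - t| ≤ 1 :=
    ((tendsto_sub s t).abs.eventually_le_const (by simp))
  filter_upwards [hd, this] with τ h1 h2
  refine ((h1.add hC').mono ?_).congr (ae_of_all _ fun x => by ring)
  have := mul_le_mul_of_nonneg_left h2 hC
  linarith

lemma const {k : ℝ → ℝ} {C : ℝ} (hk : LB p k C) : DL p s t (fun _ => k) (fun _ => 0) := by
  have h0 : LB p (fun _ => (0 : ℝ)) 0 := ⟨aestronglyMeasurable_const, le_rfl, by simp⟩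
  exact ⟨⟨C, hk⟩, ⟨0, h0⟩, fun _ => 0, isLittleO_zero _ _,
    Eventually.of_forall fun τ => h0.congr (ae_of_all _ fun x => by simp)⟩

lemma add [Fact (1 ≤ p)] (hf : DL p s t f f') (hg : DL p s t g g') :
    DL p s t (fun τ x => f τ x + g τ x) (fun x => f' x + g' x) := by
  obtain ⟨⟨A, hA⟩, ⟨A', hA'⟩, e, he, hd⟩ := hf
  obtain ⟨⟨B, hB⟩, ⟨B', hB'⟩, e₁, he₁, hd₁⟩ := hg
  refine ⟨⟨_, hA.add hB⟩, ⟨_, hA'.add hB'⟩, _, he.add he₁, ?_⟩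
  filter_upwards [hd, hd₁] with τ h1 h2
  exact (h1.add h2).congr (ae_of_all _ fun x => by ring)

lemma const_mul (hf : DL p s t f f') (a : ℝ) :
    DL p s t (fun τ x => a * f τ x) (fun x => a * f' x) := by
  obtain ⟨⟨A, hA⟩, ⟨A', hA'⟩, e, he, hd⟩ := hf
  refine ⟨⟨_, hA.const_mul a⟩, ⟨_, hA'.const_mul a⟩, _, he.const_mul_left |a|, ?_⟩
  filter_upwards [hd] with τ h1
  exact (h1.const_mul a).congr (ae_of_all _ fun x => by ring)

/-- The remainder of the product splits as (remainder of `f`)·`g_τ` + `f_t`·(remainder of `g`) + `(τ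
- t) f' (g_τ - g_t)`, the last term being of second order. -/
lemma mul [Fact (1 ≤ p)] (hf : DL ⊤ s t f f') (hg : DL p s t g g') :
    DL p s t (fun τ x => f τ x * g τ x) (fun x => f' x * g t x + f t x * g' x) := by
  obtain ⟨C, hC, hCe⟩ := hg.eventually_bdd
  obtain ⟨K, hK, hKe⟩ := hg.sub_le
  obtain ⟨⟨A, hA⟩, ⟨A', hA'⟩, e, he, hd⟩ := hf
  obtain ⟨⟨B, hB⟩, ⟨B', hB'⟩, e₁, he₁, hd₁⟩ := hg
  refine ⟨⟨_, hA.mul hB⟩, ⟨_, (hA'.mul hB).add (hA.mul hB')⟩, _,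
    ((he.mul_isBigO (isBigO_const_const C one_ne_zero _)).congr_right
      (fun τ => mul_one _)).add ((he₁.const_mul_left A).add (isLittleO_sq s t (A' * K))), ?_⟩
  filter_upwards [hd, hd₁, hCe, hKe] with τ h1 h2 h3 h4
  refine (((h1.mul h3).add ((hA.mul h2).add ((hA'.mul h4).const_mul (τ - t)))).mono
    (le_of_eq ?_)).congr (ae_of_all _ fun x => by ring)
  ring

/-- The Taylor remainder is quadratic in `f_τ - f_t`; one factor is measured in `L^∞` and the other
in `L^p`. This is why differentiability in both norms is assumed, and it is available because `v`
lives in `L² ∩ L^∞`. -/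
lemma comp [Fact (1 ≤ p)] {φ φ' : ℝ → ℝ} {K M A : ℝ}
    (hrem : ∀ x y, |φ y - φ x - (y - x) * φ' x| ≤ K * (y - x) ^ 2) (hφ : Continuous φ)
    (hφ' : Continuous φ') (hM : ∀ x, |φ' x| ≤ M) (hf : DL ⊤ s t f f') (hfp : DL p s t f f')
    (h0 : LB p (fun x => φ (f t x)) A) :
    DL p s t (fun τ x => φ (f τ x)) (fun x => φ' (f t x) * f' x) := by
  have hK : 0 ≤ K := by have := (abs_nonneg _).trans (hrem 0 1); simpa using this
  have hM0 : 0 ≤ M := (abs_nonneg _).trans (hM 0)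
  obtain ⟨C, hC, hCe⟩ := hf.sub_le
  obtain ⟨C', hC', hCe'⟩ := hfp.sub_le
  obtain ⟨_, -, hme⟩ := hfp.eventually_bdd
  obtain ⟨⟨B, hB⟩, ⟨B', hB'⟩, e₁, he₁, hd₁⟩ := hfp
  have hφl : LB ⊤ (fun x => φ' (f t x)) M :=
    LB.of_bound (hφ'.comp_aestronglyMeasurable hB.meas) hM0 (ae_of_all _ fun x => hM _)
  refine ⟨⟨A, h0⟩, ⟨_, hφl.mul hB'⟩, _, (he₁.const_mul_left M).add (isLittleO_sq s t (K * (C * C'))),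
    ?_⟩
  filter_upwards [hd₁, hCe, hCe', hme] with τ h1 h2 h3 h4
  have hm : AEStronglyMeasurable (fun x => φ (f τ x) - φ (f t x) - (f τ x - f t x) * φ' (f t x))
      volume := ((hφ.comp_aestronglyMeasurable h4.meas).sub h0.meas).sub (h3.meas.mul hφl.meas)
  have h5 := (h2.mul h3).of_le_mul hm hK (ae_of_all _ fun x => by
    refine (hrem (f t x) (f τ x)).trans (le_of_eq ?_)
    rw [← sq, abs_of_nonneg (sq_nonneg _)])
  refine (((hφl.mul h1).add h5).mono (le_of_eq (by ring))).congr (ae_of_all _ fun x => by ring)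

/-- The same splitting as for products, with Cauchy-Schwarz in place of the `L^∞`-`L^p` estimate.
Conserved quantities are written as such pairings. -/
lemma hasDerivWithinAt_integral (hf : DL 2 s t f f') (hg : DL 2 s t g g') :
    HasDerivWithinAt (fun τ => ∫ x, f τ x * g τ x) (∫ x, (f' x * g t x + f t x * g' x)) s t := by
  obtain ⟨F, hF, hFe⟩ := hf.eventually_bdd
  obtain ⟨C, hC, hCe⟩ := hg.eventually_bdd
  obtain ⟨K, hK, hKe⟩ := hg.sub_le
  obtain ⟨⟨A, hA⟩, ⟨A', hA'⟩, e, he, hd⟩ := hf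
  obtain ⟨⟨B, hB⟩, ⟨B', hB'⟩, e₁, he₁, hd₁⟩ := hg
  rw [hasDerivWithinAt_iff_isLittleO]
  have ho := ((he.mul_isBigO (isBigO_const_const C one_ne_zero _)).congr_right
      (fun τ => mul_one _)).add ((he₁.const_mul_left A).add (isLittleO_sq s t (A' * K)))
  refine IsBigO.trans_isLittleO (IsBigO.of_bound 1 ?_) ho
  filter_upwards [hd, hd₁, hCe, hKe, hFe] with τ h1 h2 h3 h4 h5
  have i1 := h1.integrable_mul h3
  have i2 := hA.integrable_mul h2
  have i3 := (hA'.integrable_mul h4).const_mul (τ - t)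
  have key : (∫ x, f τ x * g τ x) - (∫ x, f t x * g t x)
      - (τ - t) • ∫ x, (f' x * g t x + f t x * g' x)
      = (∫ x, (f τ x - f t x - (τ - t) * f' x) * g τ x)
        + ((∫ x, f t x * (g τ x - g t x - (τ - t) * g' x))
          + (τ - t) * ∫ x, f' x * (g τ x - g t x)) := by
    have i23 : Integrable fun x => f t x * (g τ x - g t x - (τ - t) * g' x)
        + (τ - t) * (f' x * (g τ x - g t x)) := i2.add i3
    have i4 : Integrable fun x => f τ x * g τ x - f t x * g t x :=
      (h5.integrable_mul h3).sub (hA.integrable_mul hB)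
    have i5 : Integrable fun x => f' x * g t x + f t x * g' x :=
      (hA'.integrable_mul hB).add (hA.integrable_mul hB')
    rw [← integral_const_mul, ← integral_add i2 i3, ← integral_add i1 i23, smul_eq_mul,
      ← integral_const_mul, ← integral_sub (h5.integrable_mul h3) (hA.integrable_mul hB),
      ← integral_sub i4 (i5.const_mul _)]
    congr 1; ext x; ring
  rw [key, one_mul, Real.norm_eq_abs, Real.norm_eq_abs]
  refine le_trans ?_ (le_abs_self _)
  refine (abs_add_le _ _).trans (add_le_add (h1.abs_integral_mul_le h3) ?_)
  refine (abs_add_le _ _).trans (add_le_add (hA.abs_integral_mul_le h2) ?_)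
  rw [abs_mul]
  calc |τ - t| * |∫ x, f' x * (g τ x - g t x)| ≤ |τ - t| * (A' * (K * |τ - t|)) := by
        gcongr; exact hA'.abs_integral_mul_le h4
    _ = _ := by ring

section FromX

variable {w : ℝ → X} {w' : X} (h : HasDerivWithinAt w w' s t)
include h

lemma exists_remainder : ∃ e : ℝ → ℝ, e =o[𝓝[s] t] (fun τ => τ - t) ∧
    ∀ τ, ‖w τ - w t - (τ - t) • w'‖ ≤ e τ :=
  ⟨_, (hasDerivWithinAt_iff_isLittleO.1 h).norm_left, fun _ => le_rfl⟩

lemma u (hp : p = 2 ∨ p = ⊤) : DL p s t (fun τ => X.u (w τ)) (X.u w') := by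
  have hl : ∀ z : X, LB p (X.u z) ‖z‖ := by
    rcases hp with rfl | rfl
    exacts [X.lb_u, X.lb_u_top]
  obtain ⟨e, he, h1⟩ := exists_remainder h
  refine ⟨⟨_, hl _⟩, ⟨_, hl _⟩, e, he, Eventually.of_forall fun τ => ?_⟩
  refine ((hl _).mono (h1 τ)).congr ?_
  filter_upwards [X.u_sub (w τ - w t) ((τ - t) • w'), X.u_sub (w τ) (w t),
    X.u_smul (τ - t) w'] with x a b c
  rw [a, b, c]

lemma ux : DL 2 s t (fun τ => X.ux (w τ)) (X.ux w') := by
  obtain ⟨e, he, h1⟩ := exists_remainder h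
  refine ⟨⟨_, X.lb_ux _⟩, ⟨_, X.lb_ux _⟩, e, he, Eventually.of_forall fun τ => ?_⟩
  refine ((X.lb_ux _).mono (h1 τ)).congr ?_
  filter_upwards [X.ux_sub (w τ - w t) ((τ - t) • w'), X.ux_sub (w τ) (w t),
    X.ux_smul (τ - t) w'] with x a b c
  rw [a, b, c]

lemma v (hp : p = 2 ∨ p = ⊤) : DL p s t (fun τ => X.v (w τ)) (X.v w') := by
  have hl : ∀ z : X, LB p (X.v z) ‖z‖ := by
    rcases hp with rfl | rfl
    exacts [X.lb_v, X.lb_v_top]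
  obtain ⟨e, he, h1⟩ := exists_remainder h
  refine ⟨⟨_, hl _⟩, ⟨_, hl _⟩, e, he, Eventually.of_forall fun τ => ?_⟩
  refine ((hl _).mono (h1 τ)).congr ?_
  filter_upwards [X.v_sub (w τ - w t) ((τ - t) • w'), X.v_sub (w τ) (w t),
    X.v_smul (τ - t) w'] with x a b c
  rw [a, b, c]

lemma q : DL ⊤ s t (fun τ => X.q (w τ)) (X.q w') := by
  obtain ⟨e, he, h1⟩ := exists_remainder h
  refine ⟨⟨_, X.lb_q _⟩, ⟨_, X.lb_q _⟩, e, he, Eventually.of_forall fun τ => ?_⟩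
  refine ((X.lb_q _).mono (h1 τ)).congr ?_
  filter_upwards [X.q_sub (w τ - w t) ((τ - t) • w'), X.q_sub (w τ) (w t),
    X.q_smul (τ - t) w'] with x a b c
  rw [a, b, c]

end FromX

end DL

/-- Second-order Taylor bound for functions with bounded second derivative. -/
lemma taylor_bound {φ φ' φ'' : ℝ → ℝ} {K : ℝ} (h1 : ∀ x, HasDerivAt φ (φ' x) x)
    (h2 : ∀ x, HasDerivAt φ' (φ'' x) x) (hK : ∀ x, |φ'' x| ≤ K) (x y : ℝ) :
    |φ y - φ x - (y - x) * φ' x| ≤ K * (y - x) ^ 2 := by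
  have hK0 : 0 ≤ K := (abs_nonneg _).trans (hK 0)
  have hL : ∀ a b, |φ' b - φ' a| ≤ K * |b - a| := fun a b =>
    convex_univ.norm_image_sub_le_of_norm_hasDerivWithin_le (f := φ') (f' := φ'') (x := a) (y := b)
      (fun z _ => (h2 z).hasDerivWithinAt) (fun z _ => hK z) (mem_univ _) (mem_univ _)
  have hd : ∀ z ∈ uIcc x y, HasDerivWithinAt (fun z => φ z - (z - x) * φ' x) (φ' z - φ' x)
      (uIcc x y) z := fun z _ => by
    have := ((h1 z).fun_sub (((hasDerivAt_id z).sub_const x).mul_const (φ' x))).hasDerivWithinAt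
      (s := uIcc x y)
    rwa [one_mul] at this
  have := (convex_uIcc x y).norm_image_sub_le_of_norm_hasDerivWithin_le (C := K * |y - x|) hd
    (fun z hz => (hL x z).trans (by
      have := abs_sub_left_of_mem_uIcc hz
      gcongr)) left_mem_uIcc right_mem_uIcc
  simp only [sub_self, zero_mul, sub_zero, Real.norm_eq_abs] at this
  calc |φ y - φ x - (y - x) * φ' x| = |φ y - (y - x) * φ' x - φ x| := by ring_nf
    _ ≤ K * |y - x| * |y - x| := this
    _ = K * (y - x) ^ 2 := by rw [mul_assoc, ← sq, sq_abs]

end DualPowerCH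

namespace DualPowerCH

open Filter Topology Metric
open scoped ENNReal NNReal

/-! ### The vector field -/

/-- The open set of points of the phase space at which `q` is bounded below. -/
def posSet : Set X := {w | ∃ δ > 0, ∀ᵐ x, δ ≤ X.q w x}

lemma region_of_norm_le {w : X} {δ R : ℝ} (hδ : 0 < δ) (hq : ∀ᵐ x, δ ≤ X.q w x) (hR : ‖w‖ ≤ R) :
    Region R δ R (R ^ 2) w :=
  ⟨hδ, w.lb_u_top.mono hR, w.lb_q.mono hR, hq, ((lb_sin_half w).mono hR).integral_sq_le⟩

open Classical in
/-- The vector field of the semilinear system. -/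
noncomputable def vf (c : Coeffs) (w : X) : X :=
  if h : ∃ w', FullRHS c w w' then h.choose else 0

lemma vf_spec {c : Coeffs} (hμ : 0 < c.μ) {w : X} (hw : w ∈ posSet) : FullRHS c w (vf c w) := by
  obtain ⟨δ, hδ, hq⟩ := hw
  have h := (region_of_norm_le hδ hq le_rfl).exists_fullRHS hμ
  rw [vf, dif_pos h]
  exact h.choose_spec

/-- Uniform local control of the vector field. -/
lemma vf_control {c : Coeffs} (hμ : 0 < c.μ) {δ : ℝ} (hδ : 0 < δ) (R : ℝ) :
    ∃ ε K L : ℝ≥0, 0 < ε ∧ ∀ w : X, ‖w‖ ≤ R → (∀ᵐ x, δ ≤ X.q w x) →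
      closedBall w ε ⊆ posSet ∧ LipschitzOnWith K (vf c) (closedBall w ε) ∧
        ∀ y ∈ closedBall w ε, ‖vf c y‖ ≤ L := by
  -- In the ball of radius `δ / 2` the `L^∞` component of the norm keeps `q ≥ δ / 2`, and every norm
  -- is at most `R + δ / 2`; the last parameter is its square since `sin²(v/2) ≤ v²`.
  obtain ⟨C, hC, hC1, hC2⟩ := exists_bound_fullRHS hμ (R + δ / 2) (δ / 2) (R + δ / 2)
    ((R + δ / 2) ^ 2)
  set ε : ℝ≥0 := ⟨δ / 2, by positivity⟩ with hεdef
  set L : ℝ≥0 := (C * (1 + (R + δ / 2))).toNNReal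
  have hε : (ε : ℝ) = δ / 2 := rfl
  refine ⟨ε, L, L, half_pos hδ, fun w hw hq => ?_⟩
  have hL : ∀ r, r ≤ R + δ / 2 → C * (1 + r) ≤ L := fun r hr =>
    le_trans (by gcongr) (Real.le_coe_toNNReal _)
  have hlow : ∀ y ∈ closedBall w ε, ∀ᵐ x, δ / 2 ≤ X.q y x := by
    intro y hy
    rw [mem_closedBall, dist_eq_norm, hε] at hy
    filter_upwards [hq, X.q_sub y w, (X.lb_q (y - w)).ae_le] with x h1 h2 h3
    rw [h2] at h3
    linarith [(abs_le.1 (h3.trans hy)).1]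
  have hn : ∀ y ∈ closedBall w ε, ‖y‖ ≤ R + δ / 2 := by
    intro y hy
    rw [mem_closedBall, dist_eq_norm, hε] at hy
    have := norm_le_norm_add_norm_sub' y w
    linarith
  have hreg : ∀ y ∈ closedBall w ε, Region (R + δ / 2) (δ / 2) (R + δ / 2) ((R + δ / 2) ^ 2) y :=
    fun y hy => region_of_norm_le (by positivity) (hlow y hy) (hn y hy)
  have hpos : closedBall w ε ⊆ posSet := fun y hy => ⟨δ / 2, by positivity, hlow y hy⟩
  refine ⟨hpos, LipschitzOnWith.of_dist_le_mul fun y hy z hz => ?_, fun y hy => ?_⟩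
  · rw [dist_eq_norm, dist_eq_norm]
    refine (hC2 y _ z _ (hreg y hy) (vf_spec hμ (hpos hy)) (hreg z hz)
      (vf_spec hμ (hpos hz))).trans ?_
    gcongr
    exact hL _ (hn z hz)
  · exact (hC1 y _ (hreg y hy) (vf_spec hμ (hpos hy))).trans (hL _ (hn y hy))

lemma vf_locallyLipschitz {c : Coeffs} (hμ : 0 < c.μ) : ∀ w ∈ posSet, ∃ ε > 0, ∃ K : ℝ≥0,
    closedBall w ε ⊆ posSet ∧ LipschitzOnWith K (vf c) (closedBall w ε) := by
  rintro w ⟨δ, hδ, hq⟩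
  obtain ⟨ε, K, L, hε, h⟩ := vf_control hμ hδ ‖w‖
  obtain ⟨h1, h2, -⟩ := h w le_rfl hq
  exact ⟨ε, hε, K, h1, h2⟩

/-! ### Time derivatives of the building blocks -/

lemma sin_half_rem (x y : ℝ) : |Real.sin (y / 2) - Real.sin (x / 2)
    - (y - x) * (1 / 2 * Real.cos (x / 2))| ≤ 1 / 4 * (y - x) ^ 2 := by
  refine taylor_bound (φ := fun z => Real.sin (z / 2)) (φ' := fun z => 1 / 2 * Real.cos (z / 2))
    (φ'' := fun z => -(1 / 4) * Real.sin (z / 2)) (fun z => ?_) (fun z => ?_) (fun z => ?_) x y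
  · exact ((Real.hasDerivAt_sin (z / 2)).comp z ((hasDerivAt_id z).div_const 2)).congr_deriv
      (g' := 1 / 2 * Real.cos (z / 2)) (by ring)
  · exact (((Real.hasDerivAt_cos (z / 2)).comp z ((hasDerivAt_id z).div_const 2)).const_mul
      (1 / 2 : ℝ)).congr_deriv (by ring)
  · rw [abs_mul, abs_neg, abs_of_pos (by norm_num : (0 : ℝ) < 1 / 4)]
    linarith [Real.abs_sin_le_one (z / 2)]

lemma cos_half_rem (x y : ℝ) : |Real.cos (y / 2) - Real.cos (x / 2)
    - (y - x) * (-(1 / 2) * Real.sin (x / 2))| ≤ 1 / 4 * (y - x) ^ 2 := by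
  refine taylor_bound (φ := fun z => Real.cos (z / 2)) (φ' := fun z => -(1 / 2) * Real.sin (z / 2))
    (φ'' := fun z => -(1 / 4) * Real.cos (z / 2)) (fun z => ?_) (fun z => ?_) (fun z => ?_) x y
  · exact ((Real.hasDerivAt_cos (z / 2)).comp z ((hasDerivAt_id z).div_const 2)).congr_deriv
      (g' := -(1 / 2) * Real.sin (z / 2)) (by ring)
  · exact (((Real.hasDerivAt_sin (z / 2)).comp z ((hasDerivAt_id z).div_const 2)).const_mul
      (-(1 / 2) : ℝ)).congr_deriv (by ring)
  · rw [abs_mul, abs_neg, abs_of_pos (by norm_num : (0 : ℝ) < 1 / 4)]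
    linarith [Real.abs_cos_le_one (z / 2)]

lemma abs_half_mul_le {a : ℝ} (ha : |a| ≤ 1) : |1 / 2 * a| ≤ 1 := by
  rw [abs_mul, abs_of_pos (by norm_num : (0 : ℝ) < 1 / 2)]; linarith

lemma lb_cos_half (w : X) : LB ⊤ (fun x => Real.cos (X.v w x / 2)) 1 :=
  LB.of_bound ((Real.continuous_cos.comp (continuous_id.div_const 2)).comp_aestronglyMeasurable
    w.lb_v.meas) zero_le_one (ae_of_all _ fun _ => Real.abs_cos_le_one _)

lemma lb_sin_half_top (w : X) : LB ⊤ (fun x => Real.sin (X.v w x / 2)) 1 :=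
  LB.of_bound ((Real.continuous_sin.comp (continuous_id.div_const 2)).comp_aestronglyMeasurable
    w.lb_v.meas) zero_le_one (ae_of_all _ fun _ => Real.abs_sin_le_one _)

section Curve

variable {s : Set ℝ} {t : ℝ} {w : ℝ → X} {w' : X} (h : HasDerivWithinAt w w' s t)
include h

lemma DL.sin_half {p : ℝ≥0∞} (hp : p = 2 ∨ p = ⊤) :
    DL p s t (fun τ x => Real.sin (X.v (w τ) x / 2))
      (fun x => 1 / 2 * Real.cos (X.v (w t) x / 2) * X.v w' x) := by
  have hb : LB p (fun x => Real.sin (X.v (w t) x / 2)) (‖w t‖ + 1) := by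
    rcases hp with rfl | rfl
    · exact (lb_sin_half _).mono (by linarith)
    · exact (lb_sin_half_top _).mono (by linarith [norm_nonneg (w t)])
  have : Fact (1 ≤ p) := ⟨by rcases hp with rfl | rfl <;> simp⟩
  exact DL.comp (φ := fun z => Real.sin (z / 2)) (φ' := fun z => 1 / 2 * Real.cos (z / 2)) (M := 1)
    sin_half_rem (by fun_prop) (by fun_prop) (fun x => abs_half_mul_le (Real.abs_cos_le_one _))
    (DL.v h (Or.inr rfl)) (DL.v h hp) hb

lemma DL.cos_half : DL ⊤ s t (fun τ x => Real.cos (X.v (w τ) x / 2))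
      (fun x => -(1 / 2) * Real.sin (X.v (w t) x / 2) * X.v w' x) :=
  DL.comp (φ := fun z => Real.cos (z / 2)) (φ' := fun z => -(1 / 2) * Real.sin (z / 2)) (M := 1)
    cos_half_rem (by fun_prop) (by fun_prop) (fun x => by
      rw [neg_mul, abs_neg]; exact abs_half_mul_le (Real.abs_sin_le_one _))
    (DL.v h (Or.inr rfl)) (DL.v h (Or.inr rfl)) (lb_cos_half _)

end Curve

/-! ### Conservation laws -/

/-- The conserved energy `∫ (u² cos²(v/2) + μ sin²(v/2)) q`. -/
noncomputable def energy (c : Coeffs) (w : X) : ℝ :=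
  (∫ x, X.u w x * (Real.cos (X.v w x / 2) * Real.cos (X.v w x / 2) * X.q w x * X.u w x)) +
    c.μ * ∫ x, Real.sin (X.v w x / 2) * (X.q w x * Real.sin (X.v w x / 2))

/-- The relation `u_ξ = q sin(v) / 2`. -/
def Compat (w : X) : Prop :=
  ∀ᵐ x, X.ux w x = X.q w x * (Real.sin (X.v w x / 2) * Real.cos (X.v w x / 2))

lemma cos_eq_half (x : ℝ) : Real.cos x = 2 * Real.cos (x / 2) ^ 2 - 1 := by
  rw [← Real.cos_two_mul]; ring_nf

lemma sin_eq_half (x : ℝ) : Real.sin x = 2 * Real.sin (x / 2) * Real.cos (x / 2) := by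
  rw [← Real.sin_two_mul]; ring_nf

/-- The defect in `u_ξ = q sin(v) / 2` does not depend on time. -/
lemma hasDeriv_defect {c : Coeffs} (hμ : 0 < c.μ) {s : Set ℝ} {t : ℝ} {w : ℝ → X} {w' : X}
    (h : HasDerivWithinAt w w' s t) (hw : FullRHS c (w t) w') :
    HasDerivWithinAt (fun τ => ∫ x,
      (X.ux (w τ) x + -1 * (X.q (w τ) x * (Real.cos (X.v (w τ) x / 2) * Real.sin (X.v (w τ) x / 2)))) *
      (X.ux (w τ) x + -1 * (X.q (w τ) x * (Real.cos (X.v (w τ) x / 2) * Real.sin (X.v (w τ) x / 2)))))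
      0 s t := by
  have hD := (DL.ux h).add
    (((DL.q h).mul ((DL.cos_half h).mul (DL.sin_half h (Or.inl rfl)))).const_mul (-1))
  have key := hD.hasDerivWithinAt_integral hD
  refine key.congr_deriv (integral_eq_zero_of_ae ?_)
  filter_upwards [hw.ux_eq, hw.v_eq, hw.q_eq] with x h1 h2 h3
  rw [h1, h2, h3, negPxDeriv, src, dens, cos_eq_half (X.v (w t) x), sin_eq_half (X.v (w t) x)]
  have h4 := Real.sin_sq_add_cos_sq (X.v (w t) x / 2)
  set S := Real.sin (X.v (w t) x / 2)
  set C := Real.cos (X.v (w t) x / 2)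
  set q := X.q (w t) x
  set g := G c (X.u (w t) x)
  set p := P c (w t) x
  -- The time derivative of the defect itself vanishes pointwise, by half-angle formulas and `S² +
  -- C² = 1`; the relation `Compat` is not needed for this.
  have e : 1 / c.μ * ((g * C ^ 2 + c.s / 2 * S ^ 2) * q - C ^ 2 * q * p) + -1 *
      (1 / c.μ * (c.s / 2 + g - p) * (2 * S * C) * q * (C * S) + q *
      (-(1 / 2) * S * (1 / c.μ * (1 + (2 * C ^ 2 - 1)) * (g - p) - c.s / c.μ * S ^ 2) * S +
        C * (1 / 2 * C * (1 / c.μ * (1 + (2 * C ^ 2 - 1)) * (g - p) - c.s / c.μ * S ^ 2)))) = 0 := by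
    field_simp
    linear_combination (-2*C^2*(g-p)*q - c.s*q*S^2) * h4
  simp only [Pi.zero_apply]
  rw [e]; ring

/-- The integrand is the derivative of `φ(F)` with `φ = ∫₀ ψ`. As `ψ 0 = 0` and `ψ` is Lipschitz on
the bounded range of `F`, `|φ(F)| ≤ K F²` is integrable, so no boundary terms survive. -/
lemma integral_comp_mul_deriv_eq_zero {F g : ℝ → ℝ} (hp : IsPrim F g) {A B : ℝ} (hF : LB 2 F A)
    (hg : LB 2 g B) {ψ : ℝ → ℝ} (hψ : Continuous ψ) (h0 : ψ 0 = 0)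
    (hL : ∀ M : ℝ, ∃ K, 0 ≤ K ∧ ∀ x y, |x| ≤ M → |y| ≤ M → |ψ x - ψ y| ≤ K * |x - y|) :
    Integrable (fun x => ψ (F x) * g x) ∧ ∫ x, ψ (F x) * g x = 0 := by
  obtain ⟨K, hK, hL⟩ := hL (Real.sqrt (A * B))
  have hM : ∀ x, |F x| ≤ Real.sqrt (A * B) := fun x => Real.abs_le_sqrt (hp.lb_top hF hg x)
  have h1 : ∀ y, |y| ≤ Real.sqrt (A * B) → |ψ y| ≤ K * |y| := fun y hy => by
    simpa [h0] using hL y 0 hy (by simp)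
  have hψF : LB 2 (fun x => ψ (F x)) (K * A) :=
    hF.of_le_mul (hψ.comp_aestronglyMeasurable hF.meas) hK (ae_of_all _ fun x => h1 _ (hM x))
  set φ : ℝ → ℝ := fun y => ∫ z in (0 : ℝ)..y, ψ z
  have hφ : ∀ y, HasDerivAt φ (ψ y) y := fun y =>
    intervalIntegral.integral_hasDerivAt_right (hψ.intervalIntegrable _ _)
      (hψ.stronglyMeasurableAtFilter _ _) hψ.continuousAt
  have hφc : Continuous φ := continuous_iff_continuousAt.2 fun y => (hφ y).continuousAt
  have hi := hψF.integrable_mul hg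
  refine ⟨hi, (hp.comp hφ hψ).integral_eq_zero ?_ hi⟩
  refine (hF.integrable_sq.const_mul K).mono' (hφc.comp_aestronglyMeasurable hF.meas)
    (ae_of_all _ fun x => ?_)
  have : ‖∫ z in (0 : ℝ)..F x, ψ z‖ ≤ K * |F x| * |F x - 0| := by
    refine intervalIntegral.norm_integral_le_of_norm_le_const fun z hz => ?_
    have hz' : |z| ≤ |F x| := by
      simpa using abs_sub_left_of_mem_uIcc (uIoc_subset_uIcc hz)
    exact (h1 z (hz'.trans (hM x))).trans (by gcongr)
  refine this.trans (le_of_eq ?_)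
  rw [sub_zero, mul_assoc, ← sq, sq_abs]

/-- Using `u_ξ = q sin(v/2) cos(v/2)` and `P_ξ = dens · P_x`, the time derivative of the energy
density becomes `-2 (u P)_ξ + ((s/μ) u² + 2 G(u)) u_ξ`. Both terms are exact `ξ`-derivatives of
integrable functions. -/
lemma hasDeriv_energy {c : Coeffs} (hμ : 0 < c.μ) {s : Set ℝ} {t : ℝ} {w : ℝ → X} {w' : X}
    (h : HasDerivWithinAt w w' s t) (hw : FullRHS c (w t) w') (hpos : w t ∈ posSet)
    (hc : Compat (w t)) : HasDerivWithinAt (fun τ => energy c (w τ)) 0 s t := by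
  have hu := DL.u h (p := 2) (Or.inl rfl)
  have hA := hu.hasDerivWithinAt_integral ((((DL.cos_half h).mul (DL.cos_half h)).mul (DL.q h)).mul hu)
  have hsin := DL.sin_half h (p := 2) (Or.inl rfl)
  have hB := hsin.hasDerivWithinAt_integral ((DL.q h).mul hsin)
  refine (hA.add (hB.const_mul c.μ)).congr_deriv ?_
  obtain ⟨δ, hδ, hq⟩ := hpos
  have hreg := region_of_norm_le hδ hq le_rfl
  obtain ⟨F, hF, hFp⟩ := H1.exists_isPrim (w t).1
  have hFp : IsPrim F (X.ux (w t)) := hFp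
  have hF : F =ᵐ[volume] X.u (w t) := hF
  have hF2 : LB 2 F ‖w t‖ := (X.lb_u _).congr hF.symm
  obtain ⟨_, -, hP2, -⟩ := lip_P_two (M := ‖w t‖) (δ := δ) (Q := ‖w t‖) (N := ‖w t‖ ^ 2) hμ
  obtain ⟨_, -, hPx2, -⟩ := lip_Px_two (M := ‖w t‖) (δ := δ) (Q := ‖w t‖) (N := ‖w t‖ ^ 2) hμ
  have hP := hP2 _ hreg
  have hPx := hPx2 _ hreg
  -- Only the `L^∞` bound of the density is extracted, so the choice `ν = 1` is immaterial.
  have hd := (hreg.kerAdm one_pos).lb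
  have hdPx : LB 2 (fun x => dens (w t) x * Px c (w t) x) _ :=
    (hd.mul hPx.neg).congr (ae_of_all _ fun x => by ring)
  have hPp := hFp.mul (hreg.isPrim_P hμ)
  have j1 : Integrable fun x => X.ux (w t) x * P c (w t) x + F x * (dens (w t) x * Px c (w t) x) :=
    ((X.lb_ux _).integrable_mul hP).add (hF2.integrable_mul hdPx)
  have z1 := hPp.integral_eq_zero (hF2.integrable_mul hP) j1
  obtain ⟨j2, z2⟩ := integral_comp_mul_deriv_eq_zero hFp hF2 (X.lb_ux _)
    (ψ := fun y => c.s / c.μ * y ^ 2 + 2 * G c y) (by have := continuous_G c; fun_prop)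
    (by simp [G_zero]) (fun M => by
      have hcd : ContDiff ℝ 1 (fun y => c.s / c.μ * y ^ 2 + 2 * G c y) := by unfold G; fun_prop
      obtain ⟨K, hK⟩ := hcd.contDiffOn.exists_lipschitzOnWith (by decide) (convex_Icc (-M) M)
        isCompact_Icc
      exact ⟨K, K.2, fun x y hx hy => hK.dist_le_mul x (abs_le.1 hx) y (abs_le.1 hy)⟩)
  obtain ⟨⟨_, a1⟩, ⟨_, a2⟩, -⟩ := hu
  obtain ⟨⟨_, a3⟩, ⟨_, a4⟩, -⟩ := (((DL.cos_half h).mul (DL.cos_half h)).mul (DL.q h)).mul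
    (DL.u h (p := 2) (Or.inl rfl))
  obtain ⟨⟨_, b1⟩, ⟨_, b2⟩, -⟩ := hsin
  obtain ⟨⟨_, b3⟩, ⟨_, b4⟩, -⟩ := (DL.q h).mul (DL.sin_half h (p := 2) (Or.inl rfl))
  have k1 := (a2.integrable_mul a3).add (a1.integrable_mul a4)
  have k2 := (b2.integrable_mul b3).add (b1.integrable_mul b4)
  have z0 : (0 : ℝ) = ∫ x, (-2 * (X.ux (w t) x * P c (w t) x + F x * (dens (w t) x * Px c (w t) x)) +
      (c.s / c.μ * F x ^ 2 + 2 * G c (F x)) * X.ux (w t) x) := by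
    rw [integral_add (j1.const_mul _) j2, integral_const_mul, z1, z2]; ring
  rw [z0, ← integral_const_mul]
  refine Eq.trans (integral_add k1 (k2.const_mul c.μ)).symm (integral_congr_ae ?_)
  filter_upwards [hw.u_eq, hw.v_eq, hw.q_eq, hc, hF] with x h1 h2 h3 h5 h6
  simp only [Pi.add_apply]
  rw [h1, h2, h3, h5, h6, dens, cos_eq_half (X.v (w t) x), sin_eq_half (X.v (w t) x)]
  have h4 := Real.sin_sq_add_cos_sq (X.v (w t) x / 2)
  set S := Real.sin (X.v (w t) x / 2)
  set C := Real.cos (X.v (w t) x / 2)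
  set q := X.q (w t) x
  set u := X.u (w t) x
  set g := G c u
  set p := P c (w t) x
  set r := Px c (w t) x
  have hμ' := hμ.ne'
  field_simp
  linear_combination 2 * (c.s * u ^ 2 * q * S * C + 2 * c.μ * (g - p) * q * S * C) * h4

end DualPowerCH

/-! ### Completeness of the phase space and Gronwall-type lemmas -/

namespace DualPowerCH

open Filter Topology Metric
open scoped ENNReal NNReal

/-- Pairing with a fixed test function is continuous on `L²`, so each defining identity cuts out a
closed set. -/
lemma isClosed_H1 : IsClosed (H1 : Set (Lp ℝ 2 (volume : Measure ℝ) × Lp ℝ 2 (volume : Measure ℝ))) := by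
  have hcont : ∀ {ψ : ℝ → ℝ}, Continuous ψ → HasCompactSupport ψ →
      Continuous fun f : Lp ℝ 2 (volume : Measure ℝ) => ∫ x, f x * ψ x := by
    intro ψ hc hs
    have hψ := hc.memLp_of_hasCompactSupport (p := 2) (μ := volume) hs
    refine (continuous_id.inner (𝕜 := ℝ) (continuous_const (y := hψ.toLp ψ))).congr fun f => ?_
    rw [L2.inner_def]
    refine integral_congr_ae ?_
    filter_upwards [hψ.coeFn_toLp] with x hx
    simp [hx, mul_comm]
  have : (H1 : Set (Lp ℝ 2 (volume : Measure ℝ) × Lp ℝ 2 (volume : Measure ℝ)))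
      = ⋂ (φ : ℝ → ℝ) (_ : ContDiff ℝ (⊤ : ℕ∞) φ) (_ : HasCompactSupport φ),
        {p | ∫ x, p.1 x * deriv φ x = -∫ x, p.2 x * φ x} := by
    ext p
    simp only [mem_iInter]
    rfl
  rw [this]
  refine isClosed_iInter fun φ => isClosed_iInter fun hφ => isClosed_iInter fun hs => ?_
  exact isClosed_eq ((hcont (hφ.continuous_deriv (by simp)) hs.deriv).comp continuous_fst)
    ((hcont hφ.continuous hs).comp continuous_snd).neg

/-- Convergence in `L²` and in `L^∞` both imply convergence in measure, whose limit is unique almost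
everywhere. -/
lemma isClosed_L2Linf :
    IsClosed (L2Linf : Set (Lp ℝ 2 (volume : Measure ℝ) × Lp ℝ ⊤ (volume : Measure ℝ))) := by
  refine IsSeqClosed.isClosed fun p x hp hx => ?_
  have h1 := tendstoInMeasure_of_tendsto_Lp ((continuous_fst.tendsto x).comp hx)
  have h2 := tendstoInMeasure_of_tendsto_Lp ((continuous_snd.tendsto x).comp hx)
  exact tendstoInMeasure_ae_unique h1 (h2.congr_left fun n => EventuallyEq.symm
    (show ((p n).1 : ℝ → ℝ) =ᵐ[volume] (p n).2 from hp n))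

instance : CompleteSpace H1 := isClosed_H1.completeSpace_coe

instance : CompleteSpace L2Linf := isClosed_L2Linf.completeSpace_coe

lemma eq_of_hasDerivWithinAt_zero {f : ℝ → ℝ} {T : ℝ}
    (h : ∀ t ∈ Icc 0 T, HasDerivWithinAt f 0 (Icc 0 T) t) {t : ℝ} (ht : t ∈ Icc 0 T) :
    f t = f 0 := by
  have := (convex_Icc 0 T).norm_image_sub_le_of_norm_hasDerivWithin_le (C := 0) h
    (fun x _ => by simp) (left_mem_Icc.2 (ht.1.trans ht.2)) ht
  rw [zero_mul] at this
  exact sub_eq_zero.1 (norm_le_zero_iff.1 this)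

/-- A two-sided Gronwall inequality. -/
lemma exp_bounds_of_abs_deriv_le {f f' : ℝ → ℝ} {T Λ : ℝ}
    (h : ∀ t ∈ Icc 0 T, HasDerivWithinAt f (f' t) (Icc 0 T) t)
    (hb : ∀ t ∈ Icc 0 T, |f' t| ≤ Λ * f t) {t : ℝ} (ht : t ∈ Icc 0 T) :
    Real.exp (-(Λ * t)) * f 0 ≤ f t ∧ f t ≤ Real.exp (Λ * t) * f 0 := by
  have hc : ContinuousOn f (Icc 0 T) := fun t ht => (h t ht).continuousWithinAt
  have h0 : (0 : ℝ) ∈ Icc 0 T := left_mem_Icc.2 (ht.1.trans ht.2)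
  have hexp : ∀ a t : ℝ, HasDerivAt (fun t => Real.exp (a * t)) (Real.exp (a * t) * a) t := by
    intro a t
    exact ((Real.hasDerivAt_exp (a * t)).comp t ((hasDerivAt_id t).const_mul a)).congr_deriv
      (by rw [mul_one])
  have hd : ∀ a : ℝ, ∀ t ∈ interior (Icc 0 T), HasDerivWithinAt (fun t => Real.exp (a * t) * f t)
      (Real.exp (a * t) * a * f t + Real.exp (a * t) * f' t) (interior (Icc 0 T)) t :=
    fun a t ht => (hexp a t).hasDerivWithinAt.mul ((h t (interior_subset ht)).mono interior_subset)
  have hcc : ∀ a : ℝ, ContinuousOn (fun t => Real.exp (a * t) * f t) (Icc 0 T) := fun a =>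
    ContinuousOn.mul (by fun_prop) hc
  have m1 : MonotoneOn (fun t => Real.exp (Λ * t) * f t) (Icc 0 T) :=
    monotoneOn_of_hasDerivWithinAt_nonneg (convex_Icc 0 T) (hcc Λ) (hd Λ) fun x hx => by
      have := (abs_le.1 (hb x (interior_subset hx))).1
      rw [mul_assoc, ← mul_add]
      exact mul_nonneg (Real.exp_pos _).le (by linarith)
  have m2 : AntitoneOn (fun t => Real.exp (-Λ * t) * f t) (Icc 0 T) :=
    antitoneOn_of_hasDerivWithinAt_nonpos (convex_Icc 0 T) (hcc (-Λ)) (hd (-Λ)) fun x hx => by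
      have := (abs_le.1 (hb x (interior_subset hx))).2
      rw [mul_assoc, ← mul_add]
      exact mul_nonpos_of_nonneg_of_nonpos (Real.exp_pos _).le (by linarith)
  have k1 := m1 h0 ht ht.1
  have k2 := m2 h0 ht ht.1
  simp only [mul_zero, Real.exp_zero, one_mul, neg_mul] at k1 k2
  have e : Real.exp (-(Λ * t)) * Real.exp (Λ * t) = 1 := by rw [← Real.exp_add]; simp
  constructor
  · calc Real.exp (-(Λ * t)) * f 0 ≤ Real.exp (-(Λ * t)) * (Real.exp (Λ * t) * f t) := by gcongr
      _ = f t := by rw [← mul_assoc, e, one_mul]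
  · calc f t = Real.exp (Λ * t) * (Real.exp (-(Λ * t)) * f t) := by
          rw [← mul_assoc, mul_comm (Real.exp (Λ * t)), e, one_mul]
      _ ≤ Real.exp (Λ * t) * f 0 := by gcongr

/-! ### Bounds at a fixed time in terms of the energy -/

section Static

variable {w : X}

lemma lb_defect (w : X) : ∃ B, LB 2 (fun x =>
    X.ux w x + -1 * (X.q w x * (Real.cos (X.v w x / 2) * Real.sin (X.v w x / 2)))) B :=
  ⟨_, w.lb_ux.add ((w.lb_q.mul ((lb_cos_half w).mul (lb_sin_half w))).const_mul (-1))⟩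

/-- Turns an a.e. relation into the vanishing of one scalar, which can be propagated in time by
differentiation. -/
lemma compat_iff (w : X) : Compat w ↔ ∫ x,
      (X.ux w x + -1 * (X.q w x * (Real.cos (X.v w x / 2) * Real.sin (X.v w x / 2)))) *
      (X.ux w x + -1 * (X.q w x * (Real.cos (X.v w x / 2) * Real.sin (X.v w x / 2)))) = 0 := by
  obtain ⟨B, hB⟩ := lb_defect w
  rw [integral_eq_zero_iff_of_nonneg (fun x => mul_self_nonneg _) (hB.integrable_mul hB)]
  refine eventually_congr (Eventually.of_forall fun x => ?_)
  simp only [Pi.zero_apply, mul_self_eq_zero]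
  constructor
  · intro h; rw [h]; ring
  · intro h; linear_combination h

lemma integrable_energy_left (w : X) : Integrable fun x =>
    X.u w x * (Real.cos (X.v w x / 2) * Real.cos (X.v w x / 2) * X.q w x * X.u w x) :=
  w.lb_u.integrable_mul ((((lb_cos_half w).mul (lb_cos_half w)).mul w.lb_q).mul w.lb_u)

lemma integrable_energy_right (w : X) : Integrable fun x =>
    Real.sin (X.v w x / 2) * (X.q w x * Real.sin (X.v w x / 2)) :=
  (lb_sin_half w).integrable_mul (w.lb_q.mul (lb_sin_half w))

lemma posSet.q_nonneg (hw : w ∈ posSet) : ∀ᵐ x, 0 ≤ X.q w x := by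
  obtain ⟨δ, hδ, hq⟩ := hw
  filter_upwards [hq] with x hx using hδ.le.trans hx

variable {c : Coeffs} (hw : w ∈ posSet)
include hw

lemma mu_mul_integral_le_energy :
    c.μ * ∫ x, Real.sin (X.v w x / 2) * (X.q w x * Real.sin (X.v w x / 2)) ≤ energy c w := by
  refine le_add_of_nonneg_left (integral_nonneg_of_ae ?_)
  filter_upwards [posSet.q_nonneg hw] with x hx
  have : X.u w x * (Real.cos (X.v w x / 2) * Real.cos (X.v w x / 2) * X.q w x * X.u w x)
      = (X.u w x * Real.cos (X.v w x / 2)) ^ 2 * X.q w x := by ring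
  rw [this]
  exact mul_nonneg (sq_nonneg _) hx

variable (hμ : 0 < c.μ)
include hμ

/-- `2 u² ≤ ∫ |(u²)_ξ|`, and by compatibility `(u²)_ξ = 2 q (u cos(v/2)) sin(v/2)`. The inequality
`2√μ |ab| ≤ a² + μ b²` then recovers exactly the energy density. -/
lemma lb_u_of_energy (hc : Compat w) :
    LB ⊤ (X.u w) (Real.sqrt (energy c w / (2 * √c.μ))) := by
  obtain ⟨F, hF, hp⟩ := H1.exists_isPrim w.1
  have hp : IsPrim F (X.ux w) := hp
  have hF : F =ᵐ[volume] X.u w := hF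
  have hF2 : LB 2 F ‖w‖ := w.lb_u.congr hF.symm
  refine LB.congr ?_ hF
  refine LB.of_bound hF2.meas (Real.sqrt_nonneg _) (ae_of_all _ fun x => Real.abs_le_sqrt ?_)
  have hi1 : Integrable fun x => X.ux w x * F x + F x * X.ux w x :=
    (w.lb_ux.integrable_mul hF2).add (hF2.integrable_mul w.lb_ux)
  have h1 := (hp.mul hp).two_mul_abs_le (hF2.integrable_mul hF2) hi1 x
  have hr : 0 < √c.μ := Real.sqrt_pos.2 hμ
  have hr2 : √c.μ * √c.μ = c.μ := Real.mul_self_sqrt hμ.le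
  have h2 : ∫ x, |X.ux w x * F x + F x * X.ux w x| ≤ energy c w / √c.μ := by
    rw [le_div_iff₀ hr, mul_comm, energy, ← integral_const_mul, ← integral_const_mul,
      ← integral_add (integrable_energy_left w) ((integrable_energy_right w).const_mul _)]
    refine integral_mono_ae (hi1.abs.const_mul _)
      ((integrable_energy_left w).add ((integrable_energy_right w).const_mul _)) ?_
    filter_upwards [hc, hF, posSet.q_nonneg hw] with x a b d
    simp only [a, b]
    set S := Real.sin (X.v w x / 2)
    set C := Real.cos (X.v w x / 2)
    set q := X.q w x
    set u := X.u w x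
    have e : |q * (S * C) * u + u * (q * (S * C))| = q * |2 * ((u * C) * S)| := by
      rw [show q * (S * C) * u + u * (q * (S * C)) = q * (2 * ((u * C) * S)) by ring, abs_mul,
        abs_of_nonneg d]
    rw [e]
    have k : √c.μ * |2 * ((u * C) * S)| ≤ (u * C) ^ 2 + c.μ * S ^ 2 := by
      have e' : c.μ * S ^ 2 = (√c.μ * S) ^ 2 := by rw [← hr2]; simp only [Real.sqrt_mul_self hr.le]; ring
      have e'' : √c.μ * |2 * ((u * C) * S)| = |2 * (u * C) * (√c.μ * S)| := by
        rw [show 2 * (u * C) * (√c.μ * S) = √c.μ * (2 * ((u * C) * S)) by ring, abs_mul √c.μ,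
          abs_of_pos hr]
      rw [e', e'', abs_le]
      constructor <;> nlinarith [sq_nonneg (u * C - √c.μ * S), sq_nonneg (u * C + √c.μ * S)]
    calc √c.μ * (q * |2 * ((u * C) * S)|) = q * (√c.μ * |2 * ((u * C) * S)|) := by ring
      _ ≤ q * ((u * C) ^ 2 + c.μ * S ^ 2) := by gcongr
      _ = _ := by ring
  have h3 : 2 * F x ^ 2 ≤ energy c w / √c.μ := by
    have := le_abs_self (F x * F x)
    nlinarith
  calc F x ^ 2 ≤ energy c w / √c.μ / 2 := by linarith
    _ = energy c w / (2 * √c.μ) := by rw [div_div, mul_comm]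

/-- The `G` part of the source is at most `g₀` times the density, against which the kernel has mass
at most `2√μ`; the `sin²` part is bounded by the energy since the kernel is at most `1`. The lower
bound `δ` of `q` serves only for integrability and does not enter the constant. -/
lemma abs_P_le {g₀ : ℝ} (hg : ∀ᵐ x, |G c (X.u w x)| ≤ g₀) (x : ℝ) :
    |P c w x| ≤ 1 / (2 * √c.μ) * (g₀ * (2 * √c.μ) + |c.s| / 2 * (energy c w / c.μ)) := by
  have hν : 0 < 1 / √c.μ := by positivity
  obtain ⟨δ, hδ, hq⟩ := id hw
  have hreg := region_of_norm_le hδ hq le_rfl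
  have hk := hreg.kerAdm hν
  obtain ⟨A, hA⟩ := hreg.src_lb (c := c)
  have hg0 : 0 ≤ g₀ := by
    obtain ⟨y, hy⟩ := hg.exists
    exact (abs_nonneg _).trans hy
  have i1 := hk.integrable hk.lb x
  have i2 := integrable_energy_right w
  have i2' := mu_mul_integral_le_energy (c := c) hw
  have hmass : ∫ y, kern (1 / √c.μ) (dens w) x y * dens w y ≤ 2 * √c.μ := by
    have a1 := hk.nl_Ioi_self_le x
    have a2 := hk.nl_Iic_self_le x
    rw [one_div_one_div] at a1 a2
    rw [nl] at a1 a2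
    rw [← intervalIntegral.integral_Iic_add_Ioi (b := x) i1.integrableOn i1.integrableOn]
    linarith
  have hE : ∫ y, Real.sin (X.v w y / 2) * (X.q w y * Real.sin (X.v w y / 2)) ≤ energy c w / c.μ := by
    rw [le_div_iff₀ hμ]; linarith
  rw [P, abs_mul, abs_of_nonneg (by positivity : 0 ≤ 1 / (2 * √c.μ))]
  gcongr
  rw [integrand_eq]
  calc |∫ y, kern (1 / √c.μ) (dens w) x y * src c w y|
      ≤ ∫ y, |kern (1 / √c.μ) (dens w) x y * src c w y| := abs_integral_le_integral_abs
    _ ≤ ∫ y, (g₀ * (kern (1 / √c.μ) (dens w) x y * dens w y) +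
          |c.s| / 2 * (Real.sin (X.v w y / 2) * (X.q w y * Real.sin (X.v w y / 2)))) := by
        refine integral_mono_ae (hk.integrable hA x).abs
          ((i1.const_mul _).add (i2.const_mul _)) ?_
        filter_upwards [hg, posSet.q_nonneg hw] with y h1 h2
        have hkp := kern_pos (1 / √c.μ) (dens w) x y
        have hk1 : kern (1 / √c.μ) (dens w) x y ≤ 1 := by
          rw [kern, Real.exp_le_one_iff, neg_mul]
          have := mul_nonneg hν.le (abs_nonneg (∫ r in x..y, dens w r))
          linarith
        rw [abs_mul, abs_of_pos hkp, src, abs_mul, abs_of_nonneg h2, dens]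
        set S := Real.sin (X.v w y / 2)
        set C := Real.cos (X.v w y / 2)
        set k := kern (1 / √c.μ) (dens w) x y
        have h3 : |G c (X.u w y) * C ^ 2 + c.s / 2 * S ^ 2| ≤ g₀ * C ^ 2 + |c.s| / 2 * S ^ 2 := by
          refine (abs_add_le _ _).trans ?_
          rw [abs_mul, abs_mul, abs_div, abs_two, abs_of_nonneg (sq_nonneg C),
            abs_of_nonneg (sq_nonneg S)]
          gcongr
        calc k * (|G c (X.u w y) * C ^ 2 + c.s / 2 * S ^ 2| * X.q w y)
            ≤ k * ((g₀ * C ^ 2 + |c.s| / 2 * S ^ 2) * X.q w y) := by gcongr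
          _ = g₀ * (k * (C ^ 2 * X.q w y)) + k * (|c.s| / 2 * S ^ 2 * X.q w y) := by ring
          _ ≤ g₀ * (k * (C ^ 2 * X.q w y)) + 1 * (|c.s| / 2 * S ^ 2 * X.q w y) := by gcongr
          _ = _ := by ring
    _ = g₀ * (∫ y, kern (1 / √c.μ) (dens w) x y * dens w y) +
          |c.s| / 2 * ∫ y, Real.sin (X.v w y / 2) * (X.q w y * Real.sin (X.v w y / 2)) := by
        rw [integral_add (i1.const_mul _) (i2.const_mul _), integral_const_mul, integral_const_mul]
    _ ≤ _ := by gcongr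

end Static

/-! ### Bounds along a solution -/

section Dynamic

variable {c : Coeffs} {x₀ : X} {T : ℝ} {w : ℝ → X} (hμ : 0 < c.μ)
  (h : SolOn (vf c) posSet x₀ T w)
include hμ h

lemma SolOn.compat (h0 : Compat x₀) {t : ℝ} (ht : t ∈ Icc 0 T) : Compat (w t) := by
  rw [compat_iff]
  have := eq_of_hasDerivWithinAt_zero
    (fun t ht => hasDeriv_defect hμ (h.deriv t ht) (vf_spec hμ (h.mem t ht))) ht
  rw [this, h.init]
  exact (compat_iff x₀).1 h0

lemma SolOn.energy_eq (h0 : Compat x₀) {t : ℝ} (ht : t ∈ Icc 0 T) :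
    energy c (w t) = energy c x₀ := by
  have := eq_of_hasDerivWithinAt_zero (f := fun τ => energy c (w τ))
    (fun t ht => hasDeriv_energy hμ (h.deriv t ht) (vf_spec hμ (h.mem t ht)) (h.mem t ht)
      (h.compat hμ h0 ht)) ht
  rw [← h.init]; exact this

/-- Formally `|q_t| ≤ Λ q` for each `ξ`, but `q(t)` is only an a.e. class. Gronwall is applied
instead to the integral of `q` over each set of finite measure, and the bounds on all these
integrals give the a.e. bounds. -/
lemma SolOn.q_bounds {Λ : ℝ} (h0 : ∀ᵐ x, X.q x₀ x = 1)
    (hΛ : ∀ t ∈ Icc 0 T, ∀ᵐ x, |1 / c.μ * (c.s / 2 + G c (X.u (w t) x) - P c (w t) x)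
      * Real.sin (X.v (w t) x)| ≤ Λ) {t : ℝ} (ht : t ∈ Icc 0 T) :
    ∀ᵐ x, Real.exp (-(Λ * t)) ≤ X.q (w t) x ∧ X.q (w t) x ≤ Real.exp (Λ * t) := by
  have key : ∀ s : Set ℝ, MeasurableSet s → volume s < ⊤ →
      Real.exp (-(Λ * t)) * volume.real s ≤ ∫ x in s, X.q (w t) x ∧
      ∫ x in s, X.q (w t) x ≤ Real.exp (Λ * t) * volume.real s := by
    intro s hs hsv
    -- Since `k² = k`, the integral over `s` is the `L²` pairing of `q k` with `k`, to which the
    -- differentiation lemma applies.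
    set k : ℝ → ℝ := s.indicator fun _ => 1 with hk
    have hkk : ∀ x, k x * k x = k x := fun x => by
      by_cases hx : x ∈ s <;> simp [hk, hx]
    have hk0 : ∀ x, 0 ≤ k x := fun x => indicator_nonneg (fun _ _ => zero_le_one) x
    obtain ⟨B, hB⟩ : ∃ B, LB 2 k B := by
      have hm : MemLp k 2 volume := memLp_indicator_const 2 hs 1 (Or.inr hsv.ne)
      exact ⟨_, hm.1, ENNReal.toReal_nonneg, (ENNReal.ofReal_toReal hm.2.ne).ge⟩
    have hset : ∀ z : X, ∫ x, X.q z x * k x * k x = ∫ x in s, X.q z x := by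
      intro z
      rw [← integral_indicator hs]
      congr 1; ext x
      by_cases hx : x ∈ s <;> simp [hk, hx]
    have hd : ∀ t ∈ Icc 0 T, HasDerivWithinAt (fun τ => ∫ x, X.q (w τ) x * k x * k x)
        (∫ x, X.q (vf c (w t)) x * k x * k x) (Icc 0 T) t := fun t ht =>
      ((((DL.q (h.deriv t ht)).mul (DL.const hB)).hasDerivWithinAt_integral
        (DL.const hB))).congr_deriv (by congr 1; ext x; ring)
    have hb : ∀ t ∈ Icc 0 T, |∫ x, X.q (vf c (w t)) x * k x * k x|
        ≤ Λ * ∫ x, X.q (w t) x * k x * k x := by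
      intro t ht
      have i1 : Integrable fun x => X.q (vf c (w t)) x * k x * k x :=
        ((X.lb_q _).mul hB).integrable_mul hB
      have i2 : Integrable fun x => X.q (w t) x * k x * k x :=
        ((X.lb_q _).mul hB).integrable_mul hB
      refine abs_integral_le_integral_abs.trans ?_
      rw [← integral_const_mul]
      refine integral_mono_ae i1.abs (i2.const_mul _) ?_
      filter_upwards [hΛ t ht, (vf_spec hμ (h.mem t ht)).q_eq, posSet.q_nonneg (h.mem t ht)]
        with x h1 h2 h3
      simp only [h2, mul_assoc _ (k x) (k x), hkk, abs_mul _ (k x), abs_mul _ (X.q (w t) x),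
        abs_of_nonneg h3, abs_of_nonneg (hk0 x)]
      rw [← mul_assoc]
      have := hk0 x
      gcongr
    have hfin := exp_bounds_of_abs_deriv_le hd hb ht
    have hinit : ∫ x in s, X.q (w 0) x = volume.real s := by
      rw [h.init, integral_congr_ae (g := fun _ => (1 : ℝ)) (ae_restrict_of_ae h0)]
      simp [Measure.real]
    rw [hset, hset, hinit] at hfin
    exact hfin
  have hint : ∀ (a : ℝ) (s : Set ℝ), MeasurableSet s → volume s < ⊤ →
      IntegrableOn (X.q (w t)) s ∧ IntegrableOn (fun _ => a) s := by
    intro a s _ hsv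
    refine ⟨?_, integrableOn_const hsv.ne⟩
    have : IsFiniteMeasure (volume.restrict s) := ⟨by simpa using hsv⟩
    exact ((X.lb_q (w t)).memLp.restrict s).integrable le_top
  have e1 : 0 ≤ᵐ[volume] fun x => X.q (w t) x - Real.exp (-(Λ * t)) := by
    refine ae_nonneg_of_forall_setIntegral_nonneg_of_sigmaFinite
      (fun s hs hsv => (hint 0 s hs hsv).1.sub (hint (Real.exp (-(Λ * t))) s hs hsv).2) fun s hs hsv => ?_
    rw [integral_sub (hint 0 s hs hsv).1 (hint (Real.exp (-(Λ * t))) s hs hsv).2]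
    have := (key s hs hsv).1
    simp only [integral_const, MeasurableSet.univ, measureReal_restrict_apply, univ_inter,
      smul_eq_mul]
    linarith
  have e2 : 0 ≤ᵐ[volume] fun x => Real.exp (Λ * t) - X.q (w t) x := by
    refine ae_nonneg_of_forall_setIntegral_nonneg_of_sigmaFinite
      (fun s hs hsv => (hint (Real.exp (Λ * t)) s hs hsv).2.sub (hint 0 s hs hsv).1) fun s hs hsv => ?_
    rw [integral_sub (hint (Real.exp (Λ * t)) s hs hsv).2 (hint 0 s hs hsv).1]
    have := (key s hs hsv).2
    simp only [integral_const, MeasurableSet.univ, measureReal_restrict_apply, univ_inter,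
      smul_eq_mul]
    linarith
  filter_upwards [e1, e2] with x h1 h2
  exact ⟨by simpa using h1, by simpa using h2⟩

end Dynamic

/-- A-priori bounds on bounded time intervals. -/
lemma exists_apriori {c : Coeffs} (hμ : 0 < c.μ) {x₀ : X} (h0 : Compat x₀)
    (hq0 : ∀ᵐ x, X.q x₀ x = 1) (T : ℝ) : ∃ δ R : ℝ, 0 < δ ∧
      ∀ T' ∈ Icc 0 T, ∀ w, SolOn (vf c) posSet x₀ T' w →
        ‖w T'‖ ≤ R ∧ ∀ᵐ x, δ ≤ X.q (w T') x := by
  set E := energy c x₀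
  set M := Real.sqrt (E / (2 * √c.μ))
  obtain ⟨K, hK, hG⟩ := G_lipschitz c M
  -- The constants are chosen without circularity: `E` gives `M` for `u`, `C₁` for `P` and the rate
  -- `Λ`, then `δ`, `Q` for `q`, then `N` for `∫ sin²(v/2)`. None depends on the norm being
  -- estimated; `|Λ|` avoids checking the sign of `Λ`.
  set C₁ := 1 / (2 * √c.μ) * (K * M * (2 * √c.μ) + |c.s| / 2 * (E / c.μ))
  set Λ := 1 / c.μ * (|c.s| / 2 + K * M + C₁)
  set Q := Real.exp (|Λ| * T)
  set δ := Real.exp (-(|Λ| * T))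
  set N := E / c.μ / δ
  have hM : 0 ≤ M := Real.sqrt_nonneg _
  obtain ⟨C, hC, hgrow, -⟩ := exists_bound_fullRHS hμ M δ Q N
  refine ⟨δ, gronwallBound ‖x₀‖ C C T, Real.exp_pos _, fun T' hT' w hw => ?_⟩
  have hqb : ∀ t ∈ Icc 0 T', ∀ᵐ x, δ ≤ X.q (w t) x ∧ X.q (w t) x ≤ Q := by
    intro t ht
    have hΛb : ∀ t ∈ Icc 0 T', ∀ᵐ x, |1 / c.μ * (c.s / 2 + G c (X.u (w t) x) - P c (w t) x)
        * Real.sin (X.v (w t) x)| ≤ Λ := by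
      intro t ht
      have hu := lb_u_of_energy (hw.mem t ht) hμ (hw.compat hμ h0 ht)
      rw [hw.energy_eq hμ h0 ht] at hu
      have hGu : ∀ᵐ x, |G c (X.u (w t) x)| ≤ K * M := by
        filter_upwards [hu.ae_le] with x hx
        have := hG (X.u (w t) x) 0 hx (by simpa using hM)
        rw [G_zero, sub_zero, sub_zero] at this
        exact this.trans (by gcongr)
      have hP := abs_P_le (hw.mem t ht) hμ hGu
      rw [hw.energy_eq hμ h0 ht] at hP
      filter_upwards [hGu] with x hx
      rw [abs_mul, abs_mul, abs_of_pos (by positivity : 0 < 1 / c.μ)]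
      refine (mul_le_of_le_one_right (by positivity) (Real.abs_sin_le_one _)).trans ?_
      simp only [Λ]
      gcongr
      refine (abs_sub _ _).trans (add_le_add ((abs_add_le _ _).trans (add_le_add ?_ hx)) (hP x))
      rw [abs_div, abs_two]
    have hle : |Λ * t| ≤ |Λ| * T := by
      rw [abs_mul, abs_of_nonneg ht.1]
      gcongr
      exact ht.2.trans hT'.2
    filter_upwards [hw.q_bounds hμ hq0 hΛb ht] with x hx
    exact ⟨(Real.exp_le_exp.2 (by linarith [(abs_le.1 hle).2])).trans hx.1,
      hx.2.trans (Real.exp_le_exp.2 (abs_le.1 hle).2)⟩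
  have hreg : ∀ t ∈ Icc 0 T', Region M δ Q N (w t) := by
    intro t ht
    have hu := lb_u_of_energy (hw.mem t ht) hμ (hw.compat hμ h0 ht)
    rw [hw.energy_eq hμ h0 ht] at hu
    refine ⟨Real.exp_pos _, hu, ?_, ?_, ?_⟩
    · refine LB.of_bound (X.lb_q _).meas (Real.exp_pos _).le ?_
      filter_upwards [hqb t ht, posSet.q_nonneg (hw.mem t ht)] with x hx hx'
      rw [abs_of_nonneg hx']; exact hx.2
    · filter_upwards [hqb t ht] with x hx using hx.1
    · have h1 := mu_mul_integral_le_energy (c := c) (hw.mem t ht)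
      rw [hw.energy_eq hμ h0 ht] at h1
      simp only [N]
      rw [le_div_iff₀ (Real.exp_pos _), le_div_iff₀ hμ, mul_comm, mul_comm _ δ,
        ← integral_const_mul]
      refine le_trans ?_ h1
      gcongr ?_ * ?_
      refine integral_mono_ae ((integrable_sin_sq _).const_mul _) (integrable_energy_right _) ?_
      filter_upwards [hqb t ht] with x hx
      calc δ * Real.sin (X.v (w t) x / 2) ^ 2
          ≤ X.q (w t) x * Real.sin (X.v (w t) x / 2) ^ 2 := by gcongr; exact hx.1
        _ = _ := by ring
  have hT'I : T' ∈ Icc 0 T' := ⟨hT'.1, le_rfl⟩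
  refine ⟨?_, by filter_upwards [hqb T' hT'I] with x hx using hx.1⟩
  -- On the region just obtained the growth is linear, `‖w'‖ ≤ C ‖w‖ + C`, with a fixed `C`.
  have hgr := norm_le_gronwallBound_of_norm_deriv_right_le (K := C) (ε := C) (δ := ‖x₀‖)
    hw.continuousOn (f' := fun t => vf c (w t))
    (fun t ht => hasDerivWithinAt_Ici_of_Icc (hw.deriv t (Ico_subset_Icc_self ht)) ht)
    (by rw [hw.init]) (fun t ht => by
      have ht' := Ico_subset_Icc_self ht
      have := hgrow _ _ (hreg t ht') (vf_spec hμ (hw.mem t ht'))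
      linarith) T' hT'I
  rw [sub_zero] at hgr
  exact hgr.trans (gronwallBound_mono (norm_nonneg _) hC hC hT'.2)

/-- Global existence for data satisfying `u_ξ = q sin(v) / 2` and `q = 1`. -/
theorem exists_global {c : Coeffs} (hμ : 0 < c.μ) {x₀ : X} (h0 : Compat x₀)
    (hq0 : ∀ᵐ x, X.q x₀ x = 1) : ∃ w : ℝ → X, w 0 = x₀ ∧
      ∀ t ∈ Ici (0 : ℝ), w t ∈ posSet ∧ HasDerivWithinAt w (vf c (w t)) (Ici 0) t := by
  refine exists_global_of_apriori (vf_locallyLipschitz hμ)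
    ⟨1, one_pos, hq0.mono fun x hx => hx.ge⟩ fun T _ => ?_
  obtain ⟨δ, R, hδ, h⟩ := exists_apriori hμ h0 hq0 T
  obtain ⟨ε, K, L, hε, h'⟩ := vf_control hμ hδ R
  exact ⟨ε, K, L, hε, fun T' hT' w hw => h' _ (h T' hT' w hw).1 (h T' hT' w hw).2⟩

end DualPowerCH

/-! ### The Lagrangian change of variables and the initial data -/

namespace DualPowerCH

open Filter Topology
open scoped ENNReal

section Lagrangian

variable {g y : ℝ → ℝ} (hg : MemLp g 2 volume) (hy : ∀ ξ, ∫ x in (0 : ℝ)..y ξ, (1 + g x ^ 2) = ξ)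

include hg in
lemma intervalIntegrable_one_add_sq (a b : ℝ) :
    IntervalIntegrable (fun x => 1 + g x ^ 2) volume a b :=
  intervalIntegrable_const.add hg.integrable_sq.intervalIntegrable

include hg in
lemma strictMono_integral_one_add_sq : StrictMono fun x : ℝ => ∫ t in (0 : ℝ)..x, (1 + g t ^ 2) := by
  intro a b hab
  have h := intervalIntegrable_one_add_sq hg
  rw [← sub_pos, intervalIntegral.integral_interval_sub_left (h 0 b) (h 0 a)]
  have := intervalIntegral.integral_mono_on hab.le intervalIntegrable_const (h a b)
    (fun x _ => (by linarith [sq_nonneg (g x)] : (1 : ℝ) ≤ 1 + g x ^ 2))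
  rw [intervalIntegral.integral_const, smul_eq_mul, mul_one] at this
  linarith

include hg in
lemma aemeasurable_density : AEMeasurable (fun x => ENNReal.ofReal (1 + g x ^ 2)) volume :=
  ((hg.1.aemeasurable.pow_const 2).const_add 1).ennreal_ofReal

include hg hy

lemma lt_iff_integral_lt (a ξ : ℝ) : a < y ξ ↔ ∫ t in (0 : ℝ)..a, (1 + g t ^ 2) < ξ := by
  rw [← (strictMono_integral_one_add_sq hg).lt_iff_lt, hy]

lemma monotone_lagrangian : Monotone y := fun a b hab => by
  rw [← (strictMono_integral_one_add_sq hg).le_iff_le, hy, hy]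
  exact hab

/-- The change of variables `x = y(ξ)`. -/
lemma map_lagrangian :
    Measure.map y volume = volume.withDensity fun x => ENNReal.ofReal (1 + g x ^ 2) := by
  have hm : Measurable y := (monotone_lagrangian hg hy).measurable
  have h := intervalIntegrable_one_add_sq hg
  have hpre : ∀ a b, Measure.map y volume (Ioc a b)
      = ENNReal.ofReal (∫ t in a..b, (1 + g t ^ 2)) := by
    intro a b
    have : y ⁻¹' Ioc a b
        = Ioc (∫ t in (0 : ℝ)..a, (1 + g t ^ 2)) (∫ t in (0 : ℝ)..b, (1 + g t ^ 2)) := by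
      ext ξ
      simp only [mem_preimage, mem_Ioc]
      rw [lt_iff_integral_lt hg hy, ← not_lt, lt_iff_integral_lt hg hy, not_lt]
    rw [Measure.map_apply hm measurableSet_Ioc, this, Real.volume_Ioc,
      intervalIntegral.integral_interval_sub_left (h 0 b) (h 0 a)]
  refine Measure.ext_of_Ioc' _ _ (fun a b _ => ?_) fun a b hab => ?_
  · rw [hpre]; exact ENNReal.ofReal_ne_top
  · rw [hpre, withDensity_apply _ measurableSet_Ioc, intervalIntegral.integral_of_le hab.le,
      ofReal_integral_eq_lintegral_ofReal (h a b).1 (ae_of_all _ fun x => by positivity)]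

/-- Null sets pull back to null sets, so composing an a.e. class with `y` is meaningful. -/
lemma quasiMeasurePreserving_lagrangian : Measure.QuasiMeasurePreserving y volume volume :=
  ⟨(monotone_lagrangian hg hy).measurable, by
    rw [map_lagrangian hg hy]; exact withDensity_absolutelyContinuous _ _⟩

lemma integral_comp_lagrangian {h : ℝ → ℝ} (hh : AEStronglyMeasurable h volume) :
    ∫ ξ, h (y ξ) = ∫ x, h x * (1 + g x ^ 2) := by
  have hh' : AEStronglyMeasurable h (Measure.map y volume) :=
    hh.mono_ac (quasiMeasurePreserving_lagrangian hg hy).absolutelyContinuous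
  rw [← integral_map (monotone_lagrangian hg hy).measurable.aemeasurable hh',
    map_lagrangian hg hy, integral_withDensity_eq_integral_toReal_smul₀
      (aemeasurable_density hg) (ae_of_all _ fun _ => ENNReal.ofReal_lt_top)]
  congr 1; ext x
  rw [ENNReal.toReal_ofReal (by positivity), smul_eq_mul, mul_comm]

lemma memLp_comp_lagrangian {h : ℝ → ℝ} (hh : AEStronglyMeasurable h volume)
    (hi : Integrable fun x => h x ^ 2 * (1 + g x ^ 2)) : MemLp (fun ξ => h (y ξ)) 2 volume := by
  have hh' : AEStronglyMeasurable h (Measure.map y volume) :=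
    hh.mono_ac (quasiMeasurePreserving_lagrangian hg hy).absolutelyContinuous
  refine (memLp_map_measure_iff hh' (monotone_lagrangian hg hy).measurable.aemeasurable).1 ?_
  rw [memLp_two_iff_integrable_sq hh', map_lagrangian hg hy,
    integrable_withDensity_iff_integrable_smul₀' (aemeasurable_density hg)
      (ae_of_all _ fun _ => ENNReal.ofReal_lt_top)]
  refine hi.congr (ae_of_all _ fun x => ?_)
  simp only [smul_eq_mul]
  rw [ENNReal.toReal_ofReal (by positivity), mul_comm]

/-- Substituting `x = y(ξ)` turns `g dx` into `g(y)/(1 + g(y)²) dξ`; this density is bounded by `1`,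
so it is locally integrable. -/
lemma IsPrim.comp_lagrangian {F : ℝ → ℝ} (hF : IsPrim F g) :
    IsPrim (fun ξ => F (y ξ)) (fun ξ => g (y ξ) / (1 + g (y ξ) ^ 2)) := by
  have hm : AEStronglyMeasurable (fun x => g x / (1 + g x ^ 2)) volume :=
    (hg.1.aemeasurable.div ((hg.1.aemeasurable.pow_const 2).const_add 1)).aestronglyMeasurable
  have hb : LB ⊤ (fun ξ => g (y ξ) / (1 + g (y ξ) ^ 2)) 1 := by
    refine LB.of_bound (hm.comp_quasiMeasurePreserving (quasiMeasurePreserving_lagrangian hg hy))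
      zero_le_one (ae_of_all _ fun ξ => ?_)
    rw [abs_div, abs_of_pos (by positivity : 0 < 1 + g (y ξ) ^ 2), div_le_one (by positivity), abs_le]
    constructor <;> nlinarith [sq_nonneg (g (y ξ) - 1), sq_nonneg (g (y ξ) + 1)]
  refine ⟨hb.locallyIntegrable, ?_⟩
  have key : ∀ a b, a ≤ b →
      F (y b) - F (y a) = ∫ ξ in a..b, g (y ξ) / (1 + g (y ξ) ^ 2) := by
    intro a b hab
    have hpre : y ⁻¹' Ioc (y a) (y b) = Ioc a b := by
      ext ξ
      simp only [mem_preimage, mem_Ioc]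
      rw [lt_iff_integral_lt hg hy, ← not_lt, lt_iff_integral_lt hg hy, not_lt, hy, hy]
    have := integral_comp_lagrangian hg hy (hm.indicator (measurableSet_Ioc (a := y a) (b := y b)))
    rw [hF.sub_eq, intervalIntegral.integral_of_le (monotone_lagrangian hg hy hab),
      intervalIntegral.integral_of_le hab, ← integral_indicator measurableSet_Ioc,
      ← integral_indicator measurableSet_Ioc, ← hpre]
    refine Eq.trans ?_ this.symm
    congr 1; ext x
    by_cases hx : x ∈ Ioc (y a) (y b)
    · rw [indicator_of_mem hx, indicator_of_mem hx]
      field_simp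
    · rw [indicator_of_notMem hx, indicator_of_notMem hx, zero_mul]
  intro a b
  rcases le_total a b with hab | hab
  · exact key a b hab
  · rw [intervalIntegral.integral_symm, ← key b a hab]; ring

end Lagrangian

/-- Jordan's inequality `(2/π)|θ| ≤ |sin θ|` at `θ = arctan x`, where `sin² θ = x²/(1 + x²)`. It
shows that the initial `v` is square integrable in `ξ`. -/
lemma sq_arctan_mul_le (x : ℝ) :
    Real.arctan x ^ 2 * (1 + x ^ 2) ≤ (Real.pi / 2) ^ 2 * x ^ 2 := by
  have h1 : |Real.arctan x| ≤ Real.pi / 2 :=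
    abs_le.2 ⟨(Real.neg_pi_div_two_lt_arctan x).le, (Real.arctan_lt_pi_div_two x).le⟩
  have h2 := Real.mul_abs_le_abs_sin h1
  have h3 : (2 / Real.pi * |Real.arctan x|) ^ 2 ≤ |Real.sin (Real.arctan x)| ^ 2 := by
    have := Real.pi_pos
    gcongr
  rw [mul_pow, sq_abs, sq_abs, Real.sin_arctan, div_pow x,
    Real.sq_sqrt (by positivity), le_div_iff₀ (by positivity)] at h3
  calc Real.arctan x ^ 2 * (1 + x ^ 2)
      = (Real.pi / 2) ^ 2 * ((2 / Real.pi) ^ 2 * Real.arctan x ^ 2 * (1 + x ^ 2)) := by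
        have := Real.pi_pos.ne'
        field_simp
    _ ≤ _ := by gcongr

/-- The initial data define a point of `X` which satisfies the compatibility condition. -/
lemma exists_initial (u₀ : H1) : ∃ x₀ : X, Compat x₀ ∧
    (∀ᵐ ξ, X.u x₀ ξ = H1.toFun u₀ (y₀ u₀ ξ)) ∧
    (∀ᵐ ξ, X.v x₀ ξ = 2 * Real.arctan (H1.wderiv u₀ (y₀ u₀ ξ))) ∧ ∀ᵐ ξ, X.q x₀ ξ = 1 := by
  set g := H1.wderiv u₀
  set y := y₀ u₀
  have hg : MemLp g 2 volume := Lp.memLp u₀.1.2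
  have hy : ∀ ξ, ∫ x in (0 : ℝ)..y ξ, (1 + g x ^ 2) = ξ := y₀_spec u₀
  have hqmp := quasiMeasurePreserving_lagrangian hg hy
  have hgm := hg.1.aemeasurable
  have hg2 := hg.integrable_sq
  obtain ⟨F, hF, hp⟩ := H1.exists_isPrim u₀
  have hF2 : LB 2 F ‖u₀.1.1‖ := (LB.of_Lp u₀.1.1).congr hF.symm
  have lbo : ∀ {f : ℝ → ℝ}, MemLp f 2 volume → ∃ B, LB 2 f B := fun hm =>
    ⟨_, hm.1, ENNReal.toReal_nonneg, (ENNReal.ofReal_toReal hm.2.ne).ge⟩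
  have hFc := hp.continuous
  -- In the variable `x` the integrand is `F² + F² g²`; the Sobolev bound on `F²` controls the
  -- second term.
  obtain ⟨A, hA⟩ := lbo (memLp_comp_lagrangian hg hy hFc.aestronglyMeasurable (by
    refine (hF2.integrable_sq.add (hg2.const_mul (‖u₀.1.1‖ * ‖u₀.1.2‖))).mono'
      (((hFc.aemeasurable.pow_const 2).mul
        ((hgm.pow_const 2).const_add 1)).aestronglyMeasurable) (ae_of_all _ fun x => ?_)
    have := hp.lb_top hF2 (LB.of_Lp u₀.1.2) x
    rw [Real.norm_of_nonneg (by positivity), mul_add, mul_one]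
    simp only [Pi.add_apply]
    gcongr))
  obtain ⟨B, hB⟩ := lbo (memLp_comp_lagrangian hg hy
      (h := fun x => g x / (1 + g x ^ 2))
      (hgm.div ((hgm.pow_const 2).const_add 1)).aestronglyMeasurable (by
    refine hg2.mono' ((((hgm.div ((hgm.pow_const 2).const_add 1)).pow_const 2).mul
        ((hgm.pow_const 2).const_add 1)).aestronglyMeasurable) (ae_of_all _ fun x => ?_)
    rw [Real.norm_of_nonneg (by positivity), div_pow, div_mul_eq_mul_div,
      div_le_iff₀ (by positivity)]
    nlinarith [mul_nonneg (sq_nonneg (g x)) (sq_nonneg (g x)),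
      mul_nonneg (mul_nonneg (sq_nonneg (g x)) (sq_nonneg (g x))) (sq_nonneg (g x))]))
  have ham : AEMeasurable (fun x => 2 * Real.arctan (g x)) volume :=
    (Real.measurable_arctan.comp_aemeasurable hgm).const_mul 2
  obtain ⟨C, hC⟩ := lbo (memLp_comp_lagrangian hg hy ham.aestronglyMeasurable (by
    refine (hg2.const_mul (4 * (Real.pi / 2) ^ 2)).mono' (((ham.pow_const 2).mul
        ((hgm.pow_const 2).const_add 1)).aestronglyMeasurable) (ae_of_all _ fun x => ?_)
    rw [Real.norm_of_nonneg (by positivity)]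
    nlinarith [sq_arctan_mul_le (g x)]))
  have hD : LB ⊤ (fun ξ => 2 * Real.arctan (g (y ξ))) Real.pi := by
    refine LB.of_bound hC.meas Real.pi_pos.le (ae_of_all _ fun ξ => ?_)
    rw [abs_le]
    constructor <;>
      linarith [Real.neg_pi_div_two_lt_arctan (g (y ξ)), Real.arctan_lt_pi_div_two (g (y ξ))]
  have hE : LB ⊤ (fun _ : ℝ => (1 : ℝ)) 1 :=
    LB.of_bound aestronglyMeasurable_const zero_le_one (by simp)
  obtain ⟨x₀, h1, h2, h3, h4⟩ := X.exists_of_functions (hp.comp_lagrangian hg hy) hA hB hC hD hE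
  refine ⟨x₀, ?_, ?_, h3, h4⟩
  -- With `v = 2 arctan g` and `q = 1`, both sides of the compatibility relation equal `g/(1 + g²)`.
  · filter_upwards [h2, h3, h4] with ξ e2 e3 e4
    rw [e2, e3, e4, mul_div_cancel_left₀ _ two_ne_zero, Real.sin_arctan, Real.cos_arctan,
      div_mul_div_comm, Real.mul_self_sqrt (by positivity), mul_one, one_mul]
  · filter_upwards [h1, hqmp.ae hF] with ξ e1 e2
    rw [e1, e2]

end DualPowerCH

/-! ### Global existence and uniqueness -/

theorem theorem3p1 (c : DualPowerCH.Coeffs) (hμ : 0 < c.μ) (u₀ : DualPowerCH.H1) :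
    ∃ w : ℝ → DualPowerCH.X, DualPowerCH.IsGlobalSolution c u₀ w ∧
      ∀ z : ℝ → DualPowerCH.X, DualPowerCH.IsGlobalSolution c u₀ z → Set.EqOn z w (Set.Ici 0) := by
  open DualPowerCH in
  obtain ⟨x₀, h0, hu, hv, hq⟩ := exists_initial u₀
  obtain ⟨w, hw0, hw⟩ := exists_global hμ h0 hq
  refine ⟨w, ⟨fun t ht => ⟨_, (hw t ht).2, (vf_spec hμ (hw t ht).1).toIsRHS⟩, hw0 ▸ hu, hw0 ▸ hv,
    hw0 ▸ hq⟩, fun z hz t ht => ?_⟩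
  have hz0 : z 0 = x₀ := by
    have eu : X.u (z 0) =ᵐ[volume] X.u x₀ := by
      filter_upwards [hz.u_init, hu] with ξ h1 h2 using h1.trans h2.symm
    refine X.ext_ae eu (X.ux_congr eu) ?_ ?_
    · filter_upwards [hz.v_init, hv] with ξ h1 h2 using h1.trans h2.symm
    · filter_upwards [hz.q_init, hq] with ξ h1 h2 using h1.trans h2.symm
  -- The condition `τ ≥ 0` is moved under the quantifier so that the derivative can be chosen as a
  -- function on all of `ℝ`, with value `0` irrelevant at negative times.
  have hz' : ∀ τ : ℝ, ∃ w' : X, τ ∈ Ici (0 : ℝ) →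
      HasDerivWithinAt z w' (Ici 0) τ ∧ IsRHS c (z τ) w' := fun τ => by
    by_cases hτ : τ ∈ Ici (0 : ℝ)
    · obtain ⟨w', h'⟩ := hz.ode τ hτ
      exact ⟨w', fun _ => h'⟩
    · exact ⟨0, fun h => absurd h hτ⟩
  choose z' hz' using hz'
  have hsol : SolOn (vf c) posSet x₀ t w := ⟨hw0, fun τ hτ => (hw τ hτ.1).1,
    fun τ hτ => (hw τ hτ.1).2.mono Icc_subset_Ici_self⟩
  -- Positivity of `q` is known only for `w`. For `z`, the derivative is identified with the vector
  -- field just at times when `z` lies in `posSet`, because the right-hand side is unique.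
  exact SolOn.eqOn_of_locallyLipschitz (vf_locallyLipschitz hμ) hsol hz0
    (fun τ hτ => (hz' τ hτ.1).1.mono Icc_subset_Ici_self)
    (fun τ hτ hpos => (hz' τ hτ.1).2.unique (vf_spec hμ hpos).toIsRHS) ⟨ht, le_rfl⟩
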